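/- **Setting.** Let $(W,S)$ be a Coxeter system and $V$ a finite-dimensional realization of it over a field $\Bbbk$ which is faithful, balanced and reflection faithful and satisfies generalized Demazure surjectivity. Put $R=\mathrm{Sym}(V)$, graded with $V$ in degree one. For $I\subset S$ finitary ($W_I$ finite) let $w_I$ be the longest element of $W_I$, $\ell(I)=\ell(w_I)$, $R^I=R^{W_I}$, $\partial_w$ the Demazure operator of $w\in W$ and $\partial_I=\partial_{w_I}$. For a double coset $p$ let $\underline p$ be its minimal element; for an $(I,J)$-coset $p$ put $\mathrm{LR}(p)=I\cap \underline p J\underline p^{-1}$ and $\mathrm{RR}(p)=\underline p^{-1}I\underline p\cap J$. For $L$ finitary, a polynomial $P$ is *normalized for $L$* if it is homogeneous of degree $\ell(L)$ and $\partial_L(P)=1$. A singlestep expression $[I_0,\dots,I_d]$ is a sequence of finitary subsets such that $I_j$ and $I_{j+1}$ differ by adding or removing one element; $0\le j<d$ is *ascending* if $I_j\subset I_{j+1}$. Its Bott–Samelson bimodule is $\mathrm{BS}(I_\bullet)=R^{I_0}\otimes R^{I_1}\otimes\cdots\otimes R^{I_d}$, where the tensor product of $R^{I_j}$ and $R^{I_{j+1}}$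 is over $R^{I_j\cup I_{j+1}}$, and $1^\otimes=1\otimes\cdots\otimes1$. The expression is reduced for the $(I_0,I_d)$-coset containing $w_{I_0}\prod_{j\text{ ascending}}w_{I_j}^{-1}w_{I_{j+1}}$ if lengths add in this product. **Sprinkled paths.** Fix a singlestep expression $I_\bullet=[I_0,\dots,I_d]$. A path $t_\bullet$ subordinate to $I_\bullet$ consists of $(I_0,I_j)$-cosets $t_j$, $0\le j\le d$, with $t_0=W_{I_0}$, $t_j\subset t_{j+1}$ if $I_j\subset I_{j+1}$ and $t_j\supset t_{j+1}$ if $I_j\supset I_{j+1}$; its terminus is $t_d$, and two paths are coterminal if they have the same terminus. For $j$ ascending put $\mathfrak l_j=\underline{t_{j+1}}^{-1}\mathrm{LR}(t_j)\underline{t_{j+1}}$ and $\mathfrak r_{j+1}=\mathrm{RR}(t_{j+1})$. A sprinkled path $(t_\bullet,y_\bullet)$ is a subordinate path with elements $y_j\in W_{\mathfrak r_{j+1}}$, for $j$ ascending, that are minimal in $W_{\mathfrak l_j}y_j$. Its dual sequence is $y_j^\circ=w_{I_j}\,\underline{t_j}^{-1}\,\underline{t_{j+1}}\,y_j\,w_{I_{j+1}}$,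 for $j$ ascending. Fix a strict total order $\triangleleft$ on $W$ with $x\triangleleft x'$ whenever $\ell(x)<\ell(x')$. For coterminal sprinkled paths, $(t_\bullet,y_\bullet)\prec(u_\bullet,z_\bullet)$ means that there is an ascending $j$ with $y_j^\circ\triangleleft z_j^\circ$ and $y_i^\circ=z_i^\circ$ for all ascending $i<j$. **The dual sprinkle element.** For a sprinkled path $(u_\bullet,z_\bullet)$ with dual sequence $z^\circ_\bullet$ choose, for each ascending $j$, a polynomial $P_j$ normalized for $I_{j+1}$. Then $$b(u_\bullet,z_\bullet)=1\otimes b_1\otimes b_2\otimes\cdots\otimes b_d\in\mathrm{BS}(I_\bullet),$$ where $b_j=\partial_{I_j}\partial_{z_j^\circ}(P_j)$ if $1\le j<d$ is ascending, and $b_j=1$ otherwise. **Diagrams.** Morphisms are drawn as diagrams with oriented coloured strands, read from bottom to top, and evaluated as maps of Bott–Samelson bimodules as follows. For $A=K\cup\{s\}$, $s\notin K$, $A$ finitary: the counterclockwise cap $[A,K,A]\to[A]$ is the Frobenius trace $\partial_{w_Aw_K^{-1}}:R^K\to R^A$; the counterclockwise cup $[A]\to[A,K,A]$ is the inclusion $R^A\subset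 R^K$; the clockwise cap $[K,A,K]\to[K]$ is multiplication $R^K\otimes_{R^A}R^K\to R^K$; the clockwise cup $[K]\to[K,A,K]$ is $f\mapsto\sum_i c_i\otimes d_if$ for dual bases $(c_i),(d_i)$ of $R^K$ over $R^A$ with respect to the trace. For $A=K\cup\{s\}$, $C=K\cup\{t\}$, $s\ne t$ not in $K$, $L=A\cup C$ finitary: the upward crossing $[K,A,L]\to[K,C,L]$ and the downward crossing $[L,A,K]\to[L,C,K]$ are the isomorphisms preserving $1^\otimes$; the right-facing crossing $[A,L,C]\to[A,K,C]$ is multiplication $R^A\otimes_{R^L}R^C\to R^K$; the left-facing crossing $[A,K,C]\to[A,L,C]$ is $f\mapsto\sum_ic_i\otimes\partial_{w_Cw_K^{-1}}(fd_i)$ for dual bases of $R^A$ over $R^L$. A polynomial $f\in R^I$ in a region $I$ is multiplication by $f$ there. The duality $\mathcal D$ flips a diagram upside-down and reverses orientations. A diagram is *sinister* if it consists of left-facing crossings and counterclockwise caps only. **Rex moves.** A rex move is a composition of upward crossings, downward crossings, and, for each switchback relation $$[L\setminus u_0+u_0-u_d]\leftrightharpoons[L\setminus u_0-u_1+u_0-u_2+u_1-\cdots-u_d+u_{d-1}],$$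 the sinister diagram from right to left and its dual from left to right (applied anywhere inside an expression). Here $L$ is finitary, $u_0,\dots,u_d\in L$ with $d\ge1$, $u_i\neq u_{i+1}$, $u_{i+1}=w_{L\setminus u_i}u_{i-1}w_{L\setminus u_i}$ for $1\le i<d$, $u_d\ne w_Lu_0w_L$, and the right-hand side is a reduced expression for the $(L\setminus u_0,L\setminus u_d)$-coset containing $w_L$. **Light leaves.** Let $p\subset q$ be an $(I_0,J)$-coset and an $(I_0,Js)$-coset, where $Js=J\cup\{s\}$. Let $z$ be the $(I_0,\mathrm{RR}(q))$-coset of $\underline q$, $m$ the $(\mathrm{RR}(q),J)$-coset of $\underline q^{-1}\underline p$, and $n$ the $(\mathrm{RR}(q),Js)$-coset of the identity. Choose a reduced expression $Z$ of $z$; an expression $X_m=[\mathrm{RR}(q)-t_1-\dots-t_l]\circ K_\bullet\circ[\mathrm{RR}(m)+u_1+\dots+u_r]$ for $m$, with $K_\bullet$ a reduced expression of the $(\mathrm{LR}(m),\mathrm{RR}(m))$-coset of $\underline m$, the first factor ending in $\mathrm{LR}(m)$ and the last in $J$; an expression $X_n=[\mathrm{RR}(q)+v_1+\dots+v_k]$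 ending in $Js$; and a sinister diagram $E:X_m\circ[J,Js]\to X_n$. The single step light leaf with polynomial $f\in R^{\mathrm{LR}(m)}$ for $[p,q]$ is $\mathrm{id}_Z\otimes E$ with $f$ placed in the leftmost $\mathrm{LR}(m)$-region of the bottom of $E$; the single step light leaf for $[q,p]$ is $\mathrm{id}_Z\otimes\big((\mathrm{id}_{X_m}\otimes\text{clockwise cap})\circ(\mathcal D(E)\otimes\mathrm{id}_{[Js,J]})\big)$. For a sprinkled path $(t_\bullet,y_\bullet)$ the light leaf $\mathbb{LL}(t_\bullet,y_\bullet)$ is built inductively, starting with the identity of $[I_0]$: given the light leaf $[I_0,\dots,I_j]\to X'$ of the part up to $j$, one tensors it on the right with the identity of $[I_j,I_{j+1}]$, applies a rex move $X'\to X$ (tensored with the identity) and then a single step light leaf $X\circ[I_j,I_{j+1}]\to X''$ for $[t_j,t_{j+1}]$; for ascending $j$ it carries the polynomial $\partial_{\mathfrak l_j}\partial_{y_j}(P)$, with $P$ normalized for $\mathfrak r_{j+1}$. **Proposition.** The relation $\prec$ is a strict total order on the set of sprinkled paths subordinate to $I_\bullet$ with a given terminus. Let $(t_\bullet,y_\bullet)$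 and $(u_\bullet,z_\bullet)$ be coterminal sprinkled paths subordinate to $I_\bullet$. Then, for every light leaf $\mathbb{LL}(t_\bullet,y_\bullet)$ obtained by any of the choices above and every independent choice of the normalized polynomials $P_j$ in $b(u_\bullet,z_\bullet)$, the evaluation of $\mathbb{LL}(t_\bullet,y_\bullet)$ satisfies $$\mathbb{LL}(t_\bullet,y_\bullet)\big(b(u_\bullet,z_\bullet)\big)=\begin{cases}1^\otimes&\text{if }(t_\bullet,y_\bullet)=(u_\bullet,z_\bullet),\\0&\text{if }(t_\bullet,y_\bullet)\prec(u_\bullet,z_\bullet).\end{cases}$$ -/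

import Mathlib

noncomputable section

namespace SingularSoergel

open scoped TensorProduct Polynomial

/-! ### Coxeter combinatorics: parabolic subgroups, double cosets, singlestep expressions

Sets of simple reflections are sets `I : Set B` of indices of a Coxeter system. -/

section Coxeter

variable {B W : Type*} [Group W] {M : CoxeterMatrix B} (cs : CoxeterSystem M W)

/-- The parabolic subgroup `W_I`. -/
def parabolic (I : Set B) : Subgroup W := Subgroup.closure (cs.simple '' I)

/-- `I` is finitary: `W_I` is finite. -/
def Finitary (I : Set B) : Prop := Finite (parabolic cs I)

open Classical in
/-- The longest element `w_I` of `W_I` (for finitary `I`). -/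
def longest (I : Set B) : W :=
  if h : ∃ w ∈ parabolic cs I, ∀ v ∈ parabolic cs I, cs.length v ≤ cs.length w then h.choose else 1

/-- The double coset `W_I x W_J`. An `(I,J)`-coset is a set of this form. -/
def coset (I J : Set B) (x : W) : Set W :=
  DoubleCoset.doubleCoset x (parabolic cs I : Set W) (parabolic cs J : Set W)

open Classical in
/-- The minimal length element of a (double) coset. -/
def minElt (p : Set W) : W :=
  if h : p.Nonempty then Function.argminOn cs.length p h else 1

/-- The left redundancy `I ∩ x J x⁻¹` of an `(I,J)`-coset with minimal element `x`. -/
def leftRed (I J : Set B) (p : Set W) : Set B :=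
  {i | i ∈ I ∧ ∃ j ∈ J, cs.simple i = minElt cs p * cs.simple j * (minElt cs p)⁻¹}

/-- The right redundancy `x⁻¹ I x ∩ J` of an `(I,J)`-coset with minimal element `x`. -/
def rightRed (I J : Set B) (p : Set W) : Set B :=
  {j | j ∈ J ∧ ∃ i ∈ I, cs.simple j = (minElt cs p)⁻¹ * cs.simple i * minElt cs p}

/-- One adds or removes exactly one simple reflection to get from `I` to `J`. -/
def SingleStep (I J : Set B) : Prop :=
  (∃ s, s ∉ I ∧ J = insert s I) ∨ (∃ s, s ∉ J ∧ I = insert s J)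

/-! An expression `[I, J₁, …, J_d]` is recorded as its first region `I` together with the list
`[J₁, …, J_d]` of the remaining regions. -/

/-- The last region of an expression. -/
def lastRegion : Set B → List (Set B) → Set B
  | I, [] => I
  | _, J :: w => lastRegion J w

/-- Singlestep expressions with finitary regions. -/
def IsExpr : Set B → List (Set B) → Prop
  | I, [] => Finitary cs I
  | I, J :: w => Finitary cs I ∧ SingleStep I J ∧ IsExpr J w

/-- The expression has the form `[I + v₁ + … + v_k]`. -/
def IsAscending : Set B → List (Set B) → Prop
  | _, [] => True
  | I, J :: w => (∃ s, s ∉ I ∧ J = insert s I) ∧ IsAscending J w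

/-- The expression has the form `[I - t₁ - … - t_l]`. -/
def IsDescending : Set B → List (Set B) → Prop
  | _, [] => True
  | I, J :: w => (∃ s, s ∉ J ∧ I = insert s J) ∧ IsDescending J w

open Classical in
/-- The factor `w_I⁻¹ w_J` contributed by an ascending step; descending steps contribute `1`. -/
def stepElt (I J : Set B) : W :=
  if I ⊆ J then (longest cs I)⁻¹ * longest cs J else 1

/-- The product of the factors of all steps of an expression. -/
def tailElt : Set B → List (Set B) → W
  | _, [] => 1
  | I, J :: w => stepElt cs I J * tailElt J w

/-- The sum of the lengths of the factors of all steps of an expression. -/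
def tailLength : Set B → List (Set B) → ℕ
  | _, [] => 0
  | I, J :: w => cs.length (stepElt cs I J) + tailLength J w

/-- `[I, w]` is a reduced singlestep expression, ending in `J`, for the `(I,J)`-coset `p`.
For `[[I₀ ⊂ K₁ ⊃ I₁ ⊂ ⋯ ⊂ K_m ⊃ I_m]]` this says that the lengths add up in the product
`w_{K₁} (w_{I₁}⁻¹ w_{K₂}) ⋯ (w_{I_{m-1}}⁻¹ w_{K_m})`, and that this product lies in `p`. -/
def IsReducedExpr (I : Set B) (w : List (Set B)) (J : Set B) (p : Set W) : Prop :=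
  IsExpr cs I w ∧ lastRegion I w = J ∧
    p = coset cs I J (longest cs I * tailElt cs I w) ∧
    cs.length (longest cs I * tailElt cs I w) = cs.length (longest cs I) + tailLength cs I w

/-- `A = K ∪ {s}`, `C = K ∪ {t}`, `L = K ∪ {s, t}` with `s ≠ t` not in `K`, and `L` finitary. -/
def IsSquare (K A C L : Set B) : Prop :=
  Finitary cs L ∧ ∃ s t, s ∉ K ∧ t ∉ K ∧ s ≠ t ∧
    A = insert s K ∧ C = insert t K ∧ L = insert s (insert t K)

/-- `A = K ∪ {s}` with `s` not in `K`, and `A` finitary. -/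
def IsEdge (K A : Set B) : Prop :=
  Finitary cs A ∧ ∃ s, s ∉ K ∧ A = insert s K

variable {cs} in
theorem IsEdge.sub {K A : Set B} (h : IsEdge cs K A) : K ⊆ A := by
  obtain ⟨-, s, -, rfl⟩ := h
  exact Set.subset_insert s K

variable {cs} in
theorem IsSquare.swap {K A C L : Set B} (h : IsSquare cs K A C L) : IsSquare cs K C A L := by
  obtain ⟨hf, s, t, hs, ht, hne, hA, hC, hL⟩ := h
  exact ⟨hf, t, s, ht, hs, hne.symm, hC, hA, by rw [hL, Set.insert_comm]⟩

variable {cs} in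
theorem IsSquare.sub₁ {K A C L : Set B} (h : IsSquare cs K A C L) : K ⊆ A := by
  obtain ⟨-, s, t, -, -, -, rfl, -, -⟩ := h
  exact Set.subset_insert s K

variable {cs} in
theorem IsSquare.sub₂ {K A C L : Set B} (h : IsSquare cs K A C L) : A ⊆ L := by
  obtain ⟨-, s, t, -, -, -, rfl, -, rfl⟩ := h
  exact Set.insert_subset_insert (Set.subset_insert t K)

end Coxeter

/-! ### Realizations, the polynomial ring and Demazure operators -/

/-- The two-coloured quantum numbers `[n]_x`, with `[2]_x = x` and `[2]_y = y`. -/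
def qnum {k : Type*} [CommRing k] : k → k → ℕ → k
  | _, _, 0 => 0
  | _, _, 1 => 1
  | x, y, n + 2 => x * qnum y x (n + 1) - qnum x y n

/-- A realization `V` of a Coxeter system: roots in `V`, coroots in the dual space, such that
`s(v) = v - α_s^∨(v) α_s` defines a representation of `W`, with the usual technical condition
`[m_st]_s = [m_st]_t = 0`. (`M s t = 0` encodes `m_st = ∞`.) -/
structure Realization {B W : Type*} [Group W] {M : CoxeterMatrix B} (cs : CoxeterSystem M W)
    (k V : Type*) [Field k] [AddCommGroup V] [Module k V] where
  root : B → V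
  coroot : B → Module.Dual k V
  coroot_root : ∀ s, coroot s (root s) = 2
  action : Representation k W V
  action_simple : ∀ s v, action (cs.simple s) v = v - coroot s v • root s
  technical : ∀ s t, s ≠ t → M s t ≠ 0 →
    qnum (-(coroot s (root t))) (-(coroot t (root s))) (M s t) = 0

namespace Realization

variable {B W : Type*} [Group W] {M : CoxeterMatrix B} {cs : CoxeterSystem M W}
  {k V : Type*} [Field k] [AddCommGroup V] [Module k V] (ρ : Realization cs k V)

/-- The polynomial ring `R = Sym(V)`. -/
abbrev Poly (_ρ : Realization cs k V) : Type _ := SymmetricAlgebra k V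

/-- The action of `W` on `R`. -/
def act (w : W) : ρ.Poly →ₐ[k] ρ.Poly :=
  SymmetricAlgebra.lift (SymmetricAlgebra.ι k V ∘ₗ ρ.action w)

/-- The root `α_s` as an element of `R`. -/
def α (s : B) : ρ.Poly := SymmetricAlgebra.ι k V (ρ.root s)

/-- The algebra map `R → R[X]` with `v ↦ v - α_s^∨(v) X`. -/
def deform (s : B) : ρ.Poly →ₐ[k] ρ.Poly[X] :=
  SymmetricAlgebra.lift
    { toFun := fun v =>
        Polynomial.C (SymmetricAlgebra.ι k V v) - ρ.coroot s v • (Polynomial.X : ρ.Poly[X])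
      map_add' := fun v w => by simp only [map_add, add_smul]; abel
      map_smul' := fun c v => by
        simp only [map_smul, smul_eq_mul, mul_smul, RingHom.id_apply, smul_sub,
          Polynomial.smul_C] }

theorem deform_eval_zero (s : B) (f : ρ.Poly) : (ρ.deform s f).eval 0 = f := by
  have h : ((Polynomial.aeval (R := ρ.Poly) (0 : ρ.Poly)).restrictScalars k).comp (ρ.deform s)
      = AlgHom.id k ρ.Poly := by
    apply SymmetricAlgebra.algHom_ext
    ext v
    simp [deform]
  simpa [Polynomial.aeval_def, Polynomial.eval₂_eq_eval_map] using DFunLike.congr_fun h f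

theorem deform_eval_root (s : B) (f : ρ.Poly) :
    (ρ.deform s f).eval (ρ.α s) = ρ.act (cs.simple s) f := by
  have h : ((Polynomial.aeval (R := ρ.Poly) (ρ.α s)).restrictScalars k).comp (ρ.deform s)
      = ρ.act (cs.simple s) := by
    apply SymmetricAlgebra.algHom_ext
    ext v
    simp [deform, act, α, ρ.action_simple]
  simpa [Polynomial.aeval_def, Polynomial.eval₂_eq_eval_map] using DFunLike.congr_fun h f

/-- The Demazure operator `∂_s(f) = (f - s f) / α_s`, see `α_mul_demazure`. -/
def demazure (s : B) : ρ.Poly →ₗ[k] ρ.Poly where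
  toFun f := -((ρ.deform s f).divX.eval (ρ.α s))
  map_add' f g := by rw [map_add, Polynomial.divX_add, Polynomial.eval_add, neg_add]
  map_smul' c f := by
    have : (c • ρ.deform s f) = Polynomial.C (algebraMap k ρ.Poly c) * ρ.deform s f := by
      rw [← Polynomial.smul_eq_C_mul, algebraMap_smul]
    rw [map_smul, this, Polynomial.divX_C_mul, Polynomial.eval_mul, Polynomial.eval_C,
      RingHom.id_apply, Algebra.smul_def, mul_neg]

theorem α_mul_demazure (s : B) (f : ρ.Poly) :
    ρ.α s * ρ.demazure s f = f - ρ.act (cs.simple s) f := by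
  have h := congrArg (Polynomial.eval (ρ.α s)) (Polynomial.X_mul_divX_add (ρ.deform s f))
  rw [Polynomial.eval_add, Polynomial.eval_mul, Polynomial.eval_X, Polynomial.eval_C,
    deform_eval_root, Polynomial.coeff_zero_eq_eval_zero, deform_eval_zero] at h
  change ρ.α s * -((ρ.deform s f).divX.eval (ρ.α s)) = _
  rw [← h]
  ring

/-- The Demazure operator `∂_w = ∂_{s₁} ∘ ⋯ ∘ ∂_{s_n}`, for a reduced word `s₁ ⋯ s_n` of `w`. -/
def demazureElt (w : W) : ρ.Poly →ₗ[k] ρ.Poly :=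
  ((cs.exists_isReduced w).choose).foldr (fun s D => ρ.demazure s ∘ₗ D) LinearMap.id

/-- The operator `∂_I = ∂_{w_I}`. -/
abbrev demazureSet (I : Set B) : ρ.Poly →ₗ[k] ρ.Poly := ρ.demazureElt (longest cs I)

/-- `P` is homogeneous of degree `ℓ(w_L)` (in the grading with `V` in degree one) and
`∂_L(P) = 1`. -/
def IsNormalized (L : Set B) (P : ρ.Poly) : Prop :=
  P ∈ (LinearMap.range (SymmetricAlgebra.ι k V)) ^ cs.length (longest cs L) ∧
    ρ.demazureSet L P = 1

/-- The standing assumptions on a realization. -/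
structure IsAdmissible : Prop where
  finiteDimensional : Module.Finite k V
  faithful : Function.Injective ρ.action
  balanced : ∀ s t, s ≠ t → M s t ≠ 0 →
    qnum (-(ρ.coroot s (ρ.root t))) (-(ρ.coroot t (ρ.root s))) (M s t - 1) = 1
  /-- generalized Demazure surjectivity -/
  demazure_surjective : ∀ L, Finitary cs L → ∃ P, ρ.demazureSet L P = 1
  /-- exactly the reflections fix a subspace of codimension one -/
  reflection_faithful : ∀ w, cs.IsReflection w ↔
    Module.finrank k (V ⧸ LinearMap.ker (ρ.action w - 1)) = 1

/-- The subring `R^I` of `W_I`-invariants. -/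
def inv (I : Set B) : Subalgebra k ρ.Poly where
  carrier := {f | ∀ i ∈ I, ρ.act (cs.simple i) f = f}
  mul_mem' ha hb i hi := by rw [map_mul, ha i hi, hb i hi]
  add_mem' ha hb i hi := by rw [map_add, ha i hi, hb i hi]
  algebraMap_mem' c i _ := AlgHom.commutes _ c

theorem inv_anti {I J : Set B} (h : I ⊆ J) : ρ.inv J ≤ ρ.inv I := fun _ hf i hi => hf i (h hi)

/-- The inclusion `R^J ⊆ R^I` for `I ⊆ J`. -/
def incl {I J : Set B} (h : I ⊆ J) : ρ.inv J →ₐ[k] ρ.inv I := Subalgebra.inclusion (ρ.inv_anti h)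

open Classical in
/-- An element of `R` that lies in `R^I`, as an element of `R^I` (and `0` otherwise). -/
def toInv (I : Set B) (f : ρ.Poly) : ρ.inv I := if h : f ∈ ρ.inv I then ⟨f, h⟩ else 0

open Classical in
/-- For `K ⊆ A` finitary: the Frobenius trace `R^K → R^A`, an `R^A`-linear map that is given by
the operator `∂_{w_A w_K⁻¹}`. -/
def trace (K A : Set B) : ρ.inv K →+ ρ.inv A :=
  if h : ∃ T : ρ.inv K →+ ρ.inv A,
      (∀ f, (T f : ρ.Poly) = ρ.demazureElt (longest cs A * (longest cs K)⁻¹) f) ∧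
      (∀ (x : ρ.inv A) (y f : ρ.inv K), (x : ρ.Poly) = y → T (y * f) = x * T f)
  then h.choose else 0

theorem trace_mul (K A : Set B) (x : ρ.inv A) (y f : ρ.inv K) (hxy : (x : ρ.Poly) = y) :
    ρ.trace K A (y * f) = x * ρ.trace K A f := by
  unfold trace
  split_ifs with h
  · exact h.choose_spec.2 x y f hxy
  · simp

/-- Dual bases `c`, `d` of `R^K` over `R^A`, for `K ⊆ A`. -/
def IsDualBases {K A : Set B} (h : K ⊆ A) (n : ℕ) (c d : Fin n → ρ.inv K) : Prop :=
  (∀ i j, ρ.trace K A (c i * d j) = if i = j then 1 else 0) ∧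
  (∀ f, ∃ a : Fin n → ρ.inv A, f = ∑ i, ρ.incl h (a i) * c i) ∧
  (∀ f, ∃ a : Fin n → ρ.inv A, f = ∑ i, ρ.incl h (a i) * d i)

open Classical in
/-- Chosen dual bases of `R^K` over `R^A` (the empty families, if there are none). -/
def dualBases {K A : Set B} (h : K ⊆ A) : (n : ℕ) × (Fin n → ρ.inv K) × (Fin n → ρ.inv K) :=
  if H : ∃ x : (n : ℕ) × (Fin n → ρ.inv K) × (Fin n → ρ.inv K),
      ρ.IsDualBases h x.1 x.2.1 x.2.2 then H.choose
  else ⟨0, Fin.elim0, Fin.elim0⟩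

theorem dualBases_spec {K A : Set B} (h : K ⊆ A) :
    (ρ.dualBases h).1 = 0 ∨
      ρ.IsDualBases h (ρ.dualBases h).1 (ρ.dualBases h).2.1 (ρ.dualBases h).2.2 := by
  by_cases H : ∃ x : (n : ℕ) × (Fin n → ρ.inv K) × (Fin n → ρ.inv K),
      ρ.IsDualBases h x.1 x.2.1 x.2.2
  · have e : ρ.dualBases h = H.choose := dif_pos H
    rw [e]
    exact Or.inr H.choose_spec
  · have e : ρ.dualBases h = ⟨0, Fin.elim0, Fin.elim0⟩ := dif_neg H
    rw [e]
    exact Or.inl rfl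

theorem coproduct_central {K A : Set B} (h : K ⊆ A) {Q : Type*} [AddCommMonoid Q]
    (β : ρ.inv K →+ ρ.inv K →+ Q)
    (hβ : ∀ (a : ρ.inv A) f g, β (f * ρ.incl h a) g = β f (ρ.incl h a * g)) (r : ρ.inv K) :
    ∑ i, β ((ρ.dualBases h).2.1 i) ((ρ.dualBases h).2.2 i * r) =
      ∑ i, β (r * (ρ.dualBases h).2.1 i) ((ρ.dualBases h).2.2 i) := by
  rcases ρ.dualBases_spec h with h0 | ⟨h1, h2, h3⟩
  · have : IsEmpty (Fin (ρ.dualBases h).1) := by rw [h0]; infer_instance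
    rw [Finset.univ_eq_empty, Finset.sum_empty, Finset.sum_empty]
  · generalize (ρ.dualBases h).2.1 = c at *
    generalize (ρ.dualBases h).2.2 = d at *
    have tr : ∀ (a : ρ.inv A) (f : ρ.inv K),
        ρ.trace K A (ρ.incl h a * f) = a * ρ.trace K A f := fun a f => ρ.trace_mul K A a _ f rfl
    have hc : ∀ f, f = ∑ j, ρ.incl h (ρ.trace K A (f * d j)) * c j := by
      intro f
      obtain ⟨a, ha⟩ := h2 f
      have : ∀ j, ρ.trace K A (f * d j) = a j := by
        intro j
        rw [ha, Finset.sum_mul, map_sum]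
        simp only [mul_assoc, tr, h1]
        simp
      simp only [this]
      exact ha
    have hd : ∀ f, f = ∑ j, ρ.incl h (ρ.trace K A (f * c j)) * d j := by
      intro f
      obtain ⟨a, ha⟩ := h3 f
      have : ∀ j, ρ.trace K A (f * c j) = a j := by
        intro j
        rw [ha, Finset.sum_mul, map_sum]
        simp only [mul_assoc, tr, mul_comm (d _) (c j), h1]
        simp
      simp only [this]
      exact ha
    have e1 : ∀ i, β (r * c i) (d i)
        = ∑ j, β (c j) (ρ.incl h (ρ.trace K A (r * c i * d j)) * d i) := by
      intro i
      conv_lhs => rw [hc (r * c i)]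
      rw [map_sum, AddMonoidHom.finsetSum_apply]
      refine Finset.sum_congr rfl fun j _ => ?_
      rw [mul_comm (ρ.incl h _) (c j), hβ]
    have e2 : ∀ j, β (c j) (d j * r)
        = ∑ i, β (c j) (ρ.incl h (ρ.trace K A (r * c i * d j)) * d i) := by
      intro j
      conv_lhs => rw [hd (d j * r)]
      rw [map_sum]
      refine Finset.sum_congr rfl fun i _ => ?_
      rw [show d j * r * c i = r * c i * d j by ring]
    simp only [e1, e2]
    exact Finset.sum_comm

/-! ### Bott–Samelson bimodules

Since `R^{I ∪ J} = R^I ∩ R^J`, all tensor products below are over the intersection of the two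
rings; for a singlestep expression `I ∪ J` is the larger of two consecutive regions. -/

theorem smul_tmul_aux {R A Q : Type*} [CommSemiring R] [AddCommMonoid A] [AddCommMonoid Q]
    [Module R A] [Module R Q] (r : R) (a : A) (m : Q) : (r • a) ⊗ₜ[R] m = a ⊗ₜ[R] (r • m) :=
  TensorProduct.smul_tmul r a m

section Tens

variable (I J : Set B) (Q : Type*) [AddCommGroup Q] [Module (ρ.inv J) Q]

/-- An `R^J`-module as an `R^{I ∪ J}`-module. -/
abbrev restrictRight : Module (ρ.inv (I ∪ J)) Q :=
  Module.compHom Q (ρ.incl (Set.subset_union_right : J ⊆ I ∪ J)).toRingHom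

/-- `R^I` as an `R^{I ∪ J}`-algebra. -/
abbrev restrictLeft : Algebra (ρ.inv (I ∪ J)) (ρ.inv I) :=
  (ρ.incl (Set.subset_union_left : I ⊆ I ∪ J)).toRingHom.toAlgebra

attribute [local instance] restrictRight restrictLeft

/-- `R^I ⊗_{R^{I ∪ J}} Q` for an `R^J`-module `Q`. -/
def Tens : Type _ :=
  (ρ.inv I) ⊗[ρ.inv (I ∪ J)] Q

instance : AddCommGroup (ρ.Tens I J Q) :=
  inferInstanceAs (AddCommGroup ((ρ.inv I) ⊗[ρ.inv (I ∪ J)] Q))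

instance : Module (ρ.inv I) (ρ.Tens I J Q) :=
  inferInstanceAs (Module (ρ.inv I) ((ρ.inv I) ⊗[ρ.inv (I ∪ J)] Q))

variable {I Q}

/-- The pure tensor `a ⊗ m`. -/
def tm (a : ρ.inv I) (m : Q) : ρ.Tens I J Q :=
  a ⊗ₜ[ρ.inv (I ∪ J)] m

variable {J}

theorem tm_add (a : ρ.inv I) (m n : Q) : ρ.tm J a (m + n) = ρ.tm J a m + ρ.tm J a n := by
  exact TensorProduct.tmul_add a m n

theorem add_tm (a b : ρ.inv I) (m : Q) : ρ.tm J (a + b) m = ρ.tm J a m + ρ.tm J b m := by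
  exact TensorProduct.add_tmul a b m

theorem smul_tm (r a : ρ.inv I) (m : Q) : r • ρ.tm J a m = ρ.tm J (r * a) m := by
  exact TensorProduct.smul_tmul' r a m

theorem tm_balanced (a x : ρ.inv I) (y : ρ.inv J) (h : (x : ρ.Poly) = y) (m : Q) :
    ρ.tm J (a * x) m = ρ.tm J a (y • m) := by
  let z : ρ.inv (I ∪ J) := ⟨x, fun i hi => hi.elim (x.2 i) fun hj => h ▸ y.2 i hj⟩
  have h1 : a * x = z • a := by rw [mul_comm]; rfl
  have h2 : y • m = z • m := by
    have : y = ρ.incl (Set.subset_union_right : J ⊆ I ∪ J) z := Subtype.ext h.symm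
    rw [this]; rfl
  rw [h1, h2]
  exact smul_tmul_aux z a m

theorem tens_induction {p : ρ.Tens I J Q → Prop} (t : ρ.Tens I J Q) (h0 : p 0)
    (h1 : ∀ a m, p (ρ.tm J a m)) (h2 : ∀ s t, p s → p t → p (s + t)) : p t := by
  exact TensorProduct.induction_on (motive := p) t h0 h1 fun s t => h2 s t

/-- The additive map on `R^I ⊗_{R^{I ∪ J}} Q` that is induced by a balanced biadditive map. -/
def tliftAdd {N : Type*} [AddCommGroup N] (β : ρ.inv I →+ Q →+ N)
    (hβ : ∀ (a x : ρ.inv I) (y : ρ.inv J), (x : ρ.Poly) = y → ∀ m,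
      β (a * x) m = β a (y • m)) : ρ.Tens I J Q →+ N :=
  TensorProduct.liftAddHom β fun r a m => by
    have h := hβ a (ρ.incl Set.subset_union_left r) (ρ.incl Set.subset_union_right r) rfl m
    rw [mul_comm] at h
    exact h

theorem tliftAdd_tm {N : Type*} [AddCommGroup N] (β : ρ.inv I →+ Q →+ N)
    (hβ : ∀ (a x : ρ.inv I) (y : ρ.inv J), (x : ρ.Poly) = y → ∀ m,
      β (a * x) m = β a (y • m)) (a : ρ.inv I) (m : Q) :
    ρ.tliftAdd β hβ (ρ.tm J a m) = β a m := rfl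

/-- The `R^I`-linear map `a ⊗ m ↦ a • φ m`. -/
def tlift {N : Type*} [AddCommGroup N] [Module (ρ.inv I) N] (φ : Q →+ N)
    (hφ : ∀ (x : ρ.inv I) (y : ρ.inv J), (x : ρ.Poly) = y → ∀ m, φ (y • m) = x • φ m) :
    ρ.Tens I J Q →ₗ[ρ.inv I] N :=
  { ρ.tliftAdd (AddMonoidHom.compl₂ (smulAddHom (ρ.inv I) N) φ) (fun a x y h m => by
      change (a * x) • φ m = a • φ (y • m)
      rw [hφ x y h, mul_smul]) with
    map_smul' := fun r t => by
      induction t using ρ.tens_induction with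
      | h0 => simp
      | h1 a m =>
        rw [smul_tm]
        exact mul_smul r a (φ m)
      | h2 s t hs ht =>
        simp only [smul_add, ZeroHom.toFun_eq_coe, AddMonoidHom.toZeroHom_coe, map_add] at hs ht ⊢
        exact congrArg₂ (· + ·) hs ht }

theorem tlift_tm {N : Type*} [AddCommGroup N] [Module (ρ.inv I) N] (φ : Q →+ N)
    (hφ : ∀ (x : ρ.inv I) (y : ρ.inv J), (x : ρ.Poly) = y → ∀ m, φ (y • m) = x • φ m)
    (a : ρ.inv I) (m : Q) : ρ.tlift φ hφ (ρ.tm J a m) = a • φ m := rfl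

/-- The additive map `m ↦ a ⊗ m`. -/
def tmHom (J : Set B) {Q : Type*} [AddCommGroup Q] [Module (ρ.inv J) Q] (a : ρ.inv I) :
    Q →+ ρ.Tens I J Q :=
  AddMonoidHom.mk' (ρ.tm J a) (ρ.tm_add a)

/-- The map `id ⊗ φ`. -/
def tmap (I : Set B) {Q' : Type*} [AddCommGroup Q'] [Module (ρ.inv J) Q']
    (φ : Q →ₗ[ρ.inv J] Q') : ρ.Tens I J Q →ₗ[ρ.inv I] ρ.Tens I J Q' :=
  ρ.tlift ((ρ.tmHom J 1).comp φ.toAddMonoidHom) fun x y h m => by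
    change ρ.tm J 1 (φ (y • m)) = x • ρ.tm J 1 (φ m)
    rw [map_smul, ← ρ.tm_balanced 1 x y h, smul_tm, mul_comm]

end Tens

/-! ### The generating bimodule maps

All maps are given on `R^P ⊗ R^Q ⊗ M` or `M`, for an arbitrary module `M`. -/

section Generators

variable {N : Type*} [AddCommGroup N]

/-- Counterclockwise cap `[A, K, A] → [A]`: `a ⊗ f ⊗ m ↦ a ∂(f) m`, for the Frobenius trace
`∂ : R^K → R^A`. -/
def capTr (K A : Set B) [Module (ρ.inv A) N] : ρ.Tens A K (ρ.Tens K A N) →ₗ[ρ.inv A] N :=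
  ρ.tlift
    (ρ.tliftAdd ((smulAddHom (ρ.inv A) N).comp (ρ.trace K A)) fun a x y h m => by
      change ρ.trace K A (a * x) • m = ρ.trace K A a • y • m
      rw [mul_comm, ρ.trace_mul K A y x a h.symm, mul_comm, mul_smul])
    fun x y h t => by
      induction t using ρ.tens_induction with
      | h0 => simp
      | h1 a m =>
        rw [smul_tm, tliftAdd_tm, tliftAdd_tm]
        change ρ.trace K A (y * a) • m = x • ρ.trace K A a • m
        rw [ρ.trace_mul K A x y a h, mul_smul]
      | h2 s t hs ht => rw [smul_add, map_add, map_add, hs, ht, smul_add]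

/-- Counterclockwise cup `[A] → [A, K, A]`, for `K ⊆ A`: `m ↦ 1 ⊗ 1 ⊗ m`. -/
def cupIota {K A : Set B} (h : K ⊆ A) [Module (ρ.inv A) N] :
    N →ₗ[ρ.inv A] ρ.Tens A K (ρ.Tens K A N) where
  toFun m := ρ.tm K 1 (ρ.tm A 1 m)
  map_add' m n := by rw [tm_add, tm_add]
  map_smul' a m := by
    rw [RingHom.id_apply, smul_tm, mul_comm, ρ.tm_balanced 1 a (ρ.incl h a) rfl, smul_tm, mul_comm,
      ρ.tm_balanced 1 (ρ.incl h a) a rfl]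

/-- Clockwise cap `[K, A, K] → [K]`, for `K ⊆ A`: `f ⊗ a ⊗ m ↦ f a m`. -/
def capMul {K A : Set B} (h : K ⊆ A) [Module (ρ.inv K) N] :
    ρ.Tens K A (ρ.Tens A K N) →ₗ[ρ.inv K] N :=
  ρ.tlift
    (ρ.tliftAdd ((smulAddHom (ρ.inv K) N).comp (ρ.incl h : ρ.inv A →+ ρ.inv K))
      fun a x y hxy m => by
        change ρ.incl h (a * x) • m = ρ.incl h a • y • m
        rw [map_mul, mul_smul, show ρ.incl h x = y from Subtype.ext hxy])
    fun x y hxy t => by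
      induction t using ρ.tens_induction with
      | h0 => simp
      | h1 a m =>
        rw [smul_tm, tliftAdd_tm, tliftAdd_tm]
        change ρ.incl h (y * a) • m = x • ρ.incl h a • m
        rw [map_mul, mul_smul, show ρ.incl h y = x from Subtype.ext hxy.symm]
      | h2 s t hs ht => rw [smul_add, map_add, map_add, hs, ht, smul_add]

/-- Clockwise cup `[K] → [K, A, K]`, for `K ⊆ A`: `m ↦ ∑ cᵢ ⊗ 1 ⊗ dᵢ m`, for dual bases
`c`, `d` of `R^K` over `R^A`. -/
def cupDelta {K A : Set B} (h : K ⊆ A) [Module (ρ.inv K) N] :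
    N →ₗ[ρ.inv K] ρ.Tens K A (ρ.Tens A K N) where
  toFun m := ∑ i, ρ.tm A ((ρ.dualBases h).2.1 i) (ρ.tm K 1 ((ρ.dualBases h).2.2 i • m))
  map_add' m n := by simp only [smul_add, tm_add, Finset.sum_add_distrib]
  map_smul' r m := by
    have := ρ.coproduct_central h (Q := ρ.Tens K A (ρ.Tens A K N))
      (AddMonoidHom.mk' (fun f => AddMonoidHom.mk'
          (fun g => ρ.tm A f (ρ.tm K (1 : ρ.inv A) (g • m)))
          (fun g g' => by rw [add_smul, tm_add, tm_add]))
        (fun f f' => by ext g; exact ρ.add_tm f f' _))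
      (fun a f g => by
        change ρ.tm A (f * ρ.incl h a) (ρ.tm K 1 (g • m)) =
          ρ.tm A f (ρ.tm K 1 ((ρ.incl h a * g) • m))
        rw [ρ.tm_balanced f (ρ.incl h a) a rfl, smul_tm, mul_comm,
          ρ.tm_balanced 1 a (ρ.incl h a) rfl, mul_smul]) r
    simp only [RingHom.id_apply, Finset.smul_sum, smul_tm, ← mul_smul]
    exact this

/-- The additive map `q ⊗ m ↦ q ⊗ 1 ⊗ m` with values in `[P, Q', T]`, see `crossLeft`. -/
def crossLeftAux {P Q T Q' : Set B} (h : P ⊆ Q) (h' : Q' ⊆ T) [Module (ρ.inv T) N] :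
    ρ.Tens Q T N →+ ρ.Tens P Q' (ρ.Tens Q' T N) :=
  ρ.tliftAdd
    (AddMonoidHom.mk' (fun q => (ρ.tmHom Q' (ρ.incl h q)).comp (ρ.tmHom T (1 : ρ.inv Q')))
      fun q r => by
        ext m
        change ρ.tm Q' (ρ.incl h (q + r)) (ρ.tm T 1 m) =
          ρ.tm Q' (ρ.incl h q) (ρ.tm T 1 m) + ρ.tm Q' (ρ.incl h r) (ρ.tm T 1 m)
        rw [map_add, add_tm])
    fun q x y hxy m => by
      change ρ.tm Q' (ρ.incl h (q * x)) (ρ.tm T 1 m) = ρ.tm Q' (ρ.incl h q) (ρ.tm T 1 (y • m))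
      rw [map_mul, ρ.tm_balanced _ (ρ.incl h x) (ρ.incl h' y) hxy, smul_tm, mul_comm,
        ρ.tm_balanced 1 (ρ.incl h' y) y rfl]

theorem crossLeftAux_tm {P Q T Q' : Set B} (h : P ⊆ Q) (h' : Q' ⊆ T) [Module (ρ.inv T) N]
    (q : ρ.inv Q) (m : N) :
    ρ.crossLeftAux h h' (ρ.tm T q m) = ρ.tm Q' (ρ.incl h q) (ρ.tm T 1 m) := rfl

/-- The map `[P, Q, T] → [P, Q', T]`, `p ⊗ q ⊗ m ↦ p q ⊗ 1 ⊗ m`, for `P ⊆ Q` and `Q' ⊆ T`. -/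
def crossLeft {P Q T Q' : Set B} (h : P ⊆ Q) (h' : Q' ⊆ T) [Module (ρ.inv T) N] :
    ρ.Tens P Q (ρ.Tens Q T N) →ₗ[ρ.inv P] ρ.Tens P Q' (ρ.Tens Q' T N) :=
  ρ.tlift (ρ.crossLeftAux h h') fun x y hxy t => by
    induction t using ρ.tens_induction with
    | h0 => rw [smul_zero, map_zero, smul_zero]
    | h1 a m =>
      rw [smul_tm, crossLeftAux_tm, crossLeftAux_tm, map_mul, smul_tm,
        show ρ.incl h y = x from Subtype.ext hxy.symm]
    | h2 s t hs ht => rw [smul_add, map_add, map_add, hs, ht, smul_add]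

/-- The additive map `q ⊗ m ↦ 1 ⊗ 1 ⊗ q m` with values in `[P, Q', T]`, see `crossRight`. -/
def crossRightAux (P : Set B) {Q T : Set B} (Q' : Set B) (h : T ⊆ Q) [Module (ρ.inv T) N] :
    ρ.Tens Q T N →+ ρ.Tens P Q' (ρ.Tens Q' T N) :=
  ((ρ.tmHom Q' (1 : ρ.inv P)).comp (ρ.tmHom T (1 : ρ.inv Q'))).comp
    (ρ.tliftAdd ((smulAddHom (ρ.inv T) N).comp (ρ.incl h : ρ.inv Q →+ ρ.inv T))
      fun a x y hxy m => by
        change ρ.incl h (a * x) • m = ρ.incl h a • y • m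
        rw [map_mul, mul_smul, show ρ.incl h x = y from Subtype.ext hxy])

theorem crossRightAux_tm (P : Set B) {Q T : Set B} (Q' : Set B) (h : T ⊆ Q)
    [Module (ρ.inv T) N] (q : ρ.inv Q) (m : N) :
    ρ.crossRightAux P Q' h (ρ.tm T q m) = ρ.tm Q' 1 (ρ.tm T 1 (ρ.incl h q • m)) := rfl

/-- The map `[P, Q, T] → [P, Q', T]`, `p ⊗ q ⊗ m ↦ p ⊗ 1 ⊗ q m`, for `T ⊆ Q` and `Q' ⊆ P`. -/
def crossRight {P Q T Q' : Set B} (h : T ⊆ Q) (h' : Q' ⊆ P) [Module (ρ.inv T) N] :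
    ρ.Tens P Q (ρ.Tens Q T N) →ₗ[ρ.inv P] ρ.Tens P Q' (ρ.Tens Q' T N) :=
  ρ.tlift (ρ.crossRightAux P Q' h) fun x y hxy t => by
    induction t using ρ.tens_induction with
    | h0 => rw [smul_zero, map_zero, smul_zero]
    | h1 a m =>
      rw [smul_tm, crossRightAux_tm, crossRightAux_tm, map_mul, mul_smul, smul_tm, mul_comm,
        ρ.tm_balanced 1 x (ρ.incl h' x) rfl, smul_tm, mul_comm,
        ρ.tm_balanced 1 (ρ.incl h' x) (ρ.incl h y) hxy]
    | h2 s t hs ht => rw [smul_add, map_add, map_add, hs, ht, smul_add]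

end Generators

section Evaluation

universe uB uW uk uV

variable {B : Type uB} {W : Type uW} [Group W] {M : CoxeterMatrix B} {cs : CoxeterSystem M W}
  {k : Type uk} {V : Type uV} [Field k] [AddCommGroup V] [Module k V] (ρ : Realization cs k V)

/-- The Bott–Samelson bimodule `R^{I₀} ⊗ R^{I₁} ⊗ ⋯ ⊗ R^{I_d}` of `[I₀, I₁, …, I_d]`, where two
consecutive factors are tensored over the smaller of the two rings, as a left `R^{I₀}`-module. -/
def BS : (I : Set B) → List (Set B) → ModuleCat.{max uk uV} (ρ.inv I)
  | I, [] => ModuleCat.of (ρ.inv I) (ρ.inv I)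
  | I, J :: w => ModuleCat.of (ρ.inv I) (ρ.Tens I J (BS J w))

/-- The pure tensor `g₀ ⊗ g₁ ⊗ ⋯ ⊗ g_d`. -/
def pureTensor : (I : Set B) → (w : List (Set B)) → (ℕ → ρ.Poly) → ρ.BS I w
  | I, [], g => ρ.toInv I (g 0)
  | I, J :: w, g => ρ.tm J (ρ.toInv I (g 0)) (pureTensor J w fun n => g (n + 1))

/-- The 1-tensor `1 ⊗ 1 ⊗ ⋯ ⊗ 1`. -/
def oneTensor (I : Set B) (w : List (Set B)) : ρ.BS I w := ρ.pureTensor I w fun _ => 1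

/-- The left-facing crossing `[A, K, C] → [A, L, C]`, for `L = A ∪ C` and `K = A ∩ C`:
`1 ⊗ f ⊗ m ↦ ∑ cᵢ ⊗ 1 ⊗ ∂(f dᵢ) m`, for dual bases `c`, `d` of `R^A` over `R^L` and the trace
`∂ : R^K → R^C`. It is obtained from a clockwise cup, a downward crossing and a counterclockwise
cap by `[A, K, C] → [A, L, A, K, C] → [A, L, C, K, C] → [A, L, C]`. -/
def leftCrossing {K A C L : Set B} (h : IsSquare cs K A C L) {N : Type*} [AddCommGroup N]
    [Module (ρ.inv C) N] :
    ρ.Tens A K (ρ.Tens K C N) →ₗ[ρ.inv A] ρ.Tens A L (ρ.Tens L C N) :=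
  ρ.tmap A (ρ.tmap L (ρ.capTr K C)) ∘ₗ
    ρ.tmap A (ρ.crossRight (P := L) (Q := A) (T := K) (Q' := C) h.sub₁ h.swap.sub₂) ∘ₗ
      ρ.cupDelta h.sub₂

/-! ### Diagrams -/

/-- Diagrams with bottom `[I, w]` and top `[I, w']`, built from cups, caps, crossings and
polynomials by vertical composition and by placing identity strands on either side. -/
inductive Diag (ρ : Realization cs k V) :
    Set B → List (Set B) → List (Set B) → Type (max uB uk uV)
  /-- the identity diagram -/
  | ofEq {I : Set B} {w w' : List (Set B)} (h : w = w') : Diag ρ I w w'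
  /-- first `D`, then `D'` above it -/
  | comp {I : Set B} {w w' w'' : List (Set B)} (D : Diag ρ I w w') (D' : Diag ρ I w' w'') :
      Diag ρ I w w''
  /-- an identity strand on the left -/
  | whisk (I : Set B) {J : Set B} {w w' : List (Set B)} (D : Diag ρ J w w') :
      Diag ρ I (J :: w) (J :: w')
  /-- counterclockwise cap `[A, K, A] → [A]` -/
  | ccwCap {K A : Set B} (h : IsEdge cs K A) (w : List (Set B)) : Diag ρ A (K :: A :: w) w
  /-- counterclockwise cup `[A] → [A, K, A]` -/
  | ccwCup {K A : Set B} (h : IsEdge cs K A) (w : List (Set B)) : Diag ρ A w (K :: A :: w)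
  /-- clockwise cap `[K, A, K] → [K]` -/
  | cwCap {K A : Set B} (h : IsEdge cs K A) (w : List (Set B)) : Diag ρ K (A :: K :: w) w
  /-- clockwise cup `[K] → [K, A, K]` -/
  | cwCup {K A : Set B} (h : IsEdge cs K A) (w : List (Set B)) : Diag ρ K w (A :: K :: w)
  /-- upward crossing `[K, A, L] → [K, C, L]` -/
  | upCross {K A C L : Set B} (h : IsSquare cs K A C L) (w : List (Set B)) :
      Diag ρ K (A :: L :: w) (C :: L :: w)
  /-- downward crossing `[L, A, K] → [L, C, K]` -/
  | downCross {K A C L : Set B} (h : IsSquare cs K A C L) (w : List (Set B)) :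
      Diag ρ L (A :: K :: w) (C :: K :: w)
  /-- right-facing crossing `[A, L, C] → [A, K, C]` -/
  | rightCross {K A C L : Set B} (h : IsSquare cs K A C L) (w : List (Set B)) :
      Diag ρ A (L :: C :: w) (K :: C :: w)
  /-- left-facing crossing `[A, K, C] → [A, L, C]` -/
  | leftCross {K A C L : Set B} (h : IsSquare cs K A C L) (w : List (Set B)) :
      Diag ρ A (K :: C :: w) (L :: C :: w)
  /-- a polynomial `f` in `R^I`, in the region `I` -/
  | poly (I : Set B) (f : ρ.Poly) (w : List (Set B)) : Diag ρ I w w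

namespace Diag

variable {ρ}

/-- The evaluation functor from diagrams to maps of Bott–Samelson bimodules. -/
def eval : {I : Set B} → {w w' : List (Set B)} → Diag ρ I w w' → (ρ.BS I w →ₗ[ρ.inv I] ρ.BS I w')
  | I, w, _, ofEq h => h ▸ (LinearMap.id : ρ.BS I w →ₗ[ρ.inv I] ρ.BS I w)
  | _, _, _, comp D D' => D'.eval ∘ₗ D.eval
  | _, _, _, whisk I D => ρ.tmap I D.eval
  | _, _, _, @ccwCap _ _ _ _ _ _ _ _ _ _ _ K A _ w => ρ.capTr K A (N := ρ.BS A w)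
  | _, _, _, @ccwCup _ _ _ _ _ _ _ _ _ _ _ _ A h w => ρ.cupIota h.sub (N := ρ.BS A w)
  | _, _, _, @cwCap _ _ _ _ _ _ _ _ _ _ _ K _ h w => ρ.capMul h.sub (N := ρ.BS K w)
  | _, _, _, @cwCup _ _ _ _ _ _ _ _ _ _ _ K _ h w => ρ.cupDelta h.sub (N := ρ.BS K w)
  | _, _, _, @upCross _ _ _ _ _ _ _ _ _ _ _ _ _ _ L h w =>
      ρ.crossLeft h.sub₁ h.swap.sub₂ (N := ρ.BS L w)
  | _, _, _, @downCross _ _ _ _ _ _ _ _ _ _ _ K _ _ _ h w =>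
      ρ.crossRight h.sub₁ h.swap.sub₂ (N := ρ.BS K w)
  | _, _, _, @rightCross _ _ _ _ _ _ _ _ _ _ _ _ _ C _ h w =>
      ρ.crossLeft h.sub₂ h.swap.sub₁ (N := ρ.BS C w)
  | _, _, _, @leftCross _ _ _ _ _ _ _ _ _ _ _ _ _ C _ h w =>
      ρ.leftCrossing h (N := ρ.BS C w)
  | _, _, _, poly I f w => ρ.toInv I f • (LinearMap.id : ρ.BS I w →ₗ[ρ.inv I] ρ.BS I w)

/-- Duality: flip a diagram upside-down and reverse the orientations. -/
def dual : {I : Set B} → {w w' : List (Set B)} → Diag ρ I w w' → Diag ρ I w' w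
  | _, _, _, ofEq h => ofEq h.symm
  | _, _, _, comp D D' => comp D'.dual D.dual
  | _, _, _, whisk I D => whisk I D.dual
  | _, _, _, ccwCap h w => ccwCup h w
  | _, _, _, ccwCup h w => ccwCap h w
  | _, _, _, cwCap h w => cwCup h w
  | _, _, _, cwCup h w => cwCap h w
  | _, _, _, upCross h w => upCross h.swap w
  | _, _, _, downCross h w => downCross h.swap w
  | _, _, _, rightCross h w => leftCross h w
  | _, _, _, leftCross h w => rightCross h w
  | _, _, _, poly I f w => poly I f w

/-- Place identity strands on the right: `D ⊗ id`. -/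
def right (v : List (Set B)) :
    {I : Set B} → {w w' : List (Set B)} → Diag ρ I w w' → Diag ρ I (w ++ v) (w' ++ v)
  | _, _, _, ofEq h => ofEq (congrArg (· ++ v) h)
  | _, _, _, comp D D' => comp (D.right v) (D'.right v)
  | _, _, _, whisk I D => whisk I (D.right v)
  | _, _, _, ccwCap h w => ccwCap h (w ++ v)
  | _, _, _, ccwCup h w => ccwCup h (w ++ v)
  | _, _, _, cwCap h w => cwCap h (w ++ v)
  | _, _, _, cwCup h w => cwCup h (w ++ v)
  | _, _, _, upCross h w => upCross h (w ++ v)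
  | _, _, _, downCross h w => downCross h (w ++ v)
  | _, _, _, rightCross h w => rightCross h (w ++ v)
  | _, _, _, leftCross h w => leftCross h (w ++ v)
  | _, _, _, poly I f w => poly I f (w ++ v)

/-- Place identity strands on the left: `id ⊗ D`. -/
def left : (I : Set B) → (z : List (Set B)) → {w w' : List (Set B)} →
    Diag ρ (lastRegion I z) w w' → Diag ρ I (z ++ w) (z ++ w')
  | _, [], _, _, D => D
  | I, J :: z, _, _, D => whisk I (left J z D)

/-- Sinister diagrams: only left-facing crossings and counterclockwise caps appear. -/
def IsSinister : {I : Set B} → {w w' : List (Set B)} → Diag ρ I w w' → Prop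
  | _, _, _, ofEq _ => True
  | _, _, _, comp D D' => D.IsSinister ∧ D'.IsSinister
  | _, _, _, whisk _ D => D.IsSinister
  | _, _, _, ccwCap _ _ => True
  | _, _, _, leftCross _ _ => True
  | _, _, _, ccwCup _ _ => False
  | _, _, _, cwCap _ _ => False
  | _, _, _, cwCup _ _ => False
  | _, _, _, upCross _ _ => False
  | _, _, _, downCross _ _ => False
  | _, _, _, rightCross _ _ => False
  | _, _, _, poly _ _ _ => False

/-- The clockwise cap `[K', A, K] → [K]` for `K' = K`. -/
def cwCapEnd {K A K' : Set B} (h : IsEdge cs K A) (e : K' = K) : Diag ρ K' [A, K] [] :=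
  comp (ofEq (by rw [e])) (cwCap (K := K') (A := A) (e ▸ h) [])

end Diag

/-! ### Rex moves -/

/-- The tail of the longer side
`[L∖u₀ - u₁ + u₀ - u₂ + u₁ - ⋯ - u_d + u_{d-1}]` of a switchback relation. -/
def switchbackTail (L : Set B) (u : ℕ → B) (d : ℕ) : List (Set B) :=
  (List.range d).flatMap fun i => [L \ {u i, u (i + 1)}, L \ {u (i + 1)}]

variable (cs) in
/-- `u₀, …, u_d` is the rotation sequence of a switchback relation
`[L∖u₀ + u₀ - u_d] ⇌ [L∖u₀ - u₁ + u₀ - u₂ + u₁ - ⋯ - u_d + u_{d-1}]`. -/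
structure IsRotationSequence (L : Set B) (u : ℕ → B) (d : ℕ) : Prop where
  finitary : Finitary cs L
  pos : 1 ≤ d
  mem : ∀ i ≤ d, u i ∈ L
  ne : ∀ i < d, u i ≠ u (i + 1)
  rotate : ∀ i, 1 ≤ i → i < d →
    cs.simple (u (i + 1)) = longest cs (L \ {u i}) * cs.simple (u (i - 1)) *
      (longest cs (L \ {u i}))⁻¹
  end_ne : cs.simple (u d) ≠ longest cs L * cs.simple (u 0) * (longest cs L)⁻¹
  reduced : IsReducedExpr cs (L \ {u 0}) (switchbackTail L u d) (L \ {u d})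
    (coset cs (L \ {u 0}) (L \ {u d}) (longest cs L))

/-- Rex moves: compositions of the diagrams of up-up, down-down and switchback relations (applied
anywhere inside an expression). -/
inductive IsRexMove : {I : Set B} → {w w' : List (Set B)} → Diag ρ I w w' → Prop
  | ofEq {I : Set B} {w w' : List (Set B)} (h : w = w') : IsRexMove (Diag.ofEq (I := I) h)
  | comp {I : Set B} {w w' w'' : List (Set B)} {D : Diag ρ I w w'} {D' : Diag ρ I w' w''}
      (h : IsRexMove D) (h' : IsRexMove D') : IsRexMove (D.comp D')
  | whisk (I : Set B) {J : Set B} {w w' : List (Set B)} {D : Diag ρ J w w'} (h : IsRexMove D) :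
      IsRexMove (Diag.whisk I D)
  | upUp {K A C L : Set B} (h : IsSquare cs K A C L) (w : List (Set B)) :
      IsRexMove (Diag.upCross h w)
  | downDown {K A C L : Set B} (h : IsSquare cs K A C L) (w : List (Set B)) :
      IsRexMove (Diag.downCross h w)
  | switchback {L : Set B} {u : ℕ → B} {d : ℕ} (h : IsRotationSequence cs L u d)
      {D : Diag ρ (L \ {u 0}) (switchbackTail L u d) [L, L \ {u d}]} (hD : D.IsSinister)
      (w : List (Set B)) : IsRexMove (D.right w)
  | switchbackDual {L : Set B} {u : ℕ → B} {d : ℕ} (h : IsRotationSequence cs L u d)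
      {D : Diag ρ (L \ {u 0}) (switchbackTail L u d) [L, L \ {u d}]} (hD : D.IsSinister)
      (w : List (Set B)) : IsRexMove (D.dual.right w)

/-! ### Single step light leaves -/

variable (cs) in
/-- `[I, T, Y]` is a reduced expression for the `(I,J)`-coset `m` that factors through its core:
`[I, T] = [I - t₁ - ⋯ - t_l]` ends in the left redundancy of `m`, and `Y` consists of a reduced
expression for the core, followed by `[rightRed + u₁ + ⋯ + u_r]`, ending in `J`. -/
def IsCoreExpr (I J : Set B) (m : Set W) (T Y : List (Set B)) : Prop :=
  IsDescending I T ∧ lastRegion I T = leftRed cs I J m ∧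
    ∃ K U : List (Set B), Y = K ++ U ∧
      IsReducedExpr cs (leftRed cs I J m) K (rightRed cs I J m)
        (coset cs (leftRed cs I J m) (rightRed cs I J m) (minElt cs m)) ∧
      IsAscending (rightRed cs I J m) U ∧ lastRegion (rightRed cs I J m) U = J

variable (cs) in
/-- For an `(I₀,J)`-coset `p` contained in an `(I₀,Js)`-coset `q`: the coset `m` of the Grassmannian
pair of `p ⊂ q`. It is the `(rightRed q, J)`-coset with minimal element `q⁻¹ p`, where `p` and `q`
here stand for their minimal elements. -/
def grassmannian (I₀ J Js : Set B) (p q : Set W) : Set W :=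
  coset cs (rightRed cs I₀ Js q) J ((minElt cs q)⁻¹ * minElt cs p)

/-- `ElementaryData I₀ J Js p q Z T Y X E`: for the `(I₀,J)`-coset `p ⊂ q` with Grassmannian pair
`m ⊂ n`, `Z` is a reduced expression for `z`, `[T, Y]` is a reduced expression for `m` through its
core, `X` is the reduced expression `[rightRed q + v₁ + ⋯ + v_k]` for `n`, and `E` is an elementary
light leaf for `[m, n]`. -/
structure ElementaryData (I₀ J Js : Set B) (p q : Set W) (Z T Y X : List (Set B))
    (E : Diag ρ (lastRegion I₀ Z) (T ++ Y ++ [Js]) X) : Prop where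
  z_reduced : IsReducedExpr cs I₀ Z (rightRed cs I₀ Js q)
    (coset cs I₀ (rightRed cs I₀ Js q) (minElt cs q))
  m_core : IsCoreExpr cs (rightRed cs I₀ Js q) J (grassmannian cs I₀ J Js p q) T Y
  n_ascending : IsAscending (rightRed cs I₀ Js q) X
  n_last : lastRegion (rightRed cs I₀ Js q) X = Js
  sinister : E.IsSinister

/-- `IsStepLeaf ρ I₀ J J' p p' f X X' S`: the diagram `S` is a single step light leaf, from the
reduced expression `[I₀, X]` of the `(I₀,J)`-coset `p`, followed by `J'`, to the reduced expression
`[I₀, X']` of the `(I₀,J')`-coset `p'`, with the polynomial `f` if `p ⊂ p'`. -/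
inductive IsStepLeaf (I₀ J J' : Set B) (p p' : Set W) (f : ρ.Poly) :
    (X X' : List (Set B)) → Diag ρ I₀ (X ++ [J']) X' → Prop
  /-- `p ⊂ p'`: the diagram `id_Z ⊗ E`, with `f` in the leftmost region `leftRed m` of `E` -/
  | up (hJ : IsEdge cs J J') {Z T Y X : List (Set B)}
      {E : Diag ρ (lastRegion I₀ Z) (T ++ Y ++ [J']) X}
      (h : ElementaryData ρ I₀ J J' p p' Z T Y X E) :
      IsStepLeaf I₀ J J' p p' f (Z ++ (T ++ Y)) (Z ++ X)
        ((Diag.ofEq (by simp only [List.append_assoc])).comp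
          (Diag.left I₀ Z
            ((Diag.left (lastRegion I₀ Z) T
              (Diag.poly (lastRegion (lastRegion I₀ Z) T) f (Y ++ [J']))).comp
              ((Diag.ofEq (by simp only [List.append_assoc])).comp E))))
  /-- `p ⊃ p'`: the diagram `id_Z ⊗ ((id ⊗ clockwise cap) ∘ (dual E ⊗ id))` -/
  | down (hJ : IsEdge cs J' J) {Z T Y X : List (Set B)}
      {E : Diag ρ (lastRegion I₀ Z) (T ++ Y ++ [J]) X}
      (h : ElementaryData ρ I₀ J' J p' p Z T Y X E)
      (hlast : lastRegion (lastRegion I₀ Z) (T ++ Y) = J') :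
      IsStepLeaf I₀ J J' p p' f (Z ++ X) (Z ++ (T ++ Y))
        ((Diag.ofEq (by simp only [List.append_assoc])).comp
          (Diag.left I₀ Z
            ((E.dual.right [J']).comp
              ((Diag.ofEq (by simp only [List.append_assoc, List.singleton_append])).comp
                ((Diag.left (lastRegion I₀ Z) (T ++ Y) (Diag.cwCapEnd hJ hlast)).comp
                  (Diag.ofEq (by simp only [List.append_nil])))))))

end Evaluation

end Realization

/-! ### Sprinkled subordinate paths -/

section Paths

variable {B W : Type*} [Group W] {M : CoxeterMatrix B} (cs : CoxeterSystem M W) {d : ℕ}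

/-- Sprinkled paths `(t, y)` subordinate to the expression `[I₀, …, I_d]`. -/
@[ext]
structure SprinkledPath (I : Fin (d + 1) → Set B) where
  /-- the cosets `t₀, …, t_d` -/
  t : Fin (d + 1) → Set W
  /-- the sprinkles `y_j`; they are defined for ascending indices only, which is recorded by
  putting `y_j = 1` for the other indices -/
  y : Fin d → W
  t_coset : ∀ k, ∃ x, t k = coset cs (I 0) (I k) x
  t_zero : t 0 = (parabolic cs (I 0) : Set W)
  t_up : ∀ j : Fin d, I j.castSucc ⊆ I j.succ → t j.castSucc ⊆ t j.succ
  t_down : ∀ j : Fin d, I j.succ ⊆ I j.castSucc → t j.succ ⊆ t j.castSucc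
  y_mem : ∀ j : Fin d, I j.castSucc ⊆ I j.succ →
    y j ∈ parabolic cs (rightRed cs (I 0) (I j.succ) (t j.succ))
  y_min : ∀ j : Fin d, I j.castSucc ⊆ I j.succ →
    ∀ v ∈ parabolic cs {i | ∃ a ∈ leftRed cs (I 0) (I j.castSucc) (t j.castSucc),
      cs.simple i = (minElt cs (t j.succ))⁻¹ * cs.simple a * minElt cs (t j.succ)},
    cs.length (y j) ≤ cs.length (v * y j)
  y_other : ∀ j : Fin d, ¬ I j.castSucc ⊆ I j.succ → y j = 1

namespace SprinkledPath

variable {cs} {I : Fin (d + 1) → Set B}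

/-- The terminus of a path. -/
def term (T : SprinkledPath cs I) : Set W := T.t (Fin.last d)

/-- The set `𝓁_j = t_{j+1}⁻¹ leftRed(t_j) t_{j+1}`, where `t_{j+1}` stands for its minimal
element. -/
def ell (T : SprinkledPath cs I) (j : Fin d) : Set B :=
  {i | ∃ a ∈ leftRed cs (I 0) (I j.castSucc) (T.t j.castSucc),
    cs.simple i = (minElt cs (T.t j.succ))⁻¹ * cs.simple a * minElt cs (T.t j.succ)}

/-- The set `𝓇_{j+1} = rightRed(t_{j+1})`. -/
def err (T : SprinkledPath cs I) (j : Fin d) : Set B :=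
  rightRed cs (I 0) (I j.succ) (T.t j.succ)

/-- The dual sequence. -/
def dualSeq (T : SprinkledPath cs I) (j : Fin d) : W :=
  longest cs (I j.castSucc) * (minElt cs (T.t j.castSucc))⁻¹ * minElt cs (T.t j.succ) * T.y j *
    longest cs (I j.succ)

/-- The lexicographic order on dual sequences with respect to an order `r` on `W`. -/
def Prec (r : W → W → Prop) (T U : SprinkledPath cs I) : Prop :=
  ∃ j : Fin d, I j.castSucc ⊆ I j.succ ∧ r (T.dualSeq j) (U.dualSeq j) ∧
    ∀ i < j, I i.castSucc ⊆ I i.succ → T.dualSeq i = U.dualSeq i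

end SprinkledPath

/-- The tail `[I₁, …, I_k]` of `[I₀, …, I_k]`. -/
def tailList (I : Fin (d + 1) → Set B) : (n : ℕ) → n ≤ d → List (Set B)
  | 0, _ => []
  | n + 1, h => tailList I n (Nat.le_of_succ_le h) ++ [I (Fin.succ ⟨n, h⟩)]

end Paths

namespace Realization

universe uB uW uk uV

variable {B : Type uB} {W : Type uW} [Group W] {M : CoxeterMatrix B} {cs : CoxeterSystem M W}
  {k : Type uk} {V : Type uV} [Field k] [AddCommGroup V] [Module k V] (ρ : Realization cs k V)
  {d : ℕ} {I : Fin (d + 1) → Set B}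

/-- `f` is the sprinkle `f_j = ∂_{𝓁_j} ∂_{y_j}(P)`, for some choice of `P` of the right degree with
`∂_{𝓇_{j+1}}(P) = 1`; for descending indices `f_j = 1`. -/
def IsSprinkle (T : SprinkledPath cs I) (j : Fin d) (f : ρ.Poly) : Prop :=
  (I j.castSucc ⊆ I j.succ ∧ ∃ P, ρ.IsNormalized (T.err j) P ∧
    f = ρ.demazureSet (T.ell j) (ρ.demazureElt (T.y j) P)) ∨
  (¬ I j.castSucc ⊆ I j.succ ∧ f = 1)

/-- `IsLightLeaf ρ T n hn X D`: the diagram `D` is a light leaf with sprinkles, for the part of the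
sprinkled path `T` up to the index `n`, from `[I₀, …, I_n]` to `[I₀, X]`, obtained by any choice of
reduced expressions, polynomials and rex moves. -/
inductive IsLightLeaf (T : SprinkledPath cs I) :
    (n : ℕ) → (hn : n ≤ d) → (X : List (Set B)) → Diag ρ (I 0) (tailList I n hn) X → Prop
  | zero : IsLightLeaf T 0 (Nat.zero_le d) [] (Diag.ofEq rfl)
  | succ {n : ℕ} {hn : n + 1 ≤ d} {X₁ X₂ X₃ : List (Set B)}
      {D : Diag ρ (I 0) (tailList I n (Nat.le_of_succ_le hn)) X₁} {rex : Diag ρ (I 0) X₁ X₂}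
      {S : Diag ρ (I 0) (X₂ ++ [I (Fin.succ ⟨n, hn⟩)]) X₃} {f : ρ.Poly}
      (hD : IsLightLeaf T n (Nat.le_of_succ_le hn) X₁ D) (hrex : ρ.IsRexMove rex)
      (hf : ρ.IsSprinkle T ⟨n, hn⟩ f)
      (hS : ρ.IsStepLeaf (I 0) (I (Fin.castSucc ⟨n, hn⟩)) (I (Fin.succ ⟨n, hn⟩))
        (T.t (Fin.castSucc ⟨n, hn⟩)) (T.t (Fin.succ ⟨n, hn⟩)) f X₂ X₃ S) :
      IsLightLeaf T (n + 1) hn X₃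
        ((D.right [I (Fin.succ ⟨n, hn⟩)]).comp ((rex.right [I (Fin.succ ⟨n, hn⟩)]).comp S))

open Classical in
/-- The dual sprinkle `∂_{I_n} ∂_{z_n°}(P_n)` for an ascending index `n ≥ 1`, and `1` otherwise. -/
def dualSprinkle (U : SprinkledPath cs I) (P : Fin d → ρ.Poly) (n : ℕ) : ρ.Poly :=
  if h : 0 < n ∧ n < d then
    if I (Fin.castSucc ⟨n, h.2⟩) ⊆ I (Fin.succ ⟨n, h.2⟩) then
      ρ.demazureSet (I (Fin.castSucc ⟨n, h.2⟩)) (ρ.demazureElt (U.dualSeq ⟨n, h.2⟩) (P ⟨n, h.2⟩))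
    else 1
  else 1

/-- The element `b(U) = 1 ⊗ b(z₁°) ⊗ b(z₂°) ⊗ ⋯` of `BS([I₀, …, I_d])`, for polynomials `P_j` with
`∂_{I_{j+1}}(P_j) = 1`. -/
def dualElement (U : SprinkledPath cs I) (P : Fin d → ρ.Poly) :
    ρ.BS (I 0) (tailList I d le_rfl) :=
  ρ.pureTensor (I 0) (tailList I d le_rfl) (ρ.dualSprinkle U P)

end Realization
end SingularSoergel
end

noncomputable section

namespace SingularSoergel

/-! ### Coxeter groups: exchange, double cosets, longest elements, redundancies -/

section CoxeterTheory

variable {B W : Type*} [Group W] {M : CoxeterMatrix B} (cs : CoxeterSystem M W)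

/-! ### The exchange property -/

/-! A tensor in a Bott–Samelson bimodule acts on polynomials in its last ring: from right to left,
multiply by the factors and pass to the next ring by inclusion or Frobenius trace (`actOn`).
Sinister diagrams preserve this action (`IsAdmissible.actOn_eval`): a counterclockwise cap is a
trace, and a left-facing crossing amounts to a dual-basis expansion combined with transitivity of
traces. On a reduced expression `1^⊗` acts by the Demazure operator of the coset
(`IsAdmissible.actOn_reduced`, `IsAdmissible.actOn_core`). Tensors on `[A, L, C]` with `A, C ⊆ L`
are determined by their action, so sinister switchback diagrams fix `1^⊗`; crossings and duals of
sinister diagrams fix it by inspection. Hence rex moves and descending steps send `1^⊗` to `1^⊗`.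

It remains to treat an ascending step from `p` to `q ⊇ p`, applied to `1^⊗` followed by one dual
sprinkle. Write `J ⊂ J'` for the two right-hand sets, `R` for the right redundancy of `q`, and `x`
for the inverse of the minimal element of `q` times the minimal element of `p`. The target of the
elementary light leaf is an ascending expression, so its bimodule is generated by `1^⊗` and the
coefficient is the action on `1`. That coefficient is `∂_R(∂_y(P') · ∂_x ∂_J ∂_{z°}(P))`. Moving
`∂_y` across the trace form and using `y⁻¹ x w_J = w_{J'} (y°)⁻¹`, with lengths adding, gives
`∂_R(P' · ∂_{w_{J'} (y°)⁻¹} ∂_{z°}(P))`. If `ℓ(y°) ≤ ℓ(z°)`, the nil-Coxeter relations make the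
inner composition vanish on `P` unless `y° = z°`, when it is `∂_{J'}(P) = 1`
(`IsAdmissible.demazureElt_pairing`, `IsAdmissible.demazureSet_sprinkle`). So the value stays `1^⊗`
while the dual sequences agree, and becomes `0` at the first index where they differ in the stated
direction (`IsAdmissible.eval_lightLeaf`).

The order is lexicographic on dual sequences. It is total because a sprinkled path can be recovered
backwards from its terminus and its dual sequence (`SprinkledPath.eq_of_dualSeq_eq`).

Two foundations are needed. Demazure operators do not depend on the reduced word: Matsumoto's
theorem reduces this to the braid relations, which follow from the technical and balanced
conditions. Dual bases exist for `R^A ⊆ R^K`: a Gram matrix of Demazure images of one polynomial is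
unitriangular. -/

theorem end_mul_apply {X : Type*} (f g : Function.End X) (x : X) : (f * g) x = f (g x) := rfl

theorem end_one_apply {X : Type*} (x : X) : (1 : Function.End X) x = x := rfl

open Classical in
/-- The action of a simple reflection on signed group elements. -/
def signedConj (i : B) : Function.End (W × ZMod 2) :=
  fun x => (cs.simple i * x.1 * cs.simple i, x.2 + if x.1 = cs.simple i then 1 else 0)

-- With `u = s_i s_j`, the sign flips once for each `l < 2n` with `u^l x = s_j`. For `n = m_ij` this
-- condition is periodic in `l` with period `m_ij`, so the flips cancel in pairs and the signed
-- action respects the Coxeter relations.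
open Classical in
theorem signedConj_pow (i j : B) (n : ℕ) (x : W × ZMod 2) :
    ((signedConj cs i * signedConj cs j) ^ n : Function.End (W × ZMod 2)) x =
      ((cs.simple i * cs.simple j) ^ n * x.1 * ((cs.simple i * cs.simple j) ^ n)⁻¹,
        x.2 + ∑ l ∈ Finset.range (2 * n),
          if (cs.simple i * cs.simple j) ^ l * x.1 = cs.simple j then 1 else 0) := by
  induction n with
  | zero => simp [end_one_apply]
  | succ n ih =>
    have hj := cs.simple_mul_simple_self j
    have hi := cs.simple_mul_simple_self i
    -- Conjugation by `s_j` inverts `s_i s_j`; this brings both sign conditions below into the form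
    -- `u^l x = s_j`.
    have hinv : ∀ k : ℕ, cs.simple j * (cs.simple i * cs.simple j) ^ k
        = ((cs.simple i * cs.simple j) ^ k)⁻¹ * cs.simple j := by
      intro k
      induction k with
      | zero => simp
      | succ k ihk =>
        rw [pow_succ, ← mul_assoc, ihk, ← pow_succ, pow_succ', mul_inv_rev, mul_inv_rev]
        simp only [cs.inv_simple, mul_assoc]
    rw [pow_succ', end_mul_apply, ih, end_mul_apply]
    set u := cs.simple i * cs.simple j with hu
    have e1 : u ^ n * x.1 * (u ^ n)⁻¹ = cs.simple j ↔ u ^ (2 * n) * x.1 = cs.simple j := by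
      rw [mul_inv_eq_iff_eq_mul, hinv, two_mul, pow_add, mul_assoc, eq_inv_mul_iff_mul_eq]
    have e2 : cs.simple j * (u ^ n * x.1 * (u ^ n)⁻¹) * cs.simple j = cs.simple i ↔
        u ^ (2 * n + 1) * x.1 = cs.simple j := by
      have : cs.simple j * (u ^ n * x.1 * (u ^ n)⁻¹) * cs.simple j = cs.simple i ↔
          u ^ n * x.1 * (u ^ n)⁻¹ = cs.simple j * cs.simple i * cs.simple j := by
        constructor
        · intro h; rw [← h]; simp [mul_assoc]
        · intro h; rw [h]; simp [mul_assoc]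
      rw [this, mul_inv_eq_iff_eq_mul, show 2 * n + 1 = n + 1 + n by ring, pow_add, pow_succ',
        mul_assoc (cs.simple j * cs.simple i), hinv, mul_assoc (u * u ^ n),
        show cs.simple j * cs.simple i = u⁻¹ by simp [hu], mul_assoc u, ← mul_assoc u⁻¹,
        ← mul_inv_rev, eq_inv_mul_iff_mul_eq, ← pow_succ, pow_succ', mul_assoc]
    simp only [signedConj]
    rw [show 2 * (n + 1) = 2 * n + 1 + 1 by ring, Finset.sum_range_succ, Finset.sum_range_succ]
    refine Prod.ext ?_ ?_
    · simp only [pow_succ', mul_inv_rev, hu, cs.inv_simple, mul_assoc]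
    · simp only [e1, e2, add_assoc]

theorem signedConj_liftable : M.IsLiftable (signedConj cs) := by
  classical
  intro i j
  funext x
  rw [signedConj_pow, cs.simple_mul_simple_pow, two_mul, Finset.sum_range_add]
  simp only [pow_add, cs.simple_mul_simple_pow, one_mul, inv_one, mul_one]
  rw [← two_mul, show (2 : ZMod 2) = 0 from rfl, zero_mul, add_zero]
  rfl

open Classical in
theorem lift_signedConj_wordProd (ω : List B) (x : W × ZMod 2) :
    (cs.lift ⟨_, signedConj_liftable cs⟩ (cs.wordProd ω) : Function.End (W × ZMod 2)) x =
      (cs.wordProd ω * x.1 * (cs.wordProd ω)⁻¹, x.2 + ((cs.rightInvSeq ω).count x.1 : ℕ)) := by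
  induction ω with
  | nil => simp [end_one_apply]
  | cons i ω ih =>
    rw [cs.wordProd_cons, map_mul, end_mul_apply, ih,
      cs.lift_apply_simple, CoxeterSystem.rightInvSeq, List.count_cons]
    refine Prod.ext ?_ ?_
    · simp [signedConj, mul_assoc]
    · have : cs.wordProd ω * x.1 * (cs.wordProd ω)⁻¹ = cs.simple i ↔
          (cs.wordProd ω)⁻¹ * cs.simple i * cs.wordProd ω = x.1 := by
        constructor
        · intro h; rw [← h]; group
        · intro h; rw [← h]; group
      simp only [signedConj, this, beq_iff_eq]
      push_cast
      rw [add_assoc]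

open Classical in
/-- The parity of the multiplicity of an element in an inversion sequence depends on the product
of the word only. -/
theorem count_rightInvSeq_eq {ω ω' : List B} (h : cs.wordProd ω = cs.wordProd ω') (t : W) :
    (((cs.rightInvSeq ω).count t : ℕ) : ZMod 2) = ((cs.rightInvSeq ω').count t : ℕ) := by
  have h1 := lift_signedConj_wordProd cs ω (t, 0)
  rw [h, lift_signedConj_wordProd] at h1
  simpa using (congrArg Prod.snd h1).symm

/-- Let `w` be the product of `ω` and apply `w s_i` to `(s_i, 0)`. The factor `s_i` flips the sign,
and `ω` contributes nothing if `s_i` is missing from its inversions. Then `s_i` occurs an odd number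
of times among the inversions of a reduced word of `w s_i`, so `w` is shorter than `w s_i`, contrary
to the descent. -/
theorem simple_mem_rightInvSeq {ω : List B} {i : B} (h : cs.IsRightDescent (cs.wordProd ω) i) :
    cs.simple i ∈ cs.rightInvSeq ω := by
  classical
  by_contra hn
  obtain ⟨ω', hω', e⟩ := cs.exists_isReduced (cs.wordProd ω * cs.simple i)
  have h1 := lift_signedConj_wordProd cs ω' (cs.simple i, 0)
  have h2 := lift_signedConj_wordProd cs ω (cs.simple i, 1)
  rw [← e, map_mul, end_mul_apply, cs.lift_apply_simple] at h1
  simp only [signedConj, if_true, zero_add, cs.simple_mul_simple_self, one_mul] at h1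
  rw [h2] at h1
  have h3 := congrArg Prod.snd h1
  simp only [List.count_eq_zero_of_not_mem hn, Nat.cast_zero, add_zero] at h3
  have h4 : cs.simple i ∈ cs.rightInvSeq ω' := by
    by_contra h5
    rw [List.count_eq_zero_of_not_mem h5] at h3
    simp at h3
  have h6 := (cs.isRightInversion_of_mem_rightInvSeq hω' h4).2
  rw [← e, cs.simple_mul_simple_cancel_right] at h6
  exact absurd h (by unfold CoxeterSystem.IsRightDescent; omega)

theorem exchange_right {ω : List B} {i : B} (h : cs.IsRightDescent (cs.wordProd ω) i) :
    ∃ j < ω.length, cs.wordProd ω * cs.simple i = cs.wordProd (ω.eraseIdx j) := by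
  obtain ⟨j, hj, e⟩ := List.mem_iff_getElem.1 (simple_mem_rightInvSeq cs h)
  refine ⟨j, by simpa using hj, ?_⟩
  rw [← cs.wordProd_mul_getD_rightInvSeq, List.getD_eq_getElem _ _ hj, e]

theorem exchange_left {ω : List B} {i : B} (h : cs.IsLeftDescent (cs.wordProd ω) i) :
    ∃ j < ω.length, cs.simple i * cs.wordProd ω = cs.wordProd (ω.eraseIdx j) := by
  have h1 : cs.IsRightDescent (cs.wordProd ω.reverse) i := by
    rw [cs.wordProd_reverse]
    exact cs.isRightDescent_inv_iff.2 h
  have h2 : cs.simple i ∈ cs.leftInvSeq ω := by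
    have := simple_mem_rightInvSeq cs h1
    rwa [cs.rightInvSeq_reverse, List.mem_reverse] at this
  obtain ⟨j, hj, e⟩ := List.mem_iff_getElem.1 h2
  refine ⟨j, by simpa using hj, ?_⟩
  rw [← cs.getD_leftInvSeq_mul_wordProd, List.getD_eq_getElem _ _ hj, e]

/-- The deletion property. -/
theorem exists_reduced_sublist (ω : List B) :
    ∃ ω' : List B, ω'.Sublist ω ∧ cs.IsReduced ω' ∧ cs.wordProd ω' = cs.wordProd ω := by
  induction ω with
  | nil => exact ⟨[], List.Sublist.refl _, by simp [CoxeterSystem.IsReduced], rfl⟩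
  | cons i ω ih =>
    obtain ⟨ω', hs, hr, e⟩ := ih
    rcases cs.length_simple_mul (cs.wordProd ω') i with h | h
    · refine ⟨i :: ω', hs.cons_cons i, ?_, by rw [cs.wordProd_cons, cs.wordProd_cons, e]⟩
      rw [CoxeterSystem.IsReduced, cs.wordProd_cons, h, hr.eq, List.length_cons]
    · obtain ⟨j, hj, e'⟩ := exchange_left cs (ω := ω') (i := i)
        (by unfold CoxeterSystem.IsLeftDescent; omega)
      refine ⟨ω'.eraseIdx j, ((List.eraseIdx_sublist _ _).trans hs).cons i, ?_, ?_⟩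
      · rw [CoxeterSystem.IsReduced, ← e', List.length_eraseIdx_of_lt hj]
        rw [hr.eq] at h
        omega
      · rw [← e', cs.wordProd_cons, e]

/-! ### Parabolic subgroups -/

theorem simple_mem_parabolic {I : Set B} {i : B} (hi : i ∈ I) :
    cs.simple i ∈ parabolic cs I :=
  Subgroup.subset_closure ⟨i, hi, rfl⟩

theorem parabolic_mono {I J : Set B} (h : I ⊆ J) : parabolic cs I ≤ parabolic cs J :=
  Subgroup.closure_mono (Set.image_mono h)

theorem Finitary.mono {cs : CoxeterSystem M W} {I J : Set B} (hJ : Finitary cs J) (h : I ⊆ J) :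
    Finitary cs I :=
  have : Finite (parabolic cs J) := hJ
  Finite.of_injective _ (Subgroup.inclusion_injective (parabolic_mono cs h))

theorem wordProd_mem_parabolic {I : Set B} {ω : List B} (h : ∀ i ∈ ω, i ∈ I) :
    cs.wordProd ω ∈ parabolic cs I := by
  induction ω with
  | nil => simp
  | cons i ω ih =>
    rw [cs.wordProd_cons]
    exact mul_mem (simple_mem_parabolic cs (h i (by simp))) (ih fun j hj => h j (by simp [hj]))

theorem exists_reduced_of_mem_parabolic {I : Set B} {w : W} (h : w ∈ parabolic cs I) :
    ∃ ω : List B, (∀ i ∈ ω, i ∈ I) ∧ cs.IsReduced ω ∧ cs.wordProd ω = w := by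
  have key : ∃ ω : List B, (∀ i ∈ ω, i ∈ I) ∧ cs.wordProd ω = w := by
    induction h using Subgroup.closure_induction with
    | mem x hx =>
      obtain ⟨i, hi, rfl⟩ := hx
      exact ⟨[i], by simpa using hi, by simp⟩
    | one => exact ⟨[], by simp, by simp⟩
    | mul x y _ _ hx hy =>
      obtain ⟨ω, h1, rfl⟩ := hx
      obtain ⟨ω', h2, rfl⟩ := hy
      exact ⟨ω ++ ω', fun i hi => (List.mem_append.1 hi).elim (h1 i) (h2 i), cs.wordProd_append _ _⟩
    | inv x _ hx =>
      obtain ⟨ω, h1, rfl⟩ := hx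
      exact ⟨ω.reverse, fun i hi => h1 i (List.mem_reverse.1 hi), cs.wordProd_reverse _⟩
  obtain ⟨ω, h1, rfl⟩ := key
  obtain ⟨ω', hs, hr, e⟩ := exists_reduced_sublist cs ω
  exact ⟨ω', fun i hi => h1 i (hs.subset hi), hr, e⟩

theorem exists_simple_eq_of_mem_parabolic {I : Set B} {w : W} (h : w ∈ parabolic cs I)
    (hl : cs.length w = 1) : ∃ i ∈ I, w = cs.simple i := by
  obtain ⟨ω, h1, h2, rfl⟩ := exists_reduced_of_mem_parabolic cs h
  rw [h2.eq, List.length_eq_one_iff] at hl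
  obtain ⟨i, rfl⟩ := hl
  exact ⟨i, h1 i (by simp), by simp⟩

theorem exists_leftDescent_of_mem_parabolic {I : Set B} {a : W} (h : a ∈ parabolic cs I)
    (ha : a ≠ 1) : ∃ i ∈ I, cs.length (cs.simple i * a) + 1 = cs.length a := by
  obtain ⟨ω, h1, h2, rfl⟩ := exists_reduced_of_mem_parabolic cs h
  cases ω with
  | nil => simp at ha
  | cons i ω =>
    refine ⟨i, h1 i (by simp), ?_⟩
    have h3 : cs.IsReduced ω := by simpa using h2.drop 1
    rw [h2.eq, cs.wordProd_cons, cs.simple_mul_simple_cancel_left, h3.eq, List.length_cons]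

/-- `w` has no left descent in `I`. -/
def LeftMin (I : Set B) (w : W) : Prop :=
  ∀ i ∈ I, cs.length (cs.simple i * w) = cs.length w + 1

/-- `w` has no right descent in `I`. -/
def RightMin (I : Set B) (w : W) : Prop :=
  ∀ i ∈ I, cs.length (w * cs.simple i) = cs.length w + 1

/-- All elements of `I` are left descents of `w`. -/
def LeftMax (I : Set B) (w : W) : Prop :=
  ∀ i ∈ I, cs.length (cs.simple i * w) + 1 = cs.length w

/-- All elements of `I` are right descents of `w`. -/
def RightMax (I : Set B) (w : W) : Prop :=
  ∀ i ∈ I, cs.length (w * cs.simple i) + 1 = cs.length w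

theorem length_mul_inv_comm (x y : W) : cs.length (x⁻¹ * y⁻¹) = cs.length (y * x) := by
  rw [← mul_inv_rev, cs.length_inv]

variable {cs}

theorem leftMin_inv {I : Set B} {w : W} : LeftMin cs I w⁻¹ ↔ RightMin cs I w := by
  refine forall₂_congr fun i _ => ?_
  rw [← cs.inv_simple i, length_mul_inv_comm, cs.length_inv, cs.inv_simple]

theorem leftMax_inv {I : Set B} {w : W} : LeftMax cs I w⁻¹ ↔ RightMax cs I w := by
  refine forall₂_congr fun i _ => ?_
  rw [← cs.inv_simple i, length_mul_inv_comm, cs.length_inv, cs.inv_simple]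

/-! ### Double cosets -/

theorem mem_coset {I J : Set B} {x w : W} :
    w ∈ coset cs I J x ↔ ∃ a ∈ parabolic cs I, ∃ b ∈ parabolic cs J, w = a * x * b := by
  simp [coset, DoubleCoset.mem_doubleCoset]

theorem self_mem_coset {I J : Set B} (x : W) : x ∈ coset cs I J x :=
  mem_coset.2 ⟨1, one_mem _, 1, one_mem _, by simp⟩

theorem coset_eq_of_mem {I J : Set B} {x w : W} (h : w ∈ coset cs I J x) :
    coset cs I J w = coset cs I J x :=
  DoubleCoset.doubleCoset_eq_of_mem h

/-- Every element of `W_I x W_J`, for `x` of minimal length, is a product `a x b` with lengths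
adding. -/
theorem exists_reduced_of_mem_coset {I J : Set B} {x w : W}
    (hx : ∀ v ∈ coset cs I J x, cs.length x ≤ cs.length v) (hw : w ∈ coset cs I J x) :
    ∃ a ∈ parabolic cs I, ∃ b ∈ parabolic cs J, w = a * x * b ∧
      cs.length w = cs.length a + cs.length x + cs.length b := by
  obtain ⟨a, ha, b, hb, rfl⟩ := mem_coset.1 hw
  obtain ⟨α, hα, -, rfl⟩ := exists_reduced_of_mem_parabolic cs ha
  obtain ⟨β, hβ, -, rfl⟩ := exists_reduced_of_mem_parabolic cs hb
  obtain ⟨δ, hδ, rfl⟩ := cs.exists_isReduced x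
  obtain ⟨ω, hs, hr, e⟩ := exists_reduced_sublist cs (α ++ δ ++ β)
  obtain ⟨ω₁, β', rfl, hs₁, hβ'⟩ := List.sublist_append_iff.1 hs
  obtain ⟨α', δ', rfl, hα', hδ'⟩ := List.sublist_append_iff.1 hs₁
  have ha' := wordProd_mem_parabolic cs fun i hi => hα i (hα'.subset hi)
  have hb' := wordProd_mem_parabolic cs fun i hi => hβ i (hβ'.subset hi)
  rw [cs.wordProd_append, cs.wordProd_append, cs.wordProd_append, cs.wordProd_append] at e
  -- What the deletion leaves of the word of `x` still represents an element of the double coset, so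
  -- minimality of `x` means that no letter of it was deleted.
  have hd : cs.wordProd δ' ∈ coset cs I J (cs.wordProd δ) := by
    refine mem_coset.2 ⟨(cs.wordProd α')⁻¹ * cs.wordProd α, mul_mem (inv_mem ha') ha,
      cs.wordProd β * (cs.wordProd β')⁻¹, mul_mem hb (inv_mem hb'), ?_⟩
    rw [show (cs.wordProd α')⁻¹ * cs.wordProd α * cs.wordProd δ *
      (cs.wordProd β * (cs.wordProd β')⁻¹) = (cs.wordProd α')⁻¹ *
        (cs.wordProd α * cs.wordProd δ * cs.wordProd β) * (cs.wordProd β')⁻¹ by group, ← e]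
    group
  have h1 := hx _ hd
  have h2 := cs.length_wordProd_le δ'
  have h3 := hδ'.length_le
  rw [hδ.eq] at h1
  have h4 : δ' = δ := hδ'.eq_of_length (by omega)
  subst h4
  refine ⟨_, ha', _, hb', e.symm, ?_⟩
  have h5 := hr.eq
  rw [cs.wordProd_append, cs.wordProd_append, e, List.length_append, List.length_append] at h5
  have h6 := cs.length_wordProd_le α'
  have h7 := cs.length_wordProd_le β'
  have h8 := cs.length_mul_le (cs.wordProd α' * cs.wordProd δ') (cs.wordProd β')
  have h9 := cs.length_mul_le (cs.wordProd α') (cs.wordProd δ')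
  rw [e] at h8
  have := hδ.eq
  omega

theorem minElt_mem {p : Set W} (h : p.Nonempty) : minElt cs p ∈ p := by
  rw [minElt, dif_pos h]
  exact Function.argminOn_mem _ _ _

theorem length_minElt_le {p : Set W} {w : W} (h : w ∈ p) :
    cs.length (minElt cs p) ≤ cs.length w := by
  rw [minElt, dif_pos ⟨w, h⟩]
  exact Function.argminOn_le _ _ h

theorem coset_minElt {I J : Set B} {p : Set W} (hp : ∃ x, p = coset cs I J x) :
    p = coset cs I J (minElt cs p) := by
  obtain ⟨x, rfl⟩ := hp
  exact (coset_eq_of_mem (minElt_mem ⟨x, self_mem_coset x⟩)).symm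

theorem leftMin_minElt {I J : Set B} {p : Set W} (hp : ∃ x, p = coset cs I J x) :
    LeftMin cs I (minElt cs p) := by
  intro i hi
  have h1 : cs.simple i * minElt cs p ∈ p := by
    obtain ⟨x, rfl⟩ := hp
    exact (coset_eq_of_mem (minElt_mem (cs := cs) ⟨x, self_mem_coset x⟩)).subset
      (mem_coset.2 ⟨_, simple_mem_parabolic cs hi, 1, one_mem _, (mul_one _).symm⟩)
  have := length_minElt_le (cs := cs) h1
  rcases cs.length_simple_mul (minElt cs p) i with h | h <;> omega

theorem rightMin_minElt {I J : Set B} {p : Set W} (hp : ∃ x, p = coset cs I J x) :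
    RightMin cs J (minElt cs p) := by
  intro i hi
  have h1 : minElt cs p * cs.simple i ∈ p := by
    obtain ⟨x, rfl⟩ := hp
    exact (coset_eq_of_mem (minElt_mem (cs := cs) ⟨x, self_mem_coset x⟩)).subset
      (mem_coset.2 ⟨1, one_mem _, _, simple_mem_parabolic cs hi, by rw [one_mul]⟩)
  have := length_minElt_le (cs := cs) h1
  rcases cs.length_mul_simple (minElt cs p) i with h | h <;> omega

theorem exists_reduced_of_mem {I J : Set B} {p : Set W} (hp : ∃ x, p = coset cs I J x) {w : W}
    (hw : w ∈ p) : ∃ a ∈ parabolic cs I, ∃ b ∈ parabolic cs J, w = a * minElt cs p * b ∧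
      cs.length w = cs.length a + cs.length (minElt cs p) + cs.length b := by
  have e := coset_minElt hp
  refine exists_reduced_of_mem_coset (fun v hv => ?_) (e ▸ hw)
  rw [← e] at hv
  exact length_minElt_le hv

theorem LeftMin.eq_one_of_mul {I : Set B} {a x : W} (h : LeftMin cs I (a * x))
    (ha : a ∈ parabolic cs I) (hl : cs.length (a * x) = cs.length a + cs.length x) : a = 1 := by
  by_contra hn
  obtain ⟨i, hi, e⟩ := exists_leftDescent_of_mem_parabolic cs ha hn
  have h1 := h i hi
  have h2 := cs.length_mul_le (cs.simple i * a) x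
  rw [mul_assoc] at h2
  omega

theorem RightMin.eq_one_of_mul {I : Set B} {x b : W} (h : RightMin cs I (x * b))
    (hb : b ∈ parabolic cs I) (hl : cs.length (x * b) = cs.length x + cs.length b) : b = 1 := by
  rw [← leftMin_inv, mul_inv_rev] at h
  exact inv_eq_one.1 (h.eq_one_of_mul (inv_mem hb) (by
    rw [length_mul_inv_comm, hl, cs.length_inv, cs.length_inv, add_comm]))

theorem eq_minElt {I J : Set B} {p : Set W} (hp : ∃ x, p = coset cs I J x) {w : W} (hw : w ∈ p)
    (hl : LeftMin cs I w) (hr : RightMin cs J w) : w = minElt cs p := by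
  obtain ⟨a, ha, b, hb, rfl, e⟩ := exists_reduced_of_mem hp hw
  have h1 := cs.length_mul_le (a * minElt cs p) b
  have h2 := cs.length_mul_le a (minElt cs p)
  have h3 := cs.length_mul_le a (minElt cs p * b)
  have h4 := cs.length_mul_le (minElt cs p) b
  rw [← mul_assoc] at h3
  have hb1 := hr.eq_one_of_mul hb (by omega)
  subst hb1
  rw [mul_one] at hl e ⊢
  have ha1 := hl.eq_one_of_mul ha (by simpa using e)
  rw [ha1, one_mul]

theorem parabolic_empty : parabolic cs ∅ = ⊥ := by simp [parabolic]

theorem minElt_coset_of_min {I J : Set B} {w : W}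
    (hl : LeftMin cs I w) (hr : RightMin cs J w) : minElt cs (coset cs I J w) = w :=
  (eq_minElt ⟨w, rfl⟩ (self_mem_coset w) hl hr).symm

theorem LeftMin.length_mul {I : Set B} {a x : W} (h : LeftMin cs I x)
    (ha : a ∈ parabolic cs I) : cs.length (a * x) = cs.length a + cs.length x := by
  -- One-sided cosets are treated as double cosets with `J = ∅`.
  have e := minElt_coset_of_min (J := ∅) h (by intro i hi; exact hi.elim)
  obtain ⟨a', ha', b, hb, e1, e2⟩ := exists_reduced_of_mem (cs := cs) (I := I) (J := ∅)
    ⟨x, rfl⟩ (mem_coset.2 ⟨a, ha, 1, one_mem _, rfl⟩)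
  rw [parabolic_empty, Subgroup.mem_bot] at hb
  subst hb
  rw [e, mul_one, mul_one] at e1
  rw [e, mul_one, cs.length_one, add_zero, ← mul_right_cancel e1] at e2
  exact e2

theorem RightMin.length_mul {I : Set B} {x b : W} (h : RightMin cs I x)
    (hb : b ∈ parabolic cs I) : cs.length (x * b) = cs.length x + cs.length b := by
  have := (leftMin_inv.2 h).length_mul (inv_mem hb)
  rw [length_mul_inv_comm, cs.length_inv, cs.length_inv] at this
  omega

theorem exists_leftMin_factor (I : Set B) (w : W) :
    ∃ a ∈ parabolic cs I, ∃ v, LeftMin cs I v ∧ w = a * v ∧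
      cs.length w = cs.length a + cs.length v := by
  obtain ⟨a, ha, b, hb, e1, e2⟩ := exists_reduced_of_mem (cs := cs) (I := I) (J := ∅)
    ⟨w, rfl⟩ (self_mem_coset w)
  rw [parabolic_empty, Subgroup.mem_bot] at hb
  subst hb
  exact ⟨a, ha, _, leftMin_minElt ⟨w, rfl⟩, by simpa using e1, by simpa using e2⟩

/-! ### Longest elements -/

/-- Every reduced word of `u` begins a reduced word of `w`. Given a prefix `ω` of `w = ωκ` with `s_i
ω` reduced, the exchange for the left descent `i` removes a letter of `ωκ`; it cannot lie in `ω`, so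
it lies in `κ`. Finiteness of `W_I` is not assumed: lengths in `W_I` are bounded by that of `w`. -/
theorem LeftMax.length_eq {I : Set B} {w u : W} (h : LeftMax cs I w) (hu : u ∈ parabolic cs I) :
    cs.length w = cs.length u + cs.length (u⁻¹ * w) := by
  obtain ⟨ω, h1, h2, rfl⟩ := exists_reduced_of_mem_parabolic cs hu
  clear hu
  induction ω with
  | nil => simp
  | cons i ω ih =>
    have hr : cs.IsReduced ω := by simpa using h2.drop 1
    have h3 := ih (fun j hj => h1 j (by simp [hj])) hr
    obtain ⟨κ, hκ, e⟩ := cs.exists_isReduced ((cs.wordProd ω)⁻¹ * w)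
    have ew : cs.wordProd (ω ++ κ) = w := by rw [cs.wordProd_append, ← e]; group
    have hi := h i (h1 i (by simp))
    obtain ⟨j, hj, e'⟩ := exchange_left cs (ω := ω ++ κ) (i := i)
      (by rw [ew]; unfold CoxeterSystem.IsLeftDescent; omega)
    rw [List.length_append] at hj
    by_cases hjω : j < ω.length
    · exfalso
      rw [List.eraseIdx_append_of_lt_length hjω, cs.wordProd_append, cs.wordProd_append,
        ← mul_assoc, ← cs.wordProd_cons] at e'
      have h4 := h2.eq
      rw [mul_right_cancel e'] at h4
      have h5 := cs.length_wordProd_le (ω.eraseIdx j)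
      rw [List.length_eraseIdx_of_lt hjω] at h5
      simp only [List.length_cons] at h4
      omega
    · rw [List.eraseIdx_append_of_length_le (by omega), ew, cs.wordProd_append] at e'
      have h4 : (cs.wordProd (i :: ω))⁻¹ * w = cs.wordProd (κ.eraseIdx (j - ω.length)) := by
        rw [cs.wordProd_cons, mul_inv_rev, cs.inv_simple, mul_assoc, e']
        group
      have h5 := cs.length_wordProd_le (κ.eraseIdx (j - ω.length))
      rw [List.length_eraseIdx_of_lt (by omega)] at h5
      have h6 := cs.length_mul_le (cs.wordProd (i :: ω)) ((cs.wordProd (i :: ω))⁻¹ * w)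
      rw [mul_inv_cancel_left] at h6
      rw [e, hκ.eq, hr.eq] at h3
      rw [h4] at h6 ⊢
      rw [h2.eq, List.length_cons] at h6 ⊢
      omega

theorem RightMax.length_eq {I : Set B} {w u : W} (h : RightMax cs I w) (hu : u ∈ parabolic cs I) :
    cs.length w = cs.length (w * u⁻¹) + cs.length u := by
  have := (leftMax_inv.2 h).length_eq (inv_mem hu)
  rw [cs.length_inv, cs.length_inv, length_mul_inv_comm] at this
  omega

theorem longest_spec {I : Set B} (hI : Finitary cs I) : longest cs I ∈ parabolic cs I ∧
    ∀ v ∈ parabolic cs I, cs.length v ≤ cs.length (longest cs I) := by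
  have : Finite (parabolic cs I) := hI
  have h : ∃ w ∈ parabolic cs I, ∀ v ∈ parabolic cs I, cs.length v ≤ cs.length w := by
    obtain ⟨w, hw⟩ := Finite.exists_max fun v : parabolic cs I => cs.length v.1
    exact ⟨w, w.2, fun v hv => hw ⟨v, hv⟩⟩
  rw [longest, dif_pos h]
  exact h.choose_spec

theorem longest_mem {I : Set B} (hI : Finitary cs I) : longest cs I ∈ parabolic cs I :=
  (longest_spec hI).1

theorem longest_mem_of_subset {I J : Set B} (h : I ⊆ J) (hJ : Finitary cs J) :
    longest cs I ∈ parabolic cs J :=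
  parabolic_mono cs h (longest_mem (hJ.mono h))

theorem leftMax_of_maximal {I : Set B} {w : W} (hw : w ∈ parabolic cs I)
    (h : ∀ v ∈ parabolic cs I, cs.length v ≤ cs.length w) : LeftMax cs I w := by
  intro i hi
  have := h _ (mul_mem (simple_mem_parabolic cs hi) hw)
  rcases cs.length_simple_mul w i with h | h <;> omega

theorem leftMax_longest {I : Set B} (hI : Finitary cs I) : LeftMax cs I (longest cs I) :=
  leftMax_of_maximal (longest_mem hI) (longest_spec hI).2

theorem eq_longest_of_leftMax {I : Set B} (hI : Finitary cs I) {w : W} (hw : w ∈ parabolic cs I)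
    (h : LeftMax cs I w) : w = longest cs I := by
  have h1 := h.length_eq (longest_mem hI)
  have h2 := (longest_spec hI).2 w hw
  have h3 : (longest cs I)⁻¹ * w = 1 := cs.length_eq_zero_iff.1 (by omega)
  exact (inv_mul_eq_one.1 h3).symm

theorem eq_longest_of_length {I : Set B} (hI : Finitary cs I) {w : W} (hw : w ∈ parabolic cs I)
    (h : cs.length (longest cs I) ≤ cs.length w) : w = longest cs I :=
  eq_longest_of_leftMax hI hw
    (leftMax_of_maximal hw fun v hv => ((longest_spec hI).2 v hv).trans h)

theorem longest_inv {I : Set B} (hI : Finitary cs I) : (longest cs I)⁻¹ = longest cs I :=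
  eq_longest_of_length hI (inv_mem (longest_mem hI)) (by rw [cs.length_inv])

theorem longest_mul_self {I : Set B} (hI : Finitary cs I) : longest cs I * longest cs I = 1 := by
  nth_rw 1 [← longest_inv hI]
  exact inv_mul_cancel _

theorem rightMax_longest {I : Set B} (hI : Finitary cs I) : RightMax cs I (longest cs I) := by
  rw [← leftMax_inv, longest_inv hI]
  exact leftMax_longest hI

theorem length_longest_eq {I : Set B} (hI : Finitary cs I) {u : W} (hu : u ∈ parabolic cs I) :
    cs.length (longest cs I) = cs.length (longest cs I * u⁻¹) + cs.length u :=
  (rightMax_longest hI).length_eq hu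

theorem longest_congr {I J : Set B} (h : parabolic cs I = parabolic cs J) :
    longest cs I = longest cs J := by
  unfold longest
  rw [h]

/-- The maximal element of a double coset is unique. -/
theorem eq_of_leftMax_of_rightMax {I J : Set B} (hI : Finitary cs I) {p : Set W}
    (hp : ∃ x, p = coset cs I J x) {v w : W} (hv : v ∈ p) (hw : w ∈ p)
    (hvl : LeftMax cs I v) (hvr : RightMax cs J v) (hwl : LeftMax cs I w)
    (hwr : RightMax cs J w) : v = w := by
  -- Left maximality forces the `W_I`-part of `u` to be `w_I`, so all candidates lie in the one left
  -- coset `w_I x W_J`.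
  have key : ∀ u ∈ p, LeftMax cs I u →
      ∃ b ∈ parabolic cs J, u = longest cs I * minElt cs p * b := by
    intro u hu hul
    obtain ⟨a, ha, u', hu', e1, e2⟩ := exists_leftMin_factor (cs := cs) I u
    have ha' : a = longest cs I := by
      refine eq_longest_of_leftMax hI ha fun i hi => ?_
      have h1 := hul i hi
      have h2 := hu'.length_mul (mul_mem (simple_mem_parabolic cs hi) ha)
      rw [mul_assoc, ← e1] at h2
      omega
    have hu'p : u' ∈ p := by
      obtain ⟨x, rfl⟩ := hp
      rw [← coset_eq_of_mem hu]
      exact mem_coset.2 ⟨a⁻¹, inv_mem ha, 1, one_mem _, by rw [e1]; group⟩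
    obtain ⟨a', ha2, b, hb, rfl, e⟩ := exists_reduced_of_mem hp hu'p
    have h3 := cs.length_mul_le (minElt cs p) b
    have h4 := cs.length_mul_le a' (minElt cs p * b)
    rw [← mul_assoc] at h4
    have : a' = 1 := by
      rw [mul_assoc] at hu'
      refine hu'.eq_one_of_mul ha2 ?_
      rw [← mul_assoc]
      omega
    subst this
    exact ⟨b, hb, by rw [e1, ha', one_mul, mul_assoc]⟩
  obtain ⟨b, hb, rfl⟩ := key v hv hvl
  obtain ⟨c, hc, rfl⟩ := key w hw hwl
  -- Each candidate is as long as the other plus their quotient in `W_J`, so the quotient is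
  -- trivial.
  have h1 := hvr.length_eq (mul_mem (inv_mem hc) hb)
  have h2 := hwr.length_eq (mul_mem (inv_mem hb) hc)
  rw [show longest cs I * minElt cs p * b * (c⁻¹ * b)⁻¹ = longest cs I * minElt cs p * c by
    group] at h1
  rw [show longest cs I * minElt cs p * c * (b⁻¹ * c)⁻¹ = longest cs I * minElt cs p * b by
    group] at h2
  have h3 : c⁻¹ * b = 1 := cs.length_eq_zero_iff.1 (by omega)
  rw [inv_mul_eq_one.1 h3]

/-! ### Redundancies -/

/-- Deodhar's lemma. -/
theorem simple_mul_eq_mul_simple {v : W} {i j : B} (hv : cs.length (v * cs.simple j)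
    = cs.length v + 1) (h : cs.length (cs.simple i * v * cs.simple j) + 1 =
      cs.length (cs.simple i * v)) : cs.simple i * v = v * cs.simple j := by
  obtain ⟨ω, hω, rfl⟩ := cs.exists_isReduced v
  have h1 : cs.length (cs.simple i * cs.wordProd ω) = cs.length (cs.wordProd ω) + 1 := by
    rcases cs.length_simple_mul (cs.wordProd ω) i with h' | h'
    · exact h'
    · have := cs.length_mul_le (cs.simple i) (cs.simple i * cs.wordProd ω * cs.simple j)
      rw [mul_assoc, cs.simple_mul_simple_cancel_left, cs.length_simple, ← mul_assoc] at this
      omega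
  obtain ⟨n, hn, e⟩ := exchange_right cs (ω := i :: ω) (i := j)
    (by rw [cs.wordProd_cons]; unfold CoxeterSystem.IsRightDescent; omega)
  rw [cs.wordProd_cons] at e
  -- The exchanged letter is the leading `i`, which gives the claim, or lies in `ω`, which would
  -- make `v s_j` too short.
  cases n with
  | zero =>
    rw [List.eraseIdx_cons_zero] at e
    nth_rw 2 [← e]
    rw [cs.simple_mul_simple_cancel_right]
  | succ n =>
    exfalso
    rw [List.eraseIdx_cons_succ, cs.wordProd_cons, mul_assoc, mul_left_cancel_iff] at e
    have h2 := cs.length_wordProd_le (ω.eraseIdx n)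
    rw [List.length_eraseIdx_of_lt (by simpa using hn), ← e, hv, hω.eq] at h2
    omega

/-- For `x` without left descents in `r` and right descents in `J`, elements of `W_r` that are
minimal modulo `W_ℓ` on the right, where `ℓ = r ∩ x J x⁻¹`, stay minimal modulo `W_J` after
multiplication by `x`. -/
theorem rightMin_mul {r J : Set B} {x a : W} (hl : LeftMin cs r x) (hr : RightMin cs J x)
    (ha : a ∈ parabolic cs r)
    (hmin : RightMin cs {i | i ∈ r ∧ ∃ j ∈ J, cs.simple i = x * cs.simple j * x⁻¹} a) :
    RightMin cs J (a * x) := by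
  obtain ⟨ω, h1, h2, rfl⟩ := exists_reduced_of_mem_parabolic cs ha
  clear ha
  induction ω with
  | nil => simpa using hr
  | cons i ω ih =>
    have hω : cs.IsReduced ω := by simpa using h2.drop 1
    have hωr := wordProd_mem_parabolic cs fun j hj => h1 j (List.mem_cons_of_mem i hj)
    have hlen : cs.length (cs.simple i * cs.wordProd ω) = cs.length (cs.wordProd ω) + 1 := by
      rw [← cs.wordProd_cons, h2.eq, hω.eq, List.length_cons]
    rw [cs.wordProd_cons] at hmin
    have hmin' : RightMin cs {i | i ∈ r ∧ ∃ j ∈ J, cs.simple i = x * cs.simple j * x⁻¹}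
        (cs.wordProd ω) := by
      intro j hj
      have h3 := hmin j hj
      have h4 := cs.length_mul_le (cs.simple i) (cs.wordProd ω * cs.simple j)
      rw [cs.length_simple, ← mul_assoc] at h4
      rcases cs.length_mul_simple (cs.wordProd ω) j with h | h <;> omega
    have IH := ih (fun j hj => h1 j (List.mem_cons_of_mem i hj)) hω hmin'
    intro j hj
    rw [cs.wordProd_cons, mul_assoc (cs.simple i)]
    rcases cs.length_mul_simple (cs.simple i * (cs.wordProd ω * x)) j with h | h
    · exact h
    · exfalso
      -- If `s_j` becomes a right descent on adding `s_i`, Deodhar's lemma puts `x s_j x⁻¹` into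
      -- `W_r`. Left minimality of `x` gives it length one, so it is a simple reflection of `ℓ`, and
      -- it shortens `a` from the right.
      have e := simple_mul_eq_mul_simple (IH j hj) h
      have e2 : x * cs.simple j * x⁻¹ = (cs.wordProd ω)⁻¹ * cs.simple i * cs.wordProd ω := by
        have : cs.simple i * cs.wordProd ω = cs.wordProd ω * (x * cs.simple j * x⁻¹) := by
          rw [← mul_assoc, ← mul_assoc, ← e]
          group
        rw [mul_assoc _ (cs.simple i), this]
        group
      have hmem : x * cs.simple j * x⁻¹ ∈ parabolic cs r := by
        rw [e2]
        exact mul_mem (mul_mem (inv_mem hωr) (simple_mem_parabolic cs (h1 i (by simp)))) hωr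
      have h3 := hl.length_mul hmem
      rw [inv_mul_cancel_right, hr j hj] at h3
      obtain ⟨i', hi', e3⟩ := exists_simple_eq_of_mem_parabolic cs hmem (by omega)
      have h4 := hmin i' ⟨hi', j, hj, e3.symm⟩
      rw [← e3, e2, show cs.simple i * cs.wordProd ω * ((cs.wordProd ω)⁻¹ * cs.simple i *
        cs.wordProd ω) = cs.simple i * cs.simple i * cs.wordProd ω by group,
        cs.simple_mul_simple_self, one_mul] at h4
      omega

end CoxeterTheory

end SingularSoergel

namespace SingularSoergel

/-! ### Orders of products of simple reflections, and Matsumoto's theorem -/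

section Matsumoto

variable {B W : Type*} [Group W] {M : CoxeterMatrix B} (cs : CoxeterSystem M W)

/-! ### The geometric representation and the order of a product of two simple reflections -/

variable (M) in
/-- The contragredient geometric representation of a simple reflection. -/
def geomReflection (i : B) : Function.End (B → ℝ) :=
  fun φ k => φ k + 2 * Real.cos (Real.pi / M i k) * φ i

theorem geomReflection_apply (i k : B) (φ : B → ℝ) :
    geomReflection M i φ k = φ k + 2 * Real.cos (Real.pi / M i k) * φ i := rfl

theorem geomReflection_self (i : B) (φ : B → ℝ) : geomReflection M i φ i = -φ i := by
  rw [geomReflection_apply, M.diagonal]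
  simp
  ring

/-- On the values at `i` and `j`, the product of the two reflections is a rotation by `2θ` in a skew
basis. The factor `sin θ` avoids division and keeps the formula true for `θ = 0`. -/
theorem geom_pow {i j : B} (n : ℕ) (φ : B → ℝ) :
    let θ := Real.pi / M i j
    let ψ := ((geomReflection M i * geomReflection M j) ^ n : Function.End (B → ℝ)) φ
    ψ i * Real.sin θ = -φ i * Real.sin (2 * n * θ - θ) - φ j * Real.sin (2 * n * θ) ∧
    ψ j * Real.sin θ = φ i * Real.sin (2 * n * θ) + φ j * Real.sin (2 * n * θ + θ) := by
  intro θ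
  induction n with
  | zero => simp [end_one_apply]
  | succ n ih =>
    obtain ⟨h1, h2⟩ := ih
    rw [pow_succ', end_mul_apply, end_mul_apply]
    set ψ := ((geomReflection M i * geomReflection M j) ^ n : Function.End (B → ℝ)) φ
    simp only [geomReflection_self]
    rw [geomReflection_apply j i, geomReflection_apply i j, geomReflection_self,
      geomReflection_apply j i, M.symmetric j i]
    change -(ψ i + 2 * Real.cos θ * ψ j) * _ = _ ∧
      (-ψ j + 2 * Real.cos θ * (ψ i + 2 * Real.cos θ * ψ j)) * _ = _
    have e1 : 2 * ((n + 1 : ℕ) : ℝ) * θ - θ = 2 * n * θ + θ := by push_cast; ring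
    have e2 : 2 * ((n + 1 : ℕ) : ℝ) * θ = 2 * n * θ + (θ + θ) := by push_cast; ring
    rw [e1, e2, add_assoc (2 * (n : ℝ) * θ) (θ + θ) θ]
    generalize 2 * (n : ℝ) * θ = x at *
    simp only [Real.sin_add, Real.cos_add, Real.sin_sub] at *
    have hs := Real.sin_sq_add_cos_sq θ
    generalize Real.sin θ = s at *
    generalize Real.cos θ = c at *
    generalize Real.sin x = S at *
    generalize Real.cos x = C at *
    have hs' : s ^ 2 = 1 - c ^ 2 := by linear_combination hs
    have hs3 : s ^ 3 = s - c ^ 2 * s := by linear_combination s * hs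
    constructor
    · linear_combination -h1 - 2 * c * h2 + (-φ j * S) * hs
    · linear_combination (4 * c ^ 2 - 1) * h2 + 2 * c * h1 + (φ i * S + φ j * C * s + 3 * φ j * S * c) * hs

theorem geomReflection_liftable : M.IsLiftable (geomReflection M) := by
  intro i j
  by_cases hij : i = j
  · subst hij
    rw [M.diagonal, pow_one]
    funext φ k
    rw [end_mul_apply, geomReflection_apply, geomReflection_self, geomReflection_apply,
      end_one_apply]
    ring
  by_cases hm : M i j = 0
  · rw [hm, pow_zero]
  funext φ k
  set θ := Real.pi / M i j with hθ
  have hm2 : 2 ≤ M i j := by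
    have := M.off_diagonal i j hij
    change M i j ≠ 1 at this
    omega
  have hs : 0 < Real.sin θ := by
    apply Real.sin_pos_of_pos_of_lt_pi
    · positivity
    · rw [hθ]
      exact div_lt_self Real.pi_pos (by exact_mod_cast hm2)
  -- The invariant is `sin² θ` times the value on the component of the root `k` orthogonal to the
  -- roots `i` and `j`, which both reflections fix. As the values at `i` and `j` return after `m_ij`
  -- rounds, so does the value at `k`.
  have key : ∀ n : ℕ, let ψ := ((geomReflection M i * geomReflection M j) ^ n :
      Function.End (B → ℝ)) φ
      Real.sin θ ^ 2 * ψ k + (Real.cos (Real.pi / M i k) + Real.cos θ * Real.cos (Real.pi / M j k)) *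
        ψ i + (Real.cos (Real.pi / M j k) + Real.cos θ * Real.cos (Real.pi / M i k)) * ψ j =
      Real.sin θ ^ 2 * φ k + (Real.cos (Real.pi / M i k) + Real.cos θ * Real.cos (Real.pi / M j k)) *
        φ i + (Real.cos (Real.pi / M j k) + Real.cos θ * Real.cos (Real.pi / M i k)) * φ j := by
    intro n
    induction n with
    | zero => rfl
    | succ n ih =>
      rw [pow_succ', end_mul_apply, end_mul_apply]
      refine Eq.trans ?_ ih
      set ψ := ((geomReflection M i * geomReflection M j) ^ n : Function.End (B → ℝ)) φ
      simp only [geomReflection_self]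
      rw [geomReflection_apply j i, geomReflection_apply i j, geomReflection_self,
        geomReflection_apply i k, geomReflection_apply j k,
        geomReflection_apply j i, M.symmetric j i, ← hθ, Real.sin_sq]
      ring
  obtain ⟨h1, h2⟩ := geom_pow (i := i) (j := j) (M i j) φ
  have h3 := key (M i j)
  simp only at h1 h2 h3
  rw [end_one_apply]
  have hm0 : (M i j : ℝ) ≠ 0 := by exact_mod_cast hm
  have e0 : 2 * (M i j : ℝ) * (Real.pi / M i j) = 2 * Real.pi := by field_simp
  rw [e0, ← hθ] at h1 h2
  rw [Real.sin_two_pi, Real.sin_two_pi_sub] at h1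
  rw [Real.sin_two_pi, add_comm, add_comm (2 * Real.pi), Real.sin_add_two_pi] at h2
  have h1' := mul_right_cancel₀ hs.ne' (h1.trans (b := _) (c := φ i * Real.sin θ) (by ring))
  have h2' := mul_right_cancel₀ hs.ne' (h2.trans (b := _) (c := φ j * Real.sin θ) (by ring))
  rw [h1', h2'] at h3
  have : Real.sin θ ^ 2 ≠ 0 := by positivity
  exact mul_left_cancel₀ this (by linarith)

theorem dvd_of_pow_eq_one {i j : B} (hij : i ≠ j) {n : ℕ}
    (h : (cs.simple i * cs.simple j) ^ n = 1) : M i j ∣ n := by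
  classical
  have h0 := congrArg (cs.lift ⟨_, geomReflection_liftable⟩) h
  rw [map_pow, map_mul, cs.lift_apply_simple, cs.lift_apply_simple, map_one] at h0
  set φ : B → ℝ := Pi.single i 1 with hφ
  have hi : φ i = 1 := by simp [hφ]
  have hj : φ j = 0 := by simp [hφ, hij.symm]
  -- The value `0` encodes `m_ij = ∞`; then `π / 0 = 0` makes the cosine equal to `1`, and the value
  -- at `j` grows linearly with `n`.
  by_cases hm : M i j = 0
  · have key : ∀ n : ℕ, let ψ := ((geomReflection M i * geomReflection M j) ^ n :
        Function.End (B → ℝ)) φ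
        ψ i = 1 - 2 * n ∧ ψ j = 2 * n := by
      intro n
      induction n with
      | zero => simp [end_one_apply, hi, hj]
      | succ n ih =>
        obtain ⟨h1, h2⟩ := ih
        rw [pow_succ', end_mul_apply, end_mul_apply]
        set ψ := ((geomReflection M i * geomReflection M j) ^ n : Function.End (B → ℝ)) φ
        simp only [geomReflection_self]
        rw [geomReflection_apply j i, geomReflection_apply i j, geomReflection_self,
          geomReflection_apply j i, M.symmetric j i, hm, h1, h2]
        simp
        constructor <;> ring
    have h1 := (key n).2
    rw [h0, end_one_apply, hj] at h1
    have : n = 0 := by exact_mod_cast (by linarith : (n : ℝ) = 0)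
    rw [this]
    exact dvd_zero _
  · obtain ⟨h1, h2⟩ := geom_pow (i := i) (j := j) n φ
    rw [h0, end_one_apply, hi, hj] at h1 h2
    set θ := Real.pi / M i j with hθ
    have hm2 : 2 ≤ M i j := by
      have := M.off_diagonal i j hij
      change M i j ≠ 1 at this
      omega
    have hs : 0 < Real.sin θ := by
      apply Real.sin_pos_of_pos_of_lt_pi
      · positivity
      · rw [hθ]
        exact div_lt_self Real.pi_pos (by exact_mod_cast hm2)
    have h3 : Real.sin (2 * n * θ) = 0 := by linarith
    rw [Real.sin_sub, h3] at h1
    have h4 : Real.cos (2 * n * θ) = 1 := mul_right_cancel₀ hs.ne' (by linarith)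
    obtain ⟨l, hl⟩ := (Real.cos_eq_one_iff _).1 h4
    have hm0 : (M i j : ℝ) ≠ 0 := by exact_mod_cast hm
    have h5 : (l : ℝ) * M i j = n := by
      have hp := Real.pi_pos.ne'
      rw [hθ] at hl
      field_simp at hl
      linarith
    have h6 : (n : ℤ) = M i j * l := by
      have : ((n : ℤ) : ℝ) = ((M i j * l : ℤ) : ℝ) := by push_cast; linarith
      exact_mod_cast this
    exact Int.natCast_dvd_natCast.1 ⟨l, h6⟩

theorem pow_ne_one {i j : B} (hij : i ≠ j) {n : ℕ} (h0 : 0 < n)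
    (hn : M i j = 0 ∨ n < M i j) : (cs.simple i * cs.simple j) ^ n ≠ 1 := by
  intro h
  have h1 := dvd_of_pow_eq_one cs hij h
  rcases hn with hn | hn
  · rw [hn, zero_dvd_iff] at h1
    omega
  · exact absurd (Nat.le_of_dvd h0 h1) (by omega)

/-! ### Alternating words -/

/-- An inversion occurring exactly once in `ω` occurs, by parity, in every reduced word of the same
element. So `ω` has no more letters than such a word. -/
theorem isReduced_of_nodup {ω : List B} (h : (cs.rightInvSeq ω).Nodup) : cs.IsReduced ω := by
  classical
  obtain ⟨ω', hω', e⟩ := cs.exists_isReduced (cs.wordProd ω)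
  have hsub : cs.rightInvSeq ω ⊆ cs.rightInvSeq ω' := by
    intro t ht
    by_contra hn
    have := count_rightInvSeq_eq cs e t
    rw [List.count_eq_one_of_mem h ht, List.count_eq_zero_of_not_mem hn] at this
    simp at this
  have h1 := (List.subperm_of_subset h hsub).length_le
  rw [cs.length_rightInvSeq, cs.length_rightInvSeq] at h1
  have h2 := cs.length_wordProd_le ω
  have h3 := hω'.eq
  rw [← e] at h3
  rw [CoxeterSystem.IsReduced]
  omega

open CoxeterSystem in
theorem rightInvSeq_alternatingWord_succ (i j : B) (n : ℕ) :
    cs.rightInvSeq (alternatingWord i j (n + 1)) =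
      cs.simple j * (cs.simple i * cs.simple j) ^ n ::
        cs.rightInvSeq (alternatingWord i j n) := by
  have hinv : ∀ k : ℕ, cs.simple j * (cs.simple i * cs.simple j) ^ k
      = ((cs.simple i * cs.simple j) ^ k)⁻¹ * cs.simple j := by
    intro k
    induction k with
    | zero => simp
    | succ k ihk =>
      rw [pow_succ, ← mul_assoc, ihk, ← pow_succ, pow_succ', mul_inv_rev, mul_inv_rev]
      simp only [cs.inv_simple, mul_assoc]
  rw [alternatingWord_succ', rightInvSeq, prod_alternatingWord_eq_mul_pow]
  congr 1
  rcases Nat.even_or_odd' n with ⟨k, rfl | rfl⟩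
  · simp only [even_two, Even.mul_right, if_true, one_mul, Nat.mul_div_cancel_left k two_pos]
    rw [← hinv, two_mul, pow_add, mul_assoc]
  · have h1 : ¬ Even (2 * k + 1) := by simp
    have h2 : (2 * k + 1) / 2 = k := by omega
    rw [if_neg h1, if_neg h1, h2, mul_inv_rev, cs.inv_simple, ← hinv,
      show 2 * k + 1 = k + (1 + k) by ring, pow_add, pow_add, pow_one]
    simp only [mul_assoc]

-- The inversions are `s_j (s_i s_j)^m` for `m < n`, and a repetition among them would give `s_i
-- s_j` an order smaller than `m_ij`.
open CoxeterSystem in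
theorem isReduced_alternatingWord {i j : B} (hij : i ≠ j) (n : ℕ)
    (hn : M i j = 0 ∨ n ≤ M i j) : cs.IsReduced (alternatingWord i j n) := by
  apply isReduced_of_nodup
  have hmem : ∀ n, ∀ t ∈ cs.rightInvSeq (alternatingWord i j n),
      ∃ m < n, t = cs.simple j * (cs.simple i * cs.simple j) ^ m := by
    intro n
    induction n with
    | zero => simp [alternatingWord]
    | succ n ih =>
      intro t ht
      rw [rightInvSeq_alternatingWord_succ, List.mem_cons] at ht
      rcases ht with rfl | ht
      · exact ⟨n, by omega, rfl⟩
      · obtain ⟨m, hm, e⟩ := ih t ht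
        exact ⟨m, by omega, e⟩
  induction n with
  | zero => simp [alternatingWord]
  | succ n ih =>
    rw [rightInvSeq_alternatingWord_succ, List.nodup_cons]
    refine ⟨fun h => ?_, ih (by omega)⟩
    obtain ⟨m, hm, e⟩ := hmem n _ h
    rw [mul_left_cancel_iff] at e
    refine pow_ne_one cs hij (n := n - m) (by omega) (by omega) ?_
    rw [pow_sub _ (by omega : m ≤ n), e, mul_inv_cancel]

/-- The word `s t s ⋯` of length `n`. -/
def alt : B → B → ℕ → List B
  | _, _, 0 => []
  | s, t, n + 1 => s :: alt t s n

theorem alt_eq_reverse (s t : B) (n : ℕ) :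
    alt s t n = (CoxeterSystem.alternatingWord t s n).reverse := by
  induction n generalizing s t with
  | zero => rfl
  | succ n ih =>
    rw [CoxeterSystem.alternatingWord_succ, List.concat_eq_append, List.reverse_append, ← ih]
    rfl

theorem length_alt (s t : B) (n : ℕ) : (alt s t n).length = n := by
  rw [alt_eq_reverse, List.length_reverse, CoxeterSystem.length_alternatingWord]

theorem isReduced_alt {s t : B} (hst : s ≠ t) (n : ℕ) (hn : M s t = 0 ∨ n ≤ M s t) :
    cs.IsReduced (alt s t n) := by
  rw [alt_eq_reverse, cs.isReduced_reverse_iff]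
  exact isReduced_alternatingWord cs hst.symm n (by rwa [M.symmetric])

theorem wordProd_alt (s t : B) : cs.wordProd (alt s t (M s t)) = cs.wordProd (alt t s (M s t)) := by
  rw [alt_eq_reverse, alt_eq_reverse, cs.wordProd_reverse, cs.wordProd_reverse, inv_inj]
  have := cs.wordProd_braidWord_eq s t
  rw [CoxeterSystem.braidWord, CoxeterSystem.braidWord, M.symmetric t s] at this
  exact this.symm

theorem mem_alt {s t i : B} {n : ℕ} (h : i ∈ alt s t n) : i = s ∨ i = t := by
  induction n generalizing s t with
  | zero => simp [alt] at h
  | succ n ih =>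
    rw [alt, List.mem_cons] at h
    rcases h with h | h
    · exact Or.inl h
    · exact (ih h).symm

variable {cs} in
/-- Matsumoto's theorem: elements of a monoid that satisfy the braid relations have the same
product along all reduced words of an element. -/
theorem prod_eq_of_isReduced {X : Type*} [Monoid X] (f : B → X)
    (hf : ∀ s t, s ≠ t → M s t ≠ 0 →
      ((alt s t (M s t)).map f).prod = ((alt t s (M s t)).map f).prod)
    {ω ω' : List B} (h : cs.IsReduced ω) (h' : cs.IsReduced ω')
    (e : cs.wordProd ω = cs.wordProd ω') : (ω.map f).prod = (ω'.map f).prod := by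
  induction hn : ω.length generalizing ω ω' with
  | zero =>
    have h1 := h'.eq
    rw [← e, h.eq, hn] at h1
    rw [List.length_eq_zero_iff.1 hn, List.length_eq_zero_iff.1 h1.symm]
  | succ n ih =>
    have hlen : ω'.length = n + 1 := by rw [← h'.eq, ← e, h.eq, hn]
    -- Words with the same first letter reduce to the induction hypothesis.
    have same : ∀ {s : B} {κ κ' : List B}, cs.IsReduced (s :: κ) → cs.IsReduced (s :: κ') →
        cs.wordProd (s :: κ) = cs.wordProd (s :: κ') → κ.length = n →
        ((s :: κ).map f).prod = ((s :: κ').map f).prod := by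
      intro s κ κ' hκ hκ' e hl
      rw [cs.wordProd_cons, cs.wordProd_cons, mul_left_cancel_iff] at e
      rw [List.map_cons, List.map_cons, List.prod_cons, List.prod_cons,
        ih (by simpa using hκ.drop 1) (by simpa using hκ'.drop 1) e hl]
    obtain ⟨s, κ, rfl⟩ := List.exists_cons_of_length_eq_add_one hn
    obtain ⟨t, κ', rfl⟩ := List.exists_cons_of_length_eq_add_one hlen
    by_cases hst : s = t
    · subst hst
      exact same h h' e (by simpa using hn)
    have desc : ∀ {i : B} {ν : List B}, cs.IsReduced (i :: ν) →
        cs.length (cs.simple i * cs.wordProd (i :: ν)) + 1 = cs.length (cs.wordProd (i :: ν)) := by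
      intro i ν hν
      have h3 : cs.IsReduced ν := by simpa using hν.drop 1
      rw [hν.eq, cs.wordProd_cons, cs.simple_mul_simple_cancel_left, h3.eq, List.length_cons]
    set w := cs.wordProd (s :: κ) with hw
    have hmax : LeftMax cs {s, t} w := by
      intro i hi
      rcases hi with rfl | hi
      · exact desc h
      · rw [Set.mem_singleton_iff] at hi
        subst hi
        rw [e]
        exact desc h'
    have hmem : ∀ n, cs.wordProd (alt s t n) ∈ parabolic cs {s, t} := fun n =>
      wordProd_mem_parabolic cs fun i hi => by simpa using mem_alt hi
    -- If `m_st = ∞`, there are reduced alternating words of every length, whereas `w`, having both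
    -- `s` and `t` as left descents, bounds the lengths in `W_{s,t}`.
    have hm : M s t ≠ 0 := by
      intro h0
      have h1 := hmax.length_eq (hmem (cs.length w + 1))
      rw [(isReduced_alt cs hst _ (Or.inl h0)).eq, length_alt] at h1
      omega
    have h1 := hmax.length_eq (hmem (M s t))
    have r1 := isReduced_alt cs hst (M s t) (Or.inr le_rfl)
    have r2 := isReduced_alt cs (Ne.symm hst) (M s t) (Or.inr (M.symmetric t s).ge)
    -- The alternating element of length `m_st` is a prefix of `w`. This yields a reduced word of
    -- `w` starting with each of the two alternating words; the given words are compared with these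
    -- by their first letters, and these with each other by the braid relation.
    obtain ⟨ν, hν, eν⟩ := cs.exists_isReduced ((cs.wordProd (alt s t (M s t)))⁻¹ * w)
    have e1 : cs.wordProd (alt s t (M s t) ++ ν) = w := by
      rw [cs.wordProd_append, ← eν, mul_inv_cancel_left]
    have e2 : cs.wordProd (alt t s (M s t) ++ ν) = w := by
      rw [cs.wordProd_append, ← wordProd_alt, ← eν, mul_inv_cancel_left]
    rw [r1.eq, eν, hν.eq, length_alt] at h1
    have q1 : cs.IsReduced (alt s t (M s t) ++ ν) := by
      rw [CoxeterSystem.IsReduced, e1, List.length_append, length_alt, h1]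
    have q2 : cs.IsReduced (alt t s (M s t) ++ ν) := by
      rw [CoxeterSystem.IsReduced, e2, List.length_append, length_alt, h1]
    have q3 : (((alt s t (M s t)) ++ ν).map f).prod = (((alt t s (M s t)) ++ ν).map f).prod := by
      rw [List.map_append, List.map_append, List.prod_append, List.prod_append, hf s t hst hm]
    obtain ⟨m, hm'⟩ := Nat.exists_eq_succ_of_ne_zero hm
    rw [hm'] at q1 q2 e1 e2 q3
    simp only [alt, List.cons_append] at q1 q2 e1 e2 q3
    rw [same h q1 (hw.symm.trans e1.symm) (by simpa using hn), q3]
    refine (same h' q2 (e.symm.trans e2.symm) (by simpa using hlen)).symm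

end Matsumoto

end SingularSoergel

namespace SingularSoergel

/-! ### Demazure operators: Leibniz rule, braid and nil-Coxeter relations -/

namespace Realization

variable {B W : Type*} [Group W] {M : CoxeterMatrix B} {cs : CoxeterSystem M W}
  {k V : Type*} [Field k] [AddCommGroup V] [Module k V] {ρ : Realization cs k V}

/-! ### Simple Demazure operators -/

theorem act_ι (w : W) (v : V) :
    ρ.act w (SymmetricAlgebra.ι k V v) = SymmetricAlgebra.ι k V (ρ.action w v) := by
  simp [act]

theorem act_one (f : ρ.Poly) : ρ.act 1 f = f := by
  have : ρ.act 1 = AlgHom.id k ρ.Poly := by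
    apply SymmetricAlgebra.algHom_ext
    ext v
    simp [act_ι]
  rw [this]
  rfl

theorem act_mul (x y : W) (f : ρ.Poly) : ρ.act (x * y) f = ρ.act x (ρ.act y f) := by
  have : ρ.act (x * y) = (ρ.act x).comp (ρ.act y) := by
    apply SymmetricAlgebra.algHom_ext
    ext v
    simp [act_ι]
  rw [this]
  rfl

theorem act_simple_act_simple (s : B) (f : ρ.Poly) :
    ρ.act (cs.simple s) (ρ.act (cs.simple s) f) = f := by
  rw [← act_mul, cs.simple_mul_simple_self, act_one]

/-- In coordinates, `v` becomes a linear polynomial whose coefficients are the coordinates of `v`.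
-/
theorem ι_injective : Function.Injective (SymmetricAlgebra.ι k V) := by
  let b := Module.Basis.ofVectorSpace k V
  intro v w h
  have h1 : (SymmetricAlgebra.equivMvPolynomial b) (SymmetricAlgebra.ι k V v) =
    (SymmetricAlgebra.equivMvPolynomial b) (SymmetricAlgebra.ι k V w) := by rw [h]
  apply b.repr.injective
  ext i
  have h2 : ∀ u : V, (SymmetricAlgebra.equivMvPolynomial b) (SymmetricAlgebra.ι k V u) =
      Finsupp.linearCombination k MvPolynomial.X (b.repr u) := by
    intro u
    conv_lhs => rw [← b.linearCombination_repr u]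
    simp [Finsupp.linearCombination_apply, Finsupp.sum]
  rw [h2, h2] at h1
  have h3 : ∀ c : _ →₀ k, MvPolynomial.coeff (Finsupp.single i 1)
      (Finsupp.linearCombination k (MvPolynomial.X (R := k)) c) = c i := by
    classical
    intro c
    rw [Finsupp.linearCombination_apply, Finsupp.sum, MvPolynomial.coeff_sum]
    simp only [MvPolynomial.coeff_smul, MvPolynomial.coeff_X, smul_eq_mul, mul_ite, mul_one,
      mul_zero, Finsupp.single_left_inj one_ne_zero, Finset.sum_ite_eq', Finsupp.mem_support_iff]
    split_ifs with h
    · rfl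
    · simpa using (not_not.1 h).symm
  rw [← h3, h1, h3]

/-- If the root vanished, `s` would act trivially, contrary to faithfulness. Since `R` is a domain,
identities for `∂_s` can then be checked after multiplication by `α_s`. -/
theorem IsAdmissible.α_ne_zero (hρ : ρ.IsAdmissible) (s : B) : ρ.α s ≠ 0 := by
  intro h
  rw [α, ← map_zero (SymmetricAlgebra.ι k V)] at h
  have h1 : ρ.root s = 0 := ι_injective h
  have h2 : cs.simple s = 1 := by
    apply hρ.faithful
    ext v
    rw [ρ.action_simple, h1, smul_zero, sub_zero, map_one]
    rfl
  have := cs.length_simple s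
  rw [h2, cs.length_one] at this
  exact zero_ne_one this

theorem IsAdmissible.demazure_eq_iff (hρ : ρ.IsAdmissible) {s : B} {f g : ρ.Poly} :
    ρ.demazure s f = g ↔ ρ.α s * g = f - ρ.act (cs.simple s) f := by
  rw [← ρ.α_mul_demazure]
  exact ⟨fun h => by rw [h], fun h => (mul_left_cancel₀ (hρ.α_ne_zero s) h).symm⟩

theorem IsAdmissible.demazure_mul (hρ : ρ.IsAdmissible) (s : B) (f g : ρ.Poly) : ρ.demazure s (f * g) =
    ρ.demazure s f * g + ρ.act (cs.simple s) f * ρ.demazure s g := by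
  rw [hρ.demazure_eq_iff, map_mul]
  linear_combination g * ρ.α_mul_demazure s f + ρ.act (cs.simple s) f * ρ.α_mul_demazure s g

theorem IsAdmissible.demazure_eq_zero (hρ : ρ.IsAdmissible) {s : B} {f : ρ.Poly} (h : ρ.act (cs.simple s) f = f) :
    ρ.demazure s f = 0 := by
  rw [hρ.demazure_eq_iff, h, sub_self, mul_zero]

theorem act_eq_of_demazure_eq_zero {s : B} {f : ρ.Poly} (h : ρ.demazure s f = 0) :
    ρ.act (cs.simple s) f = f := by
  have := ρ.α_mul_demazure s f
  rw [h, mul_zero] at this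
  exact (sub_eq_zero.1 this.symm).symm

theorem IsAdmissible.demazure_mul_of_inv (hρ : ρ.IsAdmissible) {s : B} {f : ρ.Poly} (h : ρ.act (cs.simple s) f = f)
    (g : ρ.Poly) : ρ.demazure s (f * g) = f * ρ.demazure s g := by
  rw [hρ.demazure_mul, hρ.demazure_eq_zero h, h, zero_mul, zero_add]

theorem act_α (s : B) : ρ.act (cs.simple s) (ρ.α s) = -ρ.α s := by
  rw [α, act_ι, ρ.action_simple, ρ.coroot_root, ← map_neg]
  congr 1
  module

theorem IsAdmissible.act_demazure (hρ : ρ.IsAdmissible) (s : B) (f : ρ.Poly) :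
    ρ.act (cs.simple s) (ρ.demazure s f) = ρ.demazure s f := by
  have h := congrArg (ρ.act (cs.simple s)) (ρ.α_mul_demazure s f)
  rw [map_mul, act_α, map_sub, act_simple_act_simple] at h
  symm
  rw [hρ.demazure_eq_iff]
  linear_combination -h

theorem IsAdmissible.demazure_demazure (hρ : ρ.IsAdmissible) (s : B) (f : ρ.Poly) :
    ρ.demazure s (ρ.demazure s f) = 0 :=
  hρ.demazure_eq_zero (hρ.act_demazure s f)

theorem IsAdmissible.demazure_ι (hρ : ρ.IsAdmissible) (s : B) (v : V) :
    ρ.demazure s (SymmetricAlgebra.ι k V v) = algebraMap k ρ.Poly (ρ.coroot s v) := by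
  rw [hρ.demazure_eq_iff, act_ι, ρ.action_simple, map_sub, map_smul, α, mul_comm,
    ← Algebra.smul_def]
  abel

theorem IsAdmissible.demazure_ι_mul (hρ : ρ.IsAdmissible) (s : B) (v : V) (g : ρ.Poly) :
    ρ.demazure s (SymmetricAlgebra.ι k V v * g) =
      SymmetricAlgebra.ι k V (ρ.action (cs.simple s) v) * ρ.demazure s g + ρ.coroot s v • g := by
  rw [hρ.demazure_mul, hρ.demazure_ι, act_ι, Algebra.smul_def, add_comm]

/-! ### Braid relations -/

variable (ρ) in
/-- The composition of the Demazure operators along a word. -/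
def demazureWord (ω : List B) : Module.End k ρ.Poly := (ω.map fun s => ρ.demazure s).prod

theorem demazureWord_nil (f : ρ.Poly) : ρ.demazureWord [] f = f := rfl

theorem demazureWord_cons (s : B) (ω : List B) (f : ρ.Poly) :
    ρ.demazureWord (s :: ω) f = ρ.demazure s (ρ.demazureWord ω f) := by
  rw [demazureWord, List.map_cons, List.prod_cons]
  rfl

theorem demazureWord_append (ω ω' : List B) (f : ρ.Poly) :
    ρ.demazureWord (ω ++ ω') f = ρ.demazureWord ω (ρ.demazureWord ω' f) := by
  rw [demazureWord, List.map_append, List.prod_append]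
  rfl

theorem demazureElt_eq (w : W) :
    ∃ ω, cs.IsReduced ω ∧ cs.wordProd ω = w ∧ ρ.demazureElt w = ρ.demazureWord ω := by
  refine ⟨_, (cs.exists_isReduced w).choose_spec.1, (cs.exists_isReduced w).choose_spec.2.symm, ?_⟩
  rw [demazureElt, demazureWord]
  generalize (cs.exists_isReduced w).choose = ω
  induction ω with
  | nil => rfl
  | cons s ω ih =>
    rw [List.foldr_cons, ih, List.map_cons, List.prod_cons]
    rfl

/-- The last letter of `alt s t (n + 1)`. -/
def altLast {B : Type*} (s t : B) (n : ℕ) : B := if Even n then s else t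

/-- The recursion mixes parities, so the symmetry of the odd quantum numbers is proved together with
`y [2n]_x = x [2n]_y`. -/
theorem qnum_odd_symm (x y : k) (n : ℕ) : qnum x y (2 * n + 1) = qnum y x (2 * n + 1) := by
  have key : ∀ n, qnum x y (2 * n + 1) = qnum y x (2 * n + 1) ∧
      y * qnum x y (2 * n) = x * qnum y x (2 * n) := by
    intro n
    induction n with
    | zero => simp [qnum]
    | succ n ih =>
      have e1 : ∀ a b : k, qnum a b (2 * (n + 1) + 1) =
          a * (b * qnum a b (2 * n + 1) - qnum b a (2 * n)) - qnum a b (2 * n + 1) :=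
        fun a b => rfl
      have e2 : ∀ a b : k, qnum a b (2 * (n + 1)) = a * qnum b a (2 * n + 1) - qnum a b (2 * n) :=
        fun a b => rfl
      rw [e1, e1, e2, e2]
      constructor
      · linear_combination (x * y - 1) * ih.1 + ih.2
      · linear_combination -x * y * ih.1 - ih.2
  exact (key n).1

/-- Pulling a coroot back along an alternating word obeys the recursion of the two-coloured quantum
numbers. This is the link between the braid relations and the conditions on `[m_st]` and `[m_st -
1]`. -/
theorem coroot_action_alt (s t : B) (n : ℕ) (v : V) :
    (ρ.coroot t (ρ.action (cs.wordProd (alt s t (2 * n))) v) =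
      qnum (-(ρ.coroot s (ρ.root t))) (-(ρ.coroot t (ρ.root s))) (2 * n + 1) * ρ.coroot t v +
      qnum (-(ρ.coroot t (ρ.root s))) (-(ρ.coroot s (ρ.root t))) (2 * n) * ρ.coroot s v) ∧
    (ρ.coroot t (ρ.action (cs.wordProd (alt s t (2 * n + 1))) v) =
      qnum (-(ρ.coroot s (ρ.root t))) (-(ρ.coroot t (ρ.root s))) (2 * n + 1) * ρ.coroot t v +
      qnum (-(ρ.coroot t (ρ.root s))) (-(ρ.coroot s (ρ.root t))) (2 * n + 2) * ρ.coroot s v) := by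
  have hs : ∀ (s t : B) (v : V), ρ.coroot t (ρ.action (cs.simple s) v) =
      ρ.coroot t v - ρ.coroot s v * ρ.coroot t (ρ.root s) := by
    intro s t v
    rw [ρ.action_simple, map_sub, map_smul, smul_eq_mul]
  have hneg : ∀ (t : B) (v : V), ρ.coroot t (ρ.action (cs.simple t) v) = -ρ.coroot t v := by
    intro t v
    rw [hs, ρ.coroot_root]
    ring
  have rec2 : ∀ (s t : B) (n : ℕ) (v : V),
      ρ.coroot t (ρ.action (cs.wordProd (alt s t (n + 2))) v) =
        -ρ.coroot t (ρ.action (cs.wordProd (alt s t n)) v) -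
          ρ.coroot t (ρ.root s) * ρ.coroot s (ρ.action (cs.wordProd (alt t s (n + 1))) v) := by
    intro s t n v
    rw [show alt s t (n + 2) = s :: alt t s (n + 1) from rfl, cs.wordProd_cons, map_mul,
      Module.End.mul_apply, hs]
    rw [show alt t s (n + 1) = t :: alt s t n from rfl, cs.wordProd_cons, map_mul,
      Module.End.mul_apply, hneg]
    ring
  induction n generalizing s t with
  | zero =>
    simp [alt, qnum, cs.wordProd_cons, hs]
    ring
  | succ n ih =>
    obtain ⟨h1, h2⟩ := ih s t
    obtain ⟨h3, h4⟩ := ih t s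
    set x := -(ρ.coroot s (ρ.root t))
    set y := -(ρ.coroot t (ρ.root s)) with hy
    have hy' : ρ.coroot t (ρ.root s) = -y := by rw [hy, neg_neg]
    have e1 : ∀ a b : k, qnum a b (2 * (n + 1) + 1) = a * qnum b a (2 * n + 2) - qnum a b (2 * n + 1) :=
      fun a b => rfl
    have e2 : ∀ a b : k, qnum a b (2 * (n + 1)) = a * qnum b a (2 * n + 1) - qnum a b (2 * n) :=
      fun a b => rfl
    have e3 : ∀ a b : k, qnum a b (2 * n + 2) = a * qnum b a (2 * n + 1) - qnum a b (2 * n) :=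
      fun a b => rfl
    have e4 : ∀ a b : k, qnum a b (2 * (n + 1) + 2) =
      a * qnum b a (2 * (n + 1) + 1) - qnum a b (2 * (n + 1)) := fun a b => rfl
    have o1 := qnum_odd_symm x y n
    have o2 := qnum_odd_symm x y (n + 1)
    have r1 := rec2 s t (2 * n) v
    have r2 := rec2 s t (2 * n + 1) v
    have r3 := rec2 t s (2 * n) v
    rw [show 2 * n + 1 + 1 = 2 * n + 2 from rfl] at r2
    rw [r3, h2, h3] at r2
    rw [h1, h4] at r1
    have hx' : ρ.coroot s (ρ.root t) = -x := by simp [x]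
    rw [hy'] at r1 r2
    rw [hx'] at r2
    refine ⟨r1.trans ?_, r2.trans ?_⟩
    · rw [o2, e1, e2]
      linear_combination (-ρ.coroot t v - y * ρ.coroot s v) * o1
    · have eA := e1 x y
      have eB := o2.trans (e1 y x)
      rw [e3] at eA eB
      rw [e4, e2, e3]
      linear_combination ((x * y - 1) * ρ.coroot t v + y * ρ.coroot s v) * o1 -
        ρ.coroot t v * eB - y * ρ.coroot s v * eA

/-- For words of length `m_st - 1` one coefficient is `[m_st] = 0` by the technical condition and
the other is `[m_st - 1] = 1` by balancedness; parity decides which is which. -/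
theorem IsAdmissible.coroot_action_altLast (hρ : ρ.IsAdmissible) {s t : B} (hst : s ≠ t) {n : ℕ}
    (hn : M s t = n + 1) (v : V) :
    ρ.coroot t (ρ.action (cs.wordProd (alt s t n)) v) = ρ.coroot (altLast s t n) v := by
  have hm : M s t ≠ 0 := by omega
  have hm' : M t s ≠ 0 := by rwa [M.symmetric]
  have t1 := ρ.technical s t hst hm
  have t2 := ρ.technical t s hst.symm hm'
  have b1 := hρ.balanced s t hst hm
  have b2 := hρ.balanced t s hst.symm hm'
  rw [M.symmetric t s] at t2 b2
  rw [hn] at t1 t2 b1 b2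
  rw [Nat.add_sub_cancel] at b1 b2
  rcases Nat.even_or_odd' n with ⟨j, rfl | rfl⟩
  · rw [(coroot_action_alt s t j v).1, t1, b2, altLast, if_pos (even_two_mul j)]
    ring
  · rw [(coroot_action_alt s t j v).2, b1, t2, altLast, if_neg (by simp)]
    ring

/-- Iterated Leibniz rule: a term in which an interior letter is dropped has two equal adjacent
letters and vanishes by `∂_s ∂_s = 0`. Only the terms missing the first or the last letter survive.
-/
theorem IsAdmissible.demazureWord_alt_ι_mul (hρ : ρ.IsAdmissible) (s t : B) (n : ℕ) (v : V)
    (g : ρ.Poly) : ρ.demazureWord (alt s t (n + 2)) (SymmetricAlgebra.ι k V v * g) =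
      SymmetricAlgebra.ι k V (ρ.action (cs.wordProd (alt s t (n + 2))) v) *
        ρ.demazureWord (alt s t (n + 2)) g +
      ρ.coroot s (ρ.action (cs.wordProd (alt t s (n + 1))) v) •
        ρ.demazureWord (alt t s (n + 1)) g +
      ρ.coroot (altLast s t (n + 1)) v • ρ.demazureWord (alt s t (n + 1)) g := by
  induction n generalizing s t with
  | zero =>
    simp only [alt, demazureWord_cons, demazureWord_nil, zero_add, hρ.demazure_ι_mul, map_add,
      cs.wordProd_cons, cs.wordProd_nil, mul_one, map_mul, Module.End.mul_apply, map_smul, altLast]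
    simp
  | succ n ih =>
    have e : alt s t (n + 1 + 2) = s :: alt t s (n + 2) := rfl
    have e1 : alt s t (n + 1) = s :: alt t s n := rfl
    have e2 : alt s t (n + 1 + 1) = s :: alt t s (n + 1) := rfl
    have hl : altLast t s (n + 1) = altLast s t (n + 1 + 1) := by
      simp only [altLast, Nat.even_add_one]
      by_cases h : Even n <;> simp [h]
    rw [e, demazureWord_cons, ih, map_add, map_add, hρ.demazure_ι_mul, map_smul, map_smul, e1,
      demazureWord_cons s (alt t s n), hρ.demazure_demazure, smul_zero, add_zero,
      cs.wordProd_cons, map_mul, Module.End.mul_apply, ← demazureWord_cons, hl, e2,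
      ← demazureWord_cons s (alt t s (n + 1))]

/-- Between the two words of length `m_st`, the first-letter term of one cancels the last-letter
term of the other. The difference `Δ` of the operators therefore satisfies `Δ(f g) = w(f) Δ(g)`, and
`Δ(1) = 0`. -/
theorem IsAdmissible.demazureWord_braid (hρ : ρ.IsAdmissible) {s t : B} (hst : s ≠ t)
    (hm : M s t ≠ 0) :
    ρ.demazureWord (alt s t (M s t)) = ρ.demazureWord (alt t s (M s t)) := by
  have hm1 := M.off_diagonal s t hst
  change M s t ≠ 1 at hm1
  obtain ⟨n, hn⟩ : ∃ n, M s t = n + 2 := ⟨M s t - 2, by omega⟩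
  have hw := wordProd_alt cs s t
  rw [hn] at hw ⊢
  have hv : ∀ v g, (ρ.demazureWord (alt s t (n + 2)) - ρ.demazureWord (alt t s (n + 2)))
      (SymmetricAlgebra.ι k V v * g) =
      SymmetricAlgebra.ι k V (ρ.action (cs.wordProd (alt s t (n + 2))) v) *
      (ρ.demazureWord (alt s t (n + 2)) - ρ.demazureWord (alt t s (n + 2))) g := by
    intro v g
    rw [LinearMap.sub_apply, LinearMap.sub_apply, hρ.demazureWord_alt_ι_mul,
      hρ.demazureWord_alt_ι_mul, ← hw, hρ.coroot_action_altLast hst hn,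
      hρ.coroot_action_altLast hst.symm (by rw [M.symmetric, hn])]
    ring
  have hf : ∀ f g, (ρ.demazureWord (alt s t (n + 2)) - ρ.demazureWord (alt t s (n + 2))) (f * g) =
      ρ.act (cs.wordProd (alt s t (n + 2))) f *
      (ρ.demazureWord (alt s t (n + 2)) - ρ.demazureWord (alt t s (n + 2))) g := by
    intro f
    induction f using SymmetricAlgebra.induction with
    | algebraMap r =>
      intro g
      rw [AlgHom.commutes, ← Algebra.smul_def, map_smul, Algebra.smul_def]
    | ι v =>
      intro g
      rw [hv, act_ι]
    | mul a b ha hb =>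
      intro g
      rw [mul_assoc, ha, hb, map_mul, mul_assoc]
    | add a b ha hb =>
      intro g
      rw [add_mul, map_add, ha, hb, map_add, add_mul]
  have h0 : ∀ (m : ℕ) (s t : B), ρ.demazureWord (alt s t (m + 1)) 1 = 0 := by
    intro m
    induction m with
    | zero =>
      intro s t
      rw [alt, demazureWord_cons]
      exact hρ.demazure_eq_zero (map_one _)
    | succ m ih =>
      intro s t
      rw [alt, demazureWord_cons, ih, map_zero]
  have h1 : ∀ s t : B, ρ.demazureWord (alt s t (n + 2)) 1 = 0 := h0 (n + 1)
  rw [← sub_eq_zero]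
  ext f
  have := hf f 1
  rw [mul_one, LinearMap.sub_apply _ _ 1, h1, h1, sub_zero, mul_zero] at this
  exact this

/-! ### Demazure operators of group elements -/

theorem IsAdmissible.demazureElt_wordProd (hρ : ρ.IsAdmissible) {ω : List B}
    (h : cs.IsReduced ω) : ρ.demazureElt (cs.wordProd ω) = ρ.demazureWord ω := by
  obtain ⟨ω', h', e, e'⟩ := ρ.demazureElt_eq (cs.wordProd ω)
  rw [e', demazureWord, demazureWord]
  exact prod_eq_of_isReduced (M := M) (X := Module.End k ρ.Poly) (fun s => ρ.demazure s)
    (fun s t hst hm => hρ.demazureWord_braid hst hm) h' h e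

theorem IsAdmissible.demazureElt_one (hρ : ρ.IsAdmissible) (f : ρ.Poly) :
    ρ.demazureElt 1 f = f := by
  have := hρ.demazureElt_wordProd (ω := []) (by simp [CoxeterSystem.IsReduced])
  rw [cs.wordProd_nil] at this
  rw [this, demazureWord_nil]

theorem IsAdmissible.demazureElt_mul (hρ : ρ.IsAdmissible) {x y : W}
    (h : cs.length (x * y) = cs.length x + cs.length y) (f : ρ.Poly) :
    ρ.demazureElt (x * y) f = ρ.demazureElt x (ρ.demazureElt y f) := by
  obtain ⟨ω, hω, rfl⟩ := cs.exists_isReduced x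
  obtain ⟨κ, hκ, rfl⟩ := cs.exists_isReduced y
  rw [← cs.wordProd_append, hω.eq, hκ.eq, ← List.length_append] at h
  rw [← cs.wordProd_append, hρ.demazureElt_wordProd h, hρ.demazureElt_wordProd hω,
    hρ.demazureElt_wordProd hκ, demazureWord_append]

theorem IsAdmissible.demazureElt_simple (hρ : ρ.IsAdmissible) (s : B) (f : ρ.Poly) :
    ρ.demazureElt (cs.simple s) f = ρ.demazure s f := by
  have := hρ.demazureElt_wordProd (ω := [s]) (by simp [CoxeterSystem.IsReduced])
  rw [cs.wordProd_singleton] at this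
  rw [this, demazureWord_cons, demazureWord_nil]

theorem IsAdmissible.demazureElt_simple_mul (hρ : ρ.IsAdmissible) {s : B} {w : W}
    (h : cs.length (cs.simple s * w) = cs.length w + 1) (f : ρ.Poly) :
    ρ.demazureElt (cs.simple s * w) f = ρ.demazure s (ρ.demazureElt w f) := by
  rw [hρ.demazureElt_mul (by rw [h, cs.length_simple, add_comm]), hρ.demazureElt_simple]

theorem IsAdmissible.demazureElt_of_leftDescent (hρ : ρ.IsAdmissible) {s : B} {w : W}
    (h : cs.length (cs.simple s * w) + 1 = cs.length w) (f : ρ.Poly) :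
    ρ.demazureElt w f = ρ.demazure s (ρ.demazureElt (cs.simple s * w) f) := by
  rw [← hρ.demazureElt_simple_mul (by rw [cs.simple_mul_simple_cancel_left, h]),
    cs.simple_mul_simple_cancel_left]

theorem IsAdmissible.demazureElt_of_rightDescent (hρ : ρ.IsAdmissible) {s : B} {w : W}
    (h : cs.length (w * cs.simple s) + 1 = cs.length w) (f : ρ.Poly) :
    ρ.demazureElt w f = ρ.demazureElt (w * cs.simple s) (ρ.demazure s f) := by
  rw [← hρ.demazureElt_simple, ← hρ.demazureElt_mul, cs.simple_mul_simple_cancel_right]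
  rw [cs.simple_mul_simple_cancel_right, cs.length_simple, h]

/-- Move the letters of a reduced word of `x` over to `y` one by one. As lengths do not add, at some
point the letter is already a left descent, and `∂_s ∂_s = 0` applies. -/
theorem IsAdmissible.demazureElt_demazureElt_eq_zero (hρ : ρ.IsAdmissible) {x y : W}
    (h : cs.length (x * y) ≠ cs.length x + cs.length y) (f : ρ.Poly) :
    ρ.demazureElt x (ρ.demazureElt y f) = 0 := by
  induction hn : cs.length x generalizing x y with
  | zero =>
    rw [cs.length_eq_zero_iff] at hn
    subst hn
    simp at h
  | succ n ih =>
    have hx : x ≠ 1 := by rintro rfl; simp at hn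
    obtain ⟨s, hs⟩ := cs.exists_rightDescent_of_ne_one hx
    rw [cs.isRightDescent_iff] at hs
    rw [hρ.demazureElt_of_rightDescent hs]
    rcases cs.length_simple_mul y s with h1 | h1
    · rw [← hρ.demazureElt_simple_mul h1]
      refine ih ?_ (by omega)
      rw [← mul_assoc, cs.simple_mul_simple_cancel_right]
      omega
    · rw [hρ.demazureElt_of_leftDescent h1, hρ.demazure_demazure, map_zero]

theorem demazureSet_congr {I J : Set B} (h : parabolic cs I = parabolic cs J) :
    ρ.demazureSet I = ρ.demazureSet J := by
  rw [demazureSet, longest_congr h]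

theorem IsAdmissible.demazureElt_mem_inv (hρ : ρ.IsAdmissible) {I : Set B} {w : W}
    (hw : LeftMax cs I w) (f : ρ.Poly) : ρ.demazureElt w f ∈ ρ.inv I := by
  intro i hi
  rw [hρ.demazureElt_of_leftDescent (hw i hi), hρ.act_demazure]

theorem IsAdmissible.demazureSet_mem_inv (hρ : ρ.IsAdmissible) {I : Set B} (hI : Finitary cs I)
    (f : ρ.Poly) : ρ.demazureSet I f ∈ ρ.inv I :=
  hρ.demazureElt_mem_inv (leftMax_longest hI) f

theorem IsAdmissible.demazureElt_mul_of_mem_inv (hρ : ρ.IsAdmissible) {I : Set B} {w : W}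
    (hw : w ∈ parabolic cs I) {f : ρ.Poly} (hf : f ∈ ρ.inv I) (g : ρ.Poly) :
    ρ.demazureElt w (f * g) = f * ρ.demazureElt w g := by
  obtain ⟨ω, h1, h2, rfl⟩ := exists_reduced_of_mem_parabolic cs hw
  rw [hρ.demazureElt_wordProd h2]
  clear hw h2
  induction ω with
  | nil => rfl
  | cons i ω ih =>
    rw [demazureWord_cons, demazureWord_cons, ih fun j hj => h1 j (by simp [hj]),
      hρ.demazure_mul_of_inv (hf i (h1 i (by simp)))]

theorem IsAdmissible.demazureElt_eq_zero_of_rightDescent (hρ : ρ.IsAdmissible) {I : Set B}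
    {i : B} (hi : i ∈ I) {w : W} (hw : cs.length (w * cs.simple i) + 1 = cs.length w)
    {f : ρ.Poly} (hf : f ∈ ρ.inv I) : ρ.demazureElt w f = 0 := by
  rw [hρ.demazureElt_of_rightDescent hw, hρ.demazure_eq_zero (hf i hi), map_zero]

/-- Demazure operators are adjoint to each other with respect to the trace form. -/
theorem IsAdmissible.demazureSet_adjoint (hρ : ρ.IsAdmissible) {I : Set B} (hI : Finitary cs I)
    {u : W} (hu : u ∈ parabolic cs I) (f g : ρ.Poly) :
    ρ.demazureSet I (ρ.demazureElt u f * g) = ρ.demazureSet I (f * ρ.demazureElt u⁻¹ g) := by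
  -- `∂_I` factors through `∂_i` on the right, and `∂_i(∂_i f · g) = ∂_i f · ∂_i g` is symmetric in
  -- `f` and `g`.
  have hs : ∀ i ∈ I, ∀ f g, ρ.demazureSet I (ρ.demazure i f * g) =
      ρ.demazureSet I (f * ρ.demazure i g) := by
    intro i hi f g
    rw [demazureSet, hρ.demazureElt_of_rightDescent (rightMax_longest hI i hi),
      hρ.demazureElt_of_rightDescent (rightMax_longest hI i hi),
      hρ.demazure_mul_of_inv (hρ.act_demazure i f), mul_comm f,
      hρ.demazure_mul_of_inv (hρ.act_demazure i g), mul_comm]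
  obtain ⟨ω, h1, h2, rfl⟩ := exists_reduced_of_mem_parabolic cs hu
  rw [← cs.wordProd_reverse, hρ.demazureElt_wordProd h2, hρ.demazureElt_wordProd h2.reverse]
  clear hu h2
  induction ω generalizing g with
  | nil => rfl
  | cons i ω ih =>
    rw [demazureWord_cons, hs i (h1 i (by simp)), ih _ fun j hj => h1 j (by simp [hj]),
      List.reverse_cons, demazureWord_append]
    rfl

end Realization

end SingularSoergel

namespace SingularSoergel

/-! ### Frobenius traces and dual bases -/

namespace Realization

variable {B W : Type*} [Group W] {M : CoxeterMatrix B} {cs : CoxeterSystem M W}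
  {k V : Type*} [Field k] [AddCommGroup V] [Module k V] {ρ : Realization cs k V}

/-! ### Frobenius traces -/

theorem IsAdmissible.exists_demazureSet_eq (hρ : ρ.IsAdmissible) {I : Set B} (hI : Finitary cs I)
    {f : ρ.Poly} (hf : f ∈ ρ.inv I) : ∃ g, ρ.demazureSet I g = f := by
  obtain ⟨P, hP⟩ := hρ.demazure_surjective I hI
  exact ⟨f * P, by
    rw [demazureSet, hρ.demazureElt_mul_of_mem_inv (longest_mem hI) hf]
    exact (congrArg (f * ·) hP).trans (mul_one f)⟩

theorem IsAdmissible.demazureElt_demazureSet (hρ : ρ.IsAdmissible) {K A : Set B} (h : K ⊆ A)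
    (hA : Finitary cs A) (g : ρ.Poly) :
    ρ.demazureElt (longest cs A * (longest cs K)⁻¹) (ρ.demazureSet K g) = ρ.demazureSet A g := by
  rw [demazureSet, ← hρ.demazureElt_mul, inv_mul_cancel_right]
  rw [inv_mul_cancel_right]
  exact length_longest_eq hA (longest_mem_of_subset h hA)

/-- By surjectivity `f = ∂_K g`, so the operator sends `f` to `∂_A g`, which is `W_A`-invariant.
Hence a map as in the definition of `trace` exists, and the default value `0` does not occur. -/
theorem IsAdmissible.trace_eq (hρ : ρ.IsAdmissible) {K A : Set B} (h : K ⊆ A)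
    (hA : Finitary cs A) (f : ρ.inv K) :
    (ρ.trace K A f : ρ.Poly) = ρ.demazureElt (longest cs A * (longest cs K)⁻¹) f := by
  have hmem : ∀ f : ρ.inv K,
      ρ.demazureElt (longest cs A * (longest cs K)⁻¹) f ∈ ρ.inv A := by
    intro f
    obtain ⟨g, hg⟩ := hρ.exists_demazureSet_eq (hA.mono h) f.2
    rw [← hg, hρ.demazureElt_demazureSet h hA]
    exact hρ.demazureSet_mem_inv hA g
  have hex : ∃ T : ρ.inv K →+ ρ.inv A,
      (∀ f, (T f : ρ.Poly) = ρ.demazureElt (longest cs A * (longest cs K)⁻¹) f) ∧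
      (∀ (x : ρ.inv A) (y f : ρ.inv K), (x : ρ.Poly) = y → T (y * f) = x * T f) := by
    refine ⟨AddMonoidHom.mk' (fun f => ⟨_, hmem f⟩) fun f g => Subtype.ext ?_, fun f => rfl, ?_⟩
    · exact map_add _ _ _
    · intro x y f hxy
      apply Subtype.ext
      change ρ.demazureElt _ ((y : ρ.Poly) * f) = x * ρ.demazureElt _ f
      rw [← hxy, hρ.demazureElt_mul_of_mem_inv (mul_mem (longest_mem hA)
        (inv_mem (longest_mem_of_subset h hA))) x.2]
  rw [trace, dif_pos hex]
  exact hex.choose_spec.1 f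

theorem IsAdmissible.trace_demazureSet (hρ : ρ.IsAdmissible) {K A : Set B} (h : K ⊆ A)
    (hA : Finitary cs A) {f : ρ.inv K} {g : ρ.Poly} (hf : (f : ρ.Poly) = ρ.demazureSet K g) :
    (ρ.trace K A f : ρ.Poly) = ρ.demazureSet A g := by
  rw [hρ.trace_eq h hA, hf, hρ.demazureElt_demazureSet h hA]

theorem IsAdmissible.trace_trace (hρ : ρ.IsAdmissible) {K A L : Set B} (h : K ⊆ A) (h' : A ⊆ L)
    (hL : Finitary cs L) (f : ρ.inv K) :
    ρ.trace A L (ρ.trace K A f) = ρ.trace K L f := by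
  obtain ⟨g, hg⟩ := hρ.exists_demazureSet_eq (hL.mono (h.trans h')) f.2
  apply Subtype.ext
  rw [hρ.trace_demazureSet h' hL (hρ.trace_demazureSet h (hL.mono h') hg.symm),
    hρ.trace_demazureSet (h.trans h') hL hg.symm]

/-- The unitriangularity of the pairing between Demazure operators. -/
theorem IsAdmissible.demazureElt_pairing (hρ : ρ.IsAdmissible) {A : Set B} (hA : Finitary cs A)
    {P : ρ.Poly} (hP : ρ.demazureSet A P = 1) {u v : W} (hu : u ∈ parabolic cs A)
    (hv : v ∈ parabolic cs A) (hl : cs.length v ≤ cs.length u) [Decidable (u = v)] :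
    ρ.demazureElt u (ρ.demazureElt (v⁻¹ * longest cs A) P) = if u = v then 1 else 0 := by
  have h1 := (leftMax_longest hA).length_eq hv
  split_ifs with huv
  · subst huv
    rw [← hρ.demazureElt_mul, mul_inv_cancel_left]
    · exact hP
    · rwa [mul_inv_cancel_left]
  -- If lengths added, `u v⁻¹ w_A` would be at least as long as `w_A`, hence equal to it, and `u =
  -- v`.
  · apply hρ.demazureElt_demazureElt_eq_zero
    intro h2
    apply huv
    have h3 := eq_longest_of_length hA (w := u * (v⁻¹ * longest cs A))
      (mul_mem hu (mul_mem (inv_mem hv) (longest_mem hA))) (by omega)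
    rw [← mul_assoc, mul_eq_right] at h3
    exact mul_inv_eq_one.1 h3

theorem IsAdmissible.trace_mul_eq (hρ : ρ.IsAdmissible) {K A : Set B} (h : K ⊆ A)
    (hA : Finitary cs A) {d f : ρ.inv K} {y : W} (hy : y ∈ parabolic cs A) {P : ρ.Poly}
    (hd : (d : ρ.Poly) = ρ.demazureSet K (ρ.demazureElt y⁻¹ P)) :
    (ρ.trace K A (d * f) : ρ.Poly) = ρ.demazureSet A (P * ρ.demazureElt y f) := by
  rw [hρ.trace_demazureSet h hA (g := f * ρ.demazureElt y⁻¹ P), mul_comm (f : ρ.Poly),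
    hρ.demazureSet_adjoint hA (inv_mem hy), inv_inv]
  rw [demazureSet, hρ.demazureElt_mul_of_mem_inv (longest_mem (hA.mono h)) f.2]
  exact (congrArg (· * (f : ρ.Poly)) hd).trans (mul_comm _ _)

/-- Descending induction on length shows `∂_y f = 0` for all `y` in `W_A`, in particular for `y =
1`. If `y` has a right descent in `K`, invariance of `f` suffices. Otherwise the vanishing for
longer elements makes `∂_y f` invariant under `W_A`, so that `∂_A(P · ∂_y f) = ∂_y f`. -/
theorem IsAdmissible.eq_zero_of_pairing (hρ : ρ.IsAdmissible) {K A : Set B}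
    (hA : Finitary cs A) {P : ρ.Poly} (hP : ρ.demazureSet A P = 1) {f : ρ.Poly}
    (hf : f ∈ ρ.inv K)
    (h0 : ∀ y ∈ parabolic cs A, RightMin cs K y → ρ.demazureSet A (P * ρ.demazureElt y f) = 0) :
    f = 0 := by
  have key : ∀ n, ∀ y ∈ parabolic cs A, cs.length (longest cs A) ≤ cs.length y + n →
      ρ.demazureElt y f = 0 := by
    intro n
    induction n using Nat.strong_induction_on with
    | _ n ih =>
      intro y hy hn
      by_cases hmin : RightMin cs K y
      · have hinv : ρ.demazureElt y f ∈ ρ.inv A := by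
          intro s hs
          apply act_eq_of_demazure_eq_zero
          rcases cs.length_simple_mul y s with h1 | h1
          · rw [← hρ.demazureElt_simple_mul h1]
            have hmem := mul_mem (simple_mem_parabolic cs hs) hy
            have := (longest_spec hA).2 _ hmem
            exact ih (n - 1) (by omega) _ hmem (by omega)
          · rw [hρ.demazureElt_of_leftDescent h1, hρ.demazure_demazure]
        have h1 := h0 y hy hmin
        rw [mul_comm, demazureSet, hρ.demazureElt_mul_of_mem_inv (longest_mem hA) hinv] at h1
        exact (mul_one _).symm.trans ((congrArg (_ * ·) hP.symm).trans h1)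
      · simp only [RightMin, not_forall] at hmin
        obtain ⟨i, hi, h1⟩ := hmin
        have := cs.length_mul_simple y i
        exact hρ.demazureElt_eq_zero_of_rightDescent hi (by omega) hf
  have := key (cs.length (longest cs A)) 1 (one_mem _) (by omega)
  rwa [hρ.demazureElt_one] at this

/-- Applying the inverse Gram matrix to `d` produces a family `c` dual to `a`. Both families span,
since the difference of `f` and its expansion pairs to zero with every `d` and vanishes by
nondegeneracy. -/
theorem exists_isDualBases_of_pairing {K A : Set B} (h : K ⊆ A) {ι : Type*} [Fintype ι]
    [DecidableEq ι] (d a : ι → ρ.inv K)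
    (hdet : (Matrix.of fun y y' => ρ.trace K A (d y * a y')).det = 1)
    (nondeg : ∀ f, (∀ y, ρ.trace K A (d y * f) = 0) → f = 0) :
    ∃ x : (n : ℕ) × (Fin n → ρ.inv K) × (Fin n → ρ.inv K),
      ρ.IsDualBases h x.1 x.2.1 x.2.2 := by
  set G : Matrix ι ι (ρ.inv A) := Matrix.of fun y y' => ρ.trace K A (d y * a y') with hG
  have tr : ∀ (x : ρ.inv A) (f : ρ.inv K),
      ρ.trace K A (ρ.incl h x * f) = x * ρ.trace K A f := fun x f => ρ.trace_mul K A x _ f rfl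
  have hu : IsUnit G.det := by rw [hdet]; exact isUnit_one
  let c : ι → ρ.inv K := fun y => ∑ z, ρ.incl h (G⁻¹ y z) * d z
  have hca : ∀ y y', ρ.trace K A (a y * c y') = if y = y' then 1 else 0 := by
    intro y y'
    rw [mul_comm, Finset.sum_mul, map_sum]
    simp only [mul_assoc, tr]
    have := congrFun (congrFun (Matrix.nonsing_inv_mul G hu) y') y
    rw [Matrix.mul_apply, Matrix.one_apply] at this
    exact this.trans (by simp only [eq_comm])
  have hdc : ∀ y, d y = ∑ z, ρ.incl h (G y z) * c z := by
    intro y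
    have h1 : ∀ z, ρ.incl h (G y z) * c z = ∑ x, ρ.incl h (G y z * G⁻¹ z x) * d x := by
      intro z
      rw [Finset.mul_sum]
      simp only [map_mul, mul_assoc]
    simp only [h1]
    rw [Finset.sum_comm]
    simp only [← Finset.sum_mul, ← map_sum]
    have h2 : ∀ x, ∑ z, G y z * G⁻¹ z x = if y = x then 1 else 0 := by
      intro x
      have := congrFun (congrFun (Matrix.mul_nonsing_inv G hu) y) x
      rwa [Matrix.mul_apply, Matrix.one_apply] at this
    simp only [h2]
    simp [apply_ite (ρ.incl h)]
  have spa : ∀ f, f = ∑ y, ρ.incl h (ρ.trace K A (f * c y)) * a y := by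
    intro f
    rw [← sub_eq_zero]
    have h1 : ∀ z, ρ.trace K A (c z * (f - ∑ y, ρ.incl h (ρ.trace K A (f * c y)) * a y)) = 0 := by
      intro z
      rw [mul_sub, map_sub, Finset.mul_sum, map_sum]
      have : ∀ y, ρ.trace K A (c z * (ρ.incl h (ρ.trace K A (f * c y)) * a y)) =
          ρ.trace K A (f * c y) * if y = z then 1 else 0 := by
        intro y
        rw [mul_left_comm, tr, mul_comm (c z), hca]
      simp only [this, mul_ite, mul_one, mul_zero, Finset.sum_ite_eq',
        Finset.mem_univ, if_true]
      rw [mul_comm, sub_self]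
    apply nondeg
    intro y
    rw [hdc, Finset.sum_mul, map_sum]
    simp only [mul_assoc, tr, h1, mul_zero, Finset.sum_const_zero]
  have spc : ∀ f, f = ∑ y, ρ.incl h (ρ.trace K A (f * a y)) * c y := by
    intro f
    rw [← sub_eq_zero]
    have h1 : ∀ z, ρ.trace K A (a z * (f - ∑ y, ρ.incl h (ρ.trace K A (f * a y)) * c y)) = 0 := by
      intro z
      rw [mul_sub, map_sub, Finset.mul_sum, map_sum]
      have : ∀ y, ρ.trace K A (a z * (ρ.incl h (ρ.trace K A (f * a y)) * c y)) =
          ρ.trace K A (f * a y) * if z = y then 1 else 0 := by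
        intro y
        rw [mul_left_comm, tr, hca]
      simp only [this, mul_ite, mul_one, mul_zero, Finset.sum_ite_eq,
        Finset.mem_univ, if_true]
      rw [mul_comm, sub_self]
    apply nondeg
    intro y
    rw [spa (d y), Finset.sum_mul, map_sum]
    simp only [mul_assoc, tr, h1, mul_zero, Finset.sum_const_zero]
  let e := (Fintype.equivFin ι).symm
  refine ⟨⟨Fintype.card ι, a ∘ e, c ∘ e⟩, fun i j => ?_, fun f => ?_, fun f => ?_⟩
  · simp only [Function.comp_apply, hca, e.injective.eq_iff]
  · exact ⟨fun i => ρ.trace K A (f * c (e i)), (spa f).trans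
      (e.sum_comp fun y => ρ.incl h (ρ.trace K A (f * c y)) * a y).symm⟩
  · exact ⟨fun i => ρ.trace K A (f * a (e i)), (spc f).trans
      (e.sum_comp fun y => ρ.incl h (ρ.trace K A (f * a y)) * c y).symm⟩

/-- For `y` minimal in `y W_K`, pairing with `∂_K ∂_{y⁻¹} P` is `f ↦ ∂_A(P · ∂_y f)` by adjointness.
The second family is chosen so that the entries of the Gram matrix involve `∂_{y w_K}` applied to
`∂_{(y' w_K)⁻¹ w_A} P`; by `IsAdmissible.demazureElt_pairing` the matrix is unitriangular with
respect to length. -/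
theorem IsAdmissible.exists_isDualBases (hρ : ρ.IsAdmissible) {K A : Set B} (h : K ⊆ A)
    (hA : Finitary cs A) : ∃ x : (n : ℕ) × (Fin n → ρ.inv K) × (Fin n → ρ.inv K),
      ρ.IsDualBases h x.1 x.2.1 x.2.2 := by
  classical
  obtain ⟨P, hP⟩ := hρ.demazure_surjective A hA
  have hK := hA.mono h
  have hfin : Finite (parabolic cs A) := hA
  let Y := {y : parabolic cs A // RightMin cs K y.1}
  have : Fintype Y := Fintype.ofFinite Y
  let d : Y → ρ.inv K := fun y => ⟨_, hρ.demazureSet_mem_inv hK (ρ.demazureElt (y.1.1)⁻¹ P)⟩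
  let a : Y → ρ.inv K := fun y => ⟨_, hρ.demazureSet_mem_inv hK
    (ρ.demazureElt ((longest cs K)⁻¹ * (y.1.1)⁻¹ * longest cs A) P)⟩
  have trd : ∀ y f, (ρ.trace K A (d y * f) : ρ.Poly) = ρ.demazureSet A (P * ρ.demazureElt y.1.1 f) :=
    fun y f => hρ.trace_mul_eq h hA y.1.2 rfl
  have nondeg : ∀ f, (∀ y, ρ.trace K A (d y * f) = 0) → f = 0 := by
    intro f hf
    refine Subtype.ext (hρ.eq_zero_of_pairing hA hP f.2 fun y hy hmin => ?_)
    rw [← trd ⟨⟨y, hy⟩, hmin⟩, hf]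
    rfl
  let G : Matrix Y Y (ρ.inv A) := Matrix.of fun y y' => ρ.trace K A (d y * a y')
  have hG : ∀ y y' : Y, cs.length y'.1.1 ≤ cs.length y.1.1 → G y y' = if y = y' then 1 else 0 := by
    intro y y' hl
    apply Subtype.ext
    have hm : ∀ y : Y, y.1.1 * longest cs K ∈ parabolic cs A := fun y =>
      mul_mem y.1.2 (longest_mem_of_subset h hA)
    have hlen : ∀ y : Y, cs.length (y.1.1 * longest cs K) =
        cs.length y.1.1 + cs.length (longest cs K) := fun y => y.2.length_mul (longest_mem hK)
    change (ρ.trace K A (d y * a y') : ρ.Poly) = _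
    rw [trd]
    change ρ.demazureSet A (P * ρ.demazureElt _ (ρ.demazureElt (longest cs K) _)) = _
    rw [← hρ.demazureElt_mul (hlen y), ← mul_inv_rev,
      hρ.demazureElt_pairing hA hP (hm y) (hm y') (by rw [hlen, hlen]; omega)]
    by_cases hy : y = y'
    · subst hy
      rw [if_pos rfl, if_pos rfl, mul_one, hP]
      rfl
    · have hy' : y.1.1 * longest cs K ≠ y'.1.1 * longest cs K := fun e =>
        hy (Subtype.ext (Subtype.ext (mul_right_cancel e)))
      rw [if_neg hy, if_neg hy', mul_zero, map_zero]
      rfl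
  have hdet : G.det = 1 := by
    let e := Fintype.equivFin Y
    -- Ties in length are broken by an arbitrary enumeration.
    let φ : Y → ℕ ×ₗ Fin (Fintype.card Y) := fun y => toLex (cs.length y.1.1, e y)
    have hφ : Function.Injective φ := by
      intro y y' hy
      have := congrArg (fun x => (ofLex x).2) hy
      exact e.injective this
    let _ : LinearOrder Y := LinearOrder.lift' φ hφ
    have ht : G.BlockTriangular id := by
      intro y y' hlt
      have hlt' : φ y' < φ y := hlt
      have hl : cs.length y'.1.1 ≤ cs.length y.1.1 := by
        rcases Prod.Lex.lt_iff.1 hlt' with h | h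
        · exact h.le
        · exact h.1.le
      rw [hG y y' hl, if_neg]
      rintro rfl
      exact lt_irrefl _ hlt
    have h1 := Matrix.det_of_isUpperTriangular ht
    rw [Finset.prod_congr rfl fun y _ => (hG y y le_rfl).trans (if_pos rfl),
      Finset.prod_const_one] at h1
    convert h1
  exact exists_isDualBases_of_pairing h d a hdet nondeg

theorem IsAdmissible.sum_trace_mul (hρ : ρ.IsAdmissible) {K A : Set B} (h : K ⊆ A)
    (hA : Finitary cs A) (f : ρ.inv K) :
    ∑ i, ρ.incl h (ρ.trace K A (f * (ρ.dualBases h).2.2 i)) * (ρ.dualBases h).2.1 i = f := by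
  have hD : ρ.IsDualBases h (ρ.dualBases h).1 (ρ.dualBases h).2.1 (ρ.dualBases h).2.2 := by
    have e : ρ.dualBases h = (hρ.exists_isDualBases h hA).choose :=
      dif_pos (hρ.exists_isDualBases h hA)
    rw [e]
    exact (hρ.exists_isDualBases h hA).choose_spec
  obtain ⟨h1, h2, -⟩ := hD
  obtain ⟨a, ha⟩ := h2 f
  have : ∀ j, ρ.trace K A (f * (ρ.dualBases h).2.2 j) = a j := by
    intro j
    rw [ha, Finset.sum_mul, map_sum]
    simp only [mul_assoc, ρ.trace_mul K A _ (ρ.incl h _) _ rfl, h1]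
    simp
  simp only [this]
  exact ha.symm

end Realization

end SingularSoergel

namespace SingularSoergel

/-! ### The generating bimodule maps on pure tensors, and their naturality -/

namespace Realization

universe uB uW uk uV

variable {B : Type uB} {W : Type uW} [Group W] {M : CoxeterMatrix B} {cs : CoxeterSystem M W}
  {k : Type uk} {V : Type uV} [Field k] [AddCommGroup V] [Module k V] {ρ : Realization cs k V}

/-! ### Formulas on pure tensors -/

theorem toInv_of_mem {I : Set B} {f : ρ.Poly} (h : f ∈ ρ.inv I) : ρ.toInv I f = ⟨f, h⟩ :=
  dif_pos h

theorem coe_toInv {I : Set B} {f : ρ.Poly} (h : f ∈ ρ.inv I) : (ρ.toInv I f : ρ.Poly) = f := by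
  rw [toInv_of_mem h]

theorem toInv_coe {I : Set B} (f : ρ.inv I) : ρ.toInv I (f : ρ.Poly) = f :=
  toInv_of_mem f.2

theorem toInv_one (I : Set B) : ρ.toInv I 1 = 1 := toInv_of_mem (one_mem _)

section Tensors

variable {I J : Set B} {Q : Type*} [AddCommGroup Q] [Module (ρ.inv J) Q]

theorem tmap_tm {Q' : Type*} [AddCommGroup Q'] [Module (ρ.inv J) Q'] (φ : Q →ₗ[ρ.inv J] Q')
    (a : ρ.inv I) (m : Q) : ρ.tmap I φ (ρ.tm J a m) = ρ.tm J a (φ m) :=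
  (ρ.smul_tm a 1 (φ m)).trans (by rw [mul_one])

theorem tm_zero (a : ρ.inv I) : ρ.tm J a (0 : Q) = 0 := (ρ.tmHom J a).map_zero

theorem tm_sum {ι : Type*} (s : Finset ι) (a : ρ.inv I) (m : ι → Q) :
    ρ.tm J a (∑ i ∈ s, m i) = ∑ i ∈ s, ρ.tm J a (m i) := map_sum (ρ.tmHom J a) m s

/-- Induction on threefold tensors. -/
theorem tens_induction₂ {K : Set B} {N : Type*} [AddCommGroup N] [Module (ρ.inv K) N]
    {p : ρ.Tens I J (ρ.Tens J K N) → Prop} (t : ρ.Tens I J (ρ.Tens J K N)) (h0 : p 0)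
    (h1 : ∀ a g m, p (ρ.tm J a (ρ.tm K g m))) (h2 : ∀ s t, p s → p t → p (s + t)) : p t := by
  induction t using ρ.tens_induction with
  | h0 => exact h0
  | h1 a u =>
    induction u using ρ.tens_induction with
    | h0 => rwa [tm_zero]
    | h1 g m => exact h1 a g m
    | h2 s t hs ht =>
      rw [tm_add]
      exact h2 _ _ hs ht
  | h2 s t hs ht => exact h2 _ _ hs ht

end Tensors

section Generators

variable {N : Type*} [AddCommGroup N]

theorem capTr_tm {K A : Set B} [Module (ρ.inv A) N] (a : ρ.inv A) (g : ρ.inv K) (m : N) :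
    ρ.capTr K A (ρ.tm K a (ρ.tm A g m)) = a • ρ.trace K A g • m := rfl

theorem capMul_tm {K A : Set B} (h : K ⊆ A) [Module (ρ.inv K) N] (a : ρ.inv K) (g : ρ.inv A)
    (m : N) : ρ.capMul h (ρ.tm A a (ρ.tm K g m)) = a • ρ.incl h g • m := rfl

theorem crossLeft_tm {P Q T Q' : Set B} (h : P ⊆ Q) (h' : Q' ⊆ T) [Module (ρ.inv T) N]
    (a : ρ.inv P) (g : ρ.inv Q) (m : N) :
    ρ.crossLeft h h' (ρ.tm Q a (ρ.tm T g m)) = ρ.tm Q' (a * ρ.incl h g) (ρ.tm T 1 m) :=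
  ρ.smul_tm a (ρ.incl h g) (ρ.tm T 1 m)

theorem crossRight_tm {P Q T Q' : Set B} (h : T ⊆ Q) (h' : Q' ⊆ P) [Module (ρ.inv T) N]
    (a : ρ.inv P) (g : ρ.inv Q) (m : N) :
    ρ.crossRight h h' (ρ.tm Q a (ρ.tm T g m)) = ρ.tm Q' a (ρ.tm T 1 (ρ.incl h g • m)) :=
  (ρ.smul_tm a 1 (ρ.tm T 1 (ρ.incl h g • m))).trans (by rw [mul_one])

theorem leftCrossing_tm {K A C L : Set B} (h : IsSquare cs K A C L) [Module (ρ.inv C) N]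
    (a : ρ.inv A) (g : ρ.inv K) (m : N) :
    ρ.leftCrossing h (ρ.tm K a (ρ.tm C g m)) = ∑ i, ρ.tm L ((ρ.dualBases h.sub₂).2.1 i)
      (ρ.tm C 1 (ρ.trace K C (ρ.incl h.sub₁ ((ρ.dualBases h.sub₂).2.2 i * a) * g) • m)) := by
  change ρ.tmap A (ρ.tmap L (ρ.capTr K C)) (ρ.tmap A (ρ.crossRight h.sub₁ h.swap.sub₂)
    (∑ i, ρ.tm L ((ρ.dualBases h.sub₂).2.1 i)
      (ρ.tm A 1 ((ρ.dualBases h.sub₂).2.2 i • ρ.tm K a (ρ.tm C g m))))) = _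
  rw [map_sum, map_sum]
  refine Finset.sum_congr rfl fun i _ => ?_
  rw [tmap_tm, tmap_tm, smul_tm, crossRight_tm, tmap_tm, smul_tm, capTr_tm, one_smul]

variable {N' : Type*} [AddCommGroup N']

/-- Like the other generators below, the cap touches only the leftmost factors and is linear in the
rest. This naturality is what permits identity strands on the right. -/
theorem capTr_natural {K A : Set B} [Module (ρ.inv A) N] [Module (ρ.inv A) N']
    (φ : N →ₗ[ρ.inv A] N') (t : ρ.Tens A K (ρ.Tens K A N)) :
    ρ.capTr K A (ρ.tmap A (ρ.tmap K φ) t) = φ (ρ.capTr K A t) := by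
  induction t using tens_induction₂ with
  | h0 => simp only [map_zero]
  | h1 a g m => simp only [tmap_tm, capTr_tm, map_smul]
  | h2 s t hs ht => simp only [map_add, hs, ht]

theorem cupIota_natural {K A : Set B} (h : K ⊆ A) [Module (ρ.inv A) N] [Module (ρ.inv A) N']
    (φ : N →ₗ[ρ.inv A] N') (m : N) :
    ρ.cupIota h (φ m) = ρ.tmap A (ρ.tmap K φ) (ρ.cupIota h m) := by
  change ρ.tm K 1 (ρ.tm A 1 (φ m)) = ρ.tmap A (ρ.tmap K φ) (ρ.tm K 1 (ρ.tm A 1 m))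
  rw [tmap_tm, tmap_tm]

theorem capMul_natural {K A : Set B} (h : K ⊆ A) [Module (ρ.inv K) N] [Module (ρ.inv K) N']
    (φ : N →ₗ[ρ.inv K] N') (t : ρ.Tens K A (ρ.Tens A K N)) :
    ρ.capMul h (ρ.tmap K (ρ.tmap A φ) t) = φ (ρ.capMul h t) := by
  induction t using tens_induction₂ with
  | h0 => simp only [map_zero]
  | h1 a g m => simp only [tmap_tm, capMul_tm, map_smul]
  | h2 s t hs ht => simp only [map_add, hs, ht]

theorem cupDelta_natural {K A : Set B} (h : K ⊆ A) [Module (ρ.inv K) N] [Module (ρ.inv K) N']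
    (φ : N →ₗ[ρ.inv K] N') (m : N) :
    ρ.cupDelta h (φ m) = ρ.tmap K (ρ.tmap A φ) (ρ.cupDelta h m) := by
  change ∑ i, ρ.tm A ((ρ.dualBases h).2.1 i) (ρ.tm K 1 ((ρ.dualBases h).2.2 i • φ m)) =
    ρ.tmap K (ρ.tmap A φ)
      (∑ i, ρ.tm A ((ρ.dualBases h).2.1 i) (ρ.tm K 1 ((ρ.dualBases h).2.2 i • m)))
  rw [map_sum]
  simp only [tmap_tm, map_smul]

theorem crossLeft_natural {P Q T Q' : Set B} (h : P ⊆ Q) (h' : Q' ⊆ T) [Module (ρ.inv T) N]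
    [Module (ρ.inv T) N'] (φ : N →ₗ[ρ.inv T] N') (t : ρ.Tens P Q (ρ.Tens Q T N)) :
    ρ.crossLeft h h' (ρ.tmap P (ρ.tmap Q φ) t) =
      ρ.tmap P (ρ.tmap Q' φ) (ρ.crossLeft h h' t) := by
  induction t using tens_induction₂ with
  | h0 => simp only [map_zero]
  | h1 a g m => simp only [tmap_tm, crossLeft_tm]
  | h2 s t hs ht => simp only [map_add, hs, ht]

theorem crossRight_natural {P Q T Q' : Set B} (h : T ⊆ Q) (h' : Q' ⊆ P) [Module (ρ.inv T) N]
    [Module (ρ.inv T) N'] (φ : N →ₗ[ρ.inv T] N') (t : ρ.Tens P Q (ρ.Tens Q T N)) :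
    ρ.crossRight h h' (ρ.tmap P (ρ.tmap Q φ) t) =
      ρ.tmap P (ρ.tmap Q' φ) (ρ.crossRight h h' t) := by
  induction t using tens_induction₂ with
  | h0 => simp only [map_zero]
  | h1 a g m => simp only [tmap_tm, crossRight_tm, map_smul]
  | h2 s t hs ht => simp only [map_add, hs, ht]

theorem leftCrossing_natural {K A C L : Set B} (h : IsSquare cs K A C L) [Module (ρ.inv C) N]
    [Module (ρ.inv C) N'] (φ : N →ₗ[ρ.inv C] N') (t : ρ.Tens A K (ρ.Tens K C N)) :
    ρ.leftCrossing h (ρ.tmap A (ρ.tmap K φ) t) =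
      ρ.tmap A (ρ.tmap L φ) (ρ.leftCrossing h t) := by
  induction t using tens_induction₂ with
  | h0 => simp only [map_zero]
  | h1 a g m => simp only [tmap_tm, leftCrossing_tm, map_smul, map_sum]
  | h2 s t hs ht => simp only [map_add, hs, ht]

end Generators

end Realization

end SingularSoergel

namespace SingularSoergel

/-! ### Juxtaposition of tensors and of diagrams -/

namespace Realization

universe uB uW uk uV

variable {B : Type uB} {W : Type uW} [Group W] {M : CoxeterMatrix B} {cs : CoxeterSystem M W}
  {k : Type uk} {V : Type uV} [Field k] [AddCommGroup V] [Module k V] {ρ : Realization cs k V}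

theorem oneTensor_nil (I : Set B) : ρ.oneTensor I [] = (1 : ρ.inv I) := toInv_one I

theorem oneTensor_cons (I J : Set B) (w : List (Set B)) :
    ρ.oneTensor I (J :: w) = ρ.tm J (1 : ρ.inv I) (ρ.oneTensor J w) := by
  change ρ.tm J (ρ.toInv I 1) (ρ.oneTensor J w) = _
  rw [toInv_one]

/-! ### Placing tensors next to each other -/

/-- Append a tensor on the right, which is given for every possible last region. -/
def appendMap {v : List (Set B)} (y : ∀ J, ρ.BS J v) :
    (I : Set B) → (w : List (Set B)) → (ρ.BS I w →ₗ[ρ.inv I] ρ.BS I (w ++ v))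
  | I, [] => LinearMap.toSpanSingleton (ρ.inv I) (ρ.BS I v) (y I)
  | I, J :: w => ρ.tmap I (appendMap y J w)

theorem appendMap_nil {v : List (Set B)} (y : ∀ J, ρ.BS J v) (I : Set B) (a : ρ.inv I) :
    appendMap (ρ := ρ) y I [] a = a • y I := rfl

theorem appendMap_cons {v : List (Set B)} (y : ∀ J, ρ.BS J v) (I J : Set B) (w : List (Set B))
    (a : ρ.inv I) (m : ρ.BS J w) :
    appendMap (ρ := ρ) y I (J :: w) (ρ.tm J a m) =
      (ρ.tm J a (appendMap y J w m) : ρ.Tens I J (ρ.BS J (w ++ v))) := tmap_tm _ a m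

theorem appendMap_oneTensor (v : List (Set B)) (I : Set B) (w : List (Set B)) :
    appendMap (fun J => ρ.oneTensor J v) I w (ρ.oneTensor I w) = ρ.oneTensor I (w ++ v) := by
  induction w generalizing I with
  | nil =>
    rw [oneTensor_nil]
    exact (appendMap_nil (fun J => ρ.oneTensor J v) I 1).trans
      (one_smul (ρ.inv I) (ρ.oneTensor I v))
  | cons J w ih =>
    rw [oneTensor_cons]
    refine (appendMap_cons _ I J w 1 _).trans ?_
    rw [ih]
    exact (oneTensor_cons I J (w ++ v)).symm

/-- The two pieces share a region. Its factor is assigned to the right-hand piece, so the left-hand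
piece has to end in `1`. -/
theorem pureTensor_append (v : List (Set B)) (I : Set B) (w : List (Set B)) (g g' : ℕ → ρ.Poly)
    (h : ∀ n < w.length, g' n = g n) (h' : g' w.length = 1) :
    ρ.pureTensor I (w ++ v) g =
      appendMap (fun J => ρ.pureTensor J v fun n => g (n + w.length)) I w
        (ρ.pureTensor I w g') := by
  induction w generalizing I g g' with
  | nil =>
    have e : ρ.pureTensor I [] g' = (1 : ρ.inv I) :=
      (congrArg (ρ.toInv I) h').trans (toInv_one I)
    rw [e]
    exact ((appendMap_nil (fun J => ρ.pureTensor J v fun n => g (n + 0)) I 1).trans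
      (one_smul (ρ.inv I) (ρ.pureTensor I v g))).symm
  | cons J w ih =>
    refine Eq.trans ?_ (appendMap_cons (fun J => ρ.pureTensor J v fun n => g (n + (w.length + 1)))
      I J w (ρ.toInv I (g' 0)) (ρ.pureTensor J w fun n => g' (n + 1))).symm
    rw [h 0 (by simp)]
    exact congrArg (ρ.tm J (ρ.toInv I (g 0))) (ih J (fun n => g (n + 1)) (fun n => g' (n + 1))
      (fun n hn => h (n + 1) (by simpa using hn)) h')

/-- Naturality of the generators, strand by strand. Supplying `y` for every possible last region
avoids transport between the last regions of `w` and `w'`. -/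
theorem eval_right {v : List (Set B)} (y : ∀ J, ρ.BS J v) {I : Set B} {w w' : List (Set B)}
    (D : Diag ρ I w w') (x : ρ.BS I w) :
    (D.right v).eval (appendMap y I w x) = appendMap y I w' (D.eval x) := by
  induction D with
  | ofEq h => subst h; rfl
  | comp D D' ih ih' =>
    change (D'.right v).eval ((D.right v).eval _) = _
    rw [ih, ih']
    rfl
  | @whisk I J w w' D ih =>
    induction x using ρ.tens_induction with
    | h0 => exact (congrArg _ (map_zero _)).trans ((map_zero _).trans
        ((congrArg _ (map_zero _)).trans (map_zero _)).symm)
    | h1 a m =>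
      change ρ.tmap I (D.right v).eval (ρ.tmap I (appendMap y J w) (ρ.tm J a m)) =
        ρ.tmap I (appendMap y J w') (ρ.tmap I D.eval (ρ.tm J a m))
      rw [tmap_tm, tmap_tm, tmap_tm, tmap_tm, ih]
    | h2 s t hs ht =>
      refine (congrArg _ (map_add _ s t)).trans ((map_add _ _ _).trans
        ((congrArg₂ (· + ·) hs ht).trans ?_))
      exact ((congrArg _ (map_add _ s t)).trans (map_add _ _ _)).symm
  | ccwCap h w => exact capTr_natural _ x
  | ccwCup h w => exact cupIota_natural h.sub _ x
  | cwCap h w => exact capMul_natural h.sub _ x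
  | cwCup h w => exact cupDelta_natural h.sub _ x
  | upCross h w => exact crossLeft_natural _ _ _ x
  | downCross h w => exact crossRight_natural _ _ _ x
  | rightCross h w => exact crossLeft_natural _ _ _ x
  | leftCross h w => exact leftCrossing_natural h _ x
  | poly I f w => exact (map_smul (appendMap y I w) (ρ.toInv I f) x).symm

/-- The map `m ↦ 1 ⊗ ⋯ ⊗ 1 ⊗ m`. -/
def leftMap {w : List (Set B)} :
    (I : Set B) → (z : List (Set B)) → (ρ.BS (lastRegion I z) w →+ ρ.BS I (z ++ w))
  | _, [] => AddMonoidHom.id _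
  | _, J :: z => (ρ.tmHom J 1).comp (leftMap J z)

theorem leftMap_oneTensor (w : List (Set B)) (I : Set B) (z : List (Set B)) :
    leftMap I z (ρ.oneTensor (lastRegion I z) w) = ρ.oneTensor I (z ++ w) := by
  induction z generalizing I with
  | nil => rfl
  | cons J z ih =>
    exact (congrArg (ρ.tm J (1 : ρ.inv I)) (ih J)).trans (oneTensor_cons I J (z ++ w)).symm

theorem eval_left (I : Set B) (z : List (Set B)) {w w' : List (Set B)}
    (D : Diag ρ (lastRegion I z) w w') (m : ρ.BS (lastRegion I z) w) :
    (Diag.left I z D).eval (leftMap I z m) = leftMap I z (D.eval m) := by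
  induction z generalizing I with
  | nil => rfl
  | cons J z ih =>
    exact (tmap_tm (Diag.left J z D).eval (1 : ρ.inv I) (leftMap J z m)).trans
      (congrArg (ρ.tm J (1 : ρ.inv I)) (ih J D m))

theorem eval_ofEq_cons {I J : Set B} {w w' : List (Set B)} (h : w = w') (h' : J :: w = J :: w')
    (a : ρ.inv I) (m : ρ.BS J w) :
    (Diag.ofEq (ρ := ρ) (I := I) h').eval (ρ.tm J a m : ρ.Tens I J (ρ.BS J w)) =
      (ρ.tm J a ((Diag.ofEq (ρ := ρ) (I := J) h).eval m) : ρ.Tens I J (ρ.BS J w')) := by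
  subst h
  rfl

theorem appendMap_leftMap {v : List (Set B)} (y : ∀ J, ρ.BS J v) (I : Set B)
    (z : List (Set B)) {w u : List (Set B)} (h : w ++ v = u) (h' : (z ++ w) ++ v = z ++ u)
    (m : ρ.BS (lastRegion I z) w) :
    (Diag.ofEq (ρ := ρ) h').eval (appendMap y I (z ++ w) (leftMap I z m)) =
      leftMap I z ((Diag.ofEq (ρ := ρ) h).eval (appendMap y (lastRegion I z) w m)) := by
  induction z generalizing I with
  | nil => rfl
  | cons J z ih =>
    have h'' : (z ++ w) ++ v = z ++ u := List.cons_injective h'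
    refine (congrArg _ (appendMap_cons y I J (z ++ w) (1 : ρ.inv I) (leftMap J z m))).trans ?_
    exact (eval_ofEq_cons h'' h' _ _).trans (congrArg (ρ.tm J (1 : ρ.inv I)) (ih J h'' m))

theorem eval_ofEq_oneTensor {I : Set B} {w w' : List (Set B)} (h : w = w') :
    (Diag.ofEq (ρ := ρ) (I := I) h).eval (ρ.oneTensor I w) = ρ.oneTensor I w' := by
  subst h
  rfl

theorem eval_right_oneTensor {I : Set B} {w w' : List (Set B)} {D : Diag ρ I w w'}
    (h : D.eval (ρ.oneTensor I w) = ρ.oneTensor I w') (v : List (Set B)) :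
    (D.right v).eval (ρ.oneTensor I (w ++ v)) = ρ.oneTensor I (w' ++ v) := by
  rw [← appendMap_oneTensor, eval_right, h, appendMap_oneTensor]

theorem eval_left_oneTensor (I : Set B) (z : List (Set B)) {w w' : List (Set B)}
    {D : Diag ρ (lastRegion I z) w w'}
    (h : D.eval (ρ.oneTensor (lastRegion I z) w) = ρ.oneTensor (lastRegion I z) w') :
    (Diag.left I z D).eval (ρ.oneTensor I (z ++ w)) = ρ.oneTensor I (z ++ w') := by
  rw [← leftMap_oneTensor, eval_left, h, leftMap_oneTensor]

theorem eval_whisk_oneTensor (I : Set B) {J : Set B} {w w' : List (Set B)} {D : Diag ρ J w w'}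
    (h : D.eval (ρ.oneTensor J w) = ρ.oneTensor J w') :
    (Diag.whisk I D).eval (ρ.oneTensor I (J :: w)) = ρ.oneTensor I (J :: w') := by
  rw [oneTensor_cons, oneTensor_cons, ← h]
  exact tmap_tm _ _ _

/-- The dual of a sinister diagram consists of counterclockwise cups and right-facing crossings,
that is, of inclusions and multiplications of rings, which are unital. -/
theorem eval_dual_oneTensor {I : Set B} {w w' : List (Set B)} (D : Diag ρ I w w')
    (hD : D.IsSinister) : D.dual.eval (ρ.oneTensor I w') = ρ.oneTensor I w := by
  induction D with
  | ofEq h => exact eval_ofEq_oneTensor h.symm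
  | comp D D' ih ih' =>
    change D.dual.eval (D'.dual.eval _) = _
    rw [ih' hD.2, ih hD.1]
  | whisk I D ih => exact eval_whisk_oneTensor I (ih hD)
  | @ccwCap K A h w =>
    rw [oneTensor_cons, oneTensor_cons]
    rfl
  | leftCross h w =>
    rw [oneTensor_cons, oneTensor_cons, oneTensor_cons, oneTensor_cons]
    refine (crossLeft_tm _ _ _ _ _).trans ?_
    rw [map_one, mul_one]
    rfl
  | ccwCup | cwCap | cwCup | upCross | downCross | rightCross | poly => exact hD.elim

end Realization

end SingularSoergel

namespace SingularSoergel

/-! ### The action of Bott–Samelson bimodules on polynomials -/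

section Edges

variable {B W : Type*} [Group W] {M : CoxeterMatrix B} {cs : CoxeterSystem M W}

theorem not_subset_of_isEdge {K A : Set B} (h : IsEdge cs K A) : ¬ A ⊆ K := by
  obtain ⟨-, s, hs, rfl⟩ := h
  exact fun h => hs (h (Set.mem_insert s K))

theorem IsSquare.isEdge₁ {K A C L : Set B} (h : IsSquare cs K A C L) : IsEdge cs K A :=
  ⟨h.1.mono h.sub₂, h.2.choose, h.2.choose_spec.choose_spec.1,
    h.2.choose_spec.choose_spec.2.2.2.1⟩

theorem IsSquare.isEdge₂ {K A C L : Set B} (h : IsSquare cs K A C L) : IsEdge cs A L := by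
  obtain ⟨hL, s, t, -, ht, hne, rfl, -, rfl⟩ := h
  exact ⟨hL, t, by simp [ht, hne.symm], Set.insert_comm s t K⟩

end Edges

namespace Realization

universe uB uW uk uV

variable {B : Type uB} {W : Type uW} [Group W] {M : CoxeterMatrix B} {cs : CoxeterSystem M W}
  {k : Type uk} {V : Type uV} [Field k] [AddCommGroup V] [Module k V] {ρ : Realization cs k V}

/-! ### Bott–Samelson bimodules acting on polynomials -/

variable (ρ) in
open Classical in
/-- The map `R^J → R^I` of a step of an expression, read from right to left: the inclusion if
`I ⊆ J`, and the Frobenius trace otherwise. -/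
def stepMap (I J : Set B) : ρ.inv J →+ ρ.inv I :=
  if h : I ⊆ J then (ρ.incl h : ρ.inv J →+ ρ.inv I) else ρ.trace J I

theorem stepMap_of_subset {I J : Set B} (h : I ⊆ J) (f : ρ.inv J) :
    ρ.stepMap I J f = ρ.incl h f := by
  rw [stepMap, dif_pos h]
  rfl

theorem stepMap_of_not_subset {I J : Set B} (h : ¬ I ⊆ J) (f : ρ.inv J) :
    ρ.stepMap I J f = ρ.trace J I f := by
  rw [stepMap, dif_neg h]

theorem stepMap_mul {I J : Set B} (x : ρ.inv I) (y : ρ.inv J) (h : (x : ρ.Poly) = y)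
    (f : ρ.inv J) : ρ.stepMap I J (y * f) = x * ρ.stepMap I J f := by
  by_cases hIJ : I ⊆ J
  · rw [stepMap_of_subset hIJ, stepMap_of_subset hIJ, map_mul,
      show ρ.incl hIJ y = x from Subtype.ext h.symm]
  · rw [stepMap_of_not_subset hIJ, stepMap_of_not_subset hIJ, ρ.trace_mul J I x y f h]

variable (ρ) in
/-- The action of a tensor on a polynomial `f` in the last ring: from right to left, multiply with
the factors of the tensor, and apply the inclusions and Frobenius traces. -/
def actOn (f : ρ.Poly) : (I : Set B) → (w : List (Set B)) → (ρ.BS I w →ₗ[ρ.inv I] ρ.inv I)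
  | I, [] => LinearMap.toSpanSingleton (ρ.inv I) (ρ.inv I) (ρ.toInv I f)
  | I, J :: w => ρ.tlift ((ρ.stepMap I J).comp (actOn f J w).toAddMonoidHom) fun x y h m => by
      change ρ.stepMap I J (actOn f J w (y • m)) = x * ρ.stepMap I J (actOn f J w m)
      rw [map_smul, smul_eq_mul, stepMap_mul x y h]

theorem actOn_nil (f : ρ.Poly) (I : Set B) (a : ρ.inv I) :
    ρ.actOn f I [] a = a * ρ.toInv I f := rfl

theorem actOn_cons (f : ρ.Poly) (I J : Set B) (w : List (Set B)) (a : ρ.inv I) (m : ρ.BS J w) :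
    ρ.actOn f I (J :: w) (ρ.tm J a m : ρ.Tens I J (ρ.BS J w)) =
      a * ρ.stepMap I J (ρ.actOn f J w m) := rfl

theorem actOn_cons_cons (f : ρ.Poly) (I J K : Set B) (w : List (Set B)) (a : ρ.inv I)
    (g : ρ.inv J) (m : ρ.BS K w) :
    ρ.actOn f I (J :: K :: w) (ρ.tm J a (ρ.tm K g m : ρ.Tens J K (ρ.BS K w))) =
      a * ρ.stepMap I J (g * ρ.stepMap J K (ρ.actOn f K w m)) := rfl

/-- For a cap this is linearity of the trace over the smaller ring. For a left-facing crossing,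
transitivity rewrites the traces through `C` as traces through `A`, and the sum over dual bases then
reassembles the polynomial that the trace from `R^K` to `R^A` produces. -/
theorem IsAdmissible.actOn_eval (hρ : ρ.IsAdmissible) (f : ρ.Poly) {I : Set B}
    {w w' : List (Set B)} (D : Diag ρ I w w') (hD : D.IsSinister) (t : ρ.BS I w) :
    ρ.actOn f I w' (D.eval t) = ρ.actOn f I w t := by
  induction D with
  | ofEq h => subst h; rfl
  | comp D D' ih ih' => exact (ih' hD.2 _).trans (ih hD.1 t)
  | @whisk I J w w' D ih =>
    induction t using ρ.tens_induction with
    | h0 => exact (congrArg _ (map_zero _)).trans ((map_zero _).trans (map_zero _).symm)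
    | h1 a m =>
      refine (congrArg (ρ.actOn f I (J :: w')) (tmap_tm D.eval a m)).trans ?_
      rw [actOn_cons, actOn_cons, ih hD]
    | h2 s t hs ht =>
      refine (congrArg _ (map_add _ s t)).trans ((map_add _ _ _).trans
        ((congrArg₂ (· + ·) hs ht).trans (map_add _ s t).symm))
  | @ccwCap K A h w =>
    induction t using tens_induction₂ with
    | h0 => exact (congrArg _ (map_zero _)).trans ((map_zero _).trans (map_zero _).symm)
    | h1 a g m =>
      refine (congrArg (ρ.actOn f A w) (capTr_tm a g m)).trans
        (Eq.trans ?_ (actOn_cons_cons f A K A w a g m).symm)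
      rw [map_smul, map_smul, smul_eq_mul, smul_eq_mul, stepMap_of_subset h.sub, stepMap_of_not_subset (not_subset_of_isEdge h), mul_comm g,
        ρ.trace_mul K A _ (ρ.incl h.sub _) g rfl, mul_comm (ρ.trace K A g)]
    | h2 s t hs ht =>
      refine (congrArg _ (map_add _ s t)).trans ((map_add _ _ _).trans
        ((congrArg₂ (· + ·) hs ht).trans (map_add _ s t).symm))
  | @leftCross K A C L h w =>
    induction t using tens_induction₂ with
    | h0 => exact (congrArg _ (map_zero _)).trans ((map_zero _).trans (map_zero _).symm)
    | h1 a g m =>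
      refine (congrArg (ρ.actOn f A (L :: C :: w)) (leftCrossing_tm h a g m)).trans ?_
      refine (map_sum (ρ.actOn f A (L :: C :: w)) _ _).trans ?_
      refine Eq.trans ?_ (actOn_cons_cons f A K C w a g m).symm
      have hKA := not_subset_of_isEdge h.isEdge₁
      have hCL := not_subset_of_isEdge h.swap.isEdge₂
      -- The traces along `K ⊂ C ⊂ L` and along `K ⊂ A ⊂ L` have the same composition.
      have hLC : ∀ F : ρ.inv C, ∀ b : ρ.inv A,
          ρ.stepMap A L (1 * ρ.stepMap L C (ρ.trace K C (ρ.incl h.sub₁ b * g) * F)) =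
            ρ.incl h.sub₂ (ρ.trace A L (b * ρ.trace K A (g * ρ.incl h.swap.sub₁ F))) := by
        intro F b
        rw [one_mul, stepMap_of_subset h.sub₂, stepMap_of_not_subset hCL, mul_comm _ F,
          ← ρ.trace_mul K C F (ρ.incl h.swap.sub₁ F) _ rfl,
          hρ.trace_trace h.swap.sub₁ h.swap.sub₂ h.1,
          ← hρ.trace_trace h.sub₁ h.sub₂ h.1, mul_left_comm,
          ρ.trace_mul K A b (ρ.incl h.sub₁ b) _ rfl, mul_comm g]
      rw [stepMap_of_not_subset hKA, stepMap_of_subset h.swap.sub₁,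
        ← hρ.sum_trace_mul h.sub₂ h.1 (a * _)]
      refine Finset.sum_congr rfl fun i _ => ?_
      refine (actOn_cons_cons f A L C w _ 1 _).trans ?_
      rw [map_smul, smul_eq_mul, hLC, mul_comm, mul_comm _ a, mul_right_comm]
    | h2 s t hs ht =>
      refine (congrArg _ (map_add _ s t)).trans ((map_add _ _ _).trans
        ((congrArg₂ (· + ·) hs ht).trans (map_add _ s t).symm))
  | ccwCup | cwCap | cwCup | upCross | downCross | rightCross | poly => exact hD.elim

end Realization

end SingularSoergel

namespace SingularSoergel

/-! ### Reduced expressions act by Demazure operators -/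

section Expressions

variable {B W : Type*} [Group W] {M : CoxeterMatrix B} {cs : CoxeterSystem M W}

theorem lastRegion_append (I : Set B) (w v : List (Set B)) :
    lastRegion I (w ++ v) = lastRegion (lastRegion I w) v := by
  induction w generalizing I with
  | nil => rfl
  | cons J w ih => exact ih J

theorem not_insert_subset {s : B} {I : Set B} (h : s ∉ I) : ¬ insert s I ⊆ I :=
  fun h' => h (h' (Set.mem_insert s I))

theorem LeftMax.mul {I : Set B} {x y : W} (h : LeftMax cs I x)
    (hl : cs.length (x * y) = cs.length x + cs.length y) : LeftMax cs I (x * y) := by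
  intro i hi
  have h1 := h i hi
  have h2 := cs.length_mul_le (cs.simple i * x) y
  rw [mul_assoc] at h2
  rcases cs.length_simple_mul (x * y) i with h3 | h3 <;> omega

theorem RightMax.mul {I : Set B} {x y : W} (h : RightMax cs I y)
    (hl : cs.length (x * y) = cs.length x + cs.length y) : RightMax cs I (x * y) := by
  intro i hi
  have h1 := h i hi
  have h2 := cs.length_mul_le x (y * cs.simple i)
  rw [← mul_assoc] at h2
  rcases cs.length_mul_simple (x * y) i with h3 | h3 <;> omega

theorem length_tailElt_le (I : Set B) (w : List (Set B)) :
    cs.length (tailElt cs I w) ≤ tailLength cs I w := by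
  induction w generalizing I with
  | nil => exact cs.length_one.le
  | cons J w ih => exact (cs.length_mul_le _ _).trans (Nat.add_le_add_left (ih J) _)

theorem longest_mul_tailElt_up {I J : Set B} (h : I ⊆ J) (w : List (Set B)) :
    longest cs I * tailElt cs I (J :: w) = longest cs J * tailElt cs J w := by
  change longest cs I * (stepElt cs I J * tailElt cs J w) = _
  rw [stepElt, if_pos h]
  group

theorem longest_mul_tailElt_down {I J : Set B} (h : ¬ I ⊆ J) (w : List (Set B)) :
    longest cs I * tailElt cs I (J :: w) =
      longest cs I * (longest cs J)⁻¹ * (longest cs J * tailElt cs J w) := by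
  change longest cs I * (stepElt cs I J * tailElt cs J w) = _
  rw [stepElt, if_neg h]
  group

/-- Lengths add in the product defining the coset of the expression `[I, w]`. -/
def LengthsAdd (cs : CoxeterSystem M W) (I : Set B) (w : List (Set B)) : Prop :=
  cs.length (longest cs I * tailElt cs I w) = cs.length (longest cs I) + tailLength cs I w

theorem LengthsAdd.up {I J : Set B} {w : List (Set B)} (h : I ⊆ J) (hJ : Finitary cs J)
    (hl : LengthsAdd cs I (J :: w)) : LengthsAdd cs J w := by
  have h1 := hl
  unfold LengthsAdd at h1 ⊢
  rw [longest_mul_tailElt_up h, show tailLength cs I (J :: w) =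
    cs.length (stepElt cs I J) + tailLength cs J w from rfl, stepElt, if_pos h] at h1
  have h2 := (leftMax_longest hJ).length_eq (longest_mem_of_subset h hJ)
  omega

/-- All the length estimates go in one direction, so equality for the whole product forces equality
for each partial product. -/
theorem LengthsAdd.down {I J : Set B} {w : List (Set B)} (h : J ⊆ I) (h' : ¬ I ⊆ J)
    (hI : Finitary cs I) (hl : LengthsAdd cs I (J :: w)) : LengthsAdd cs J w ∧
      cs.length (longest cs I * (longest cs J)⁻¹ * (longest cs J * tailElt cs J w)) =
        cs.length (longest cs I * (longest cs J)⁻¹) +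
          cs.length (longest cs J * tailElt cs J w) := by
  unfold LengthsAdd at hl ⊢
  rw [longest_mul_tailElt_down h', show tailLength cs I (J :: w) =
    cs.length (stepElt cs I J) + tailLength cs J w from rfl, stepElt, if_neg h',
    cs.length_one] at hl
  have h1 := length_longest_eq hI (longest_mem_of_subset h hI)
  have h2 := cs.length_mul_le (longest cs I * (longest cs J)⁻¹) (longest cs J * tailElt cs J w)
  have h3 := cs.length_mul_le (longest cs J) (tailElt cs J w)
  have h4 := length_tailElt_le (cs := cs) J w
  omega

theorem LengthsAdd.leftMax {I : Set B} {w : List (Set B)} (hI : Finitary cs I)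
    (hl : LengthsAdd cs I w) : LeftMax cs I (longest cs I * tailElt cs I w) := by
  refine (leftMax_longest hI).mul ?_
  unfold LengthsAdd at hl
  have h1 := cs.length_mul_le (longest cs I) (tailElt cs I w)
  have h2 := length_tailElt_le (cs := cs) I w
  omega

theorem IsExpr.finitary {I : Set B} {w : List (Set B)} (h : IsExpr cs I w) : Finitary cs I := by
  cases w with
  | nil => exact h
  | cons J w => exact h.1

/-- Together with left maximality, this identifies the product along a reduced expression with the
unique maximal element of its double coset. -/
theorem LengthsAdd.rightMax {I : Set B} {w : List (Set B)} (hw : IsExpr cs I w)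
    (hl : LengthsAdd cs I w) :
    RightMax cs (lastRegion I w) (longest cs I * tailElt cs I w) := by
  induction w generalizing I with
  | nil =>
    change RightMax cs I (longest cs I * 1)
    rw [mul_one]
    exact rightMax_longest hw
  | cons J w ih =>
    obtain ⟨hI, hs, hw⟩ := hw
    rcases hs with ⟨s, -, rfl⟩ | ⟨s, hs, rfl⟩
    · rw [longest_mul_tailElt_up (Set.subset_insert s I)]
      exact ih hw (hl.up (Set.subset_insert s I) hw.finitary)
    · have h := hl.down (Set.subset_insert s J) (not_insert_subset hs) hI
      rw [longest_mul_tailElt_down (not_insert_subset hs)]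
      exact (ih hw h.1).mul h.2

end Expressions

namespace Realization

universe uB uW uk uV

variable {B : Type uB} {W : Type uW} [Group W] {M : CoxeterMatrix B} {cs : CoxeterSystem M W}
  {k : Type uk} {V : Type uV} [Field k] [AddCommGroup V] [Module k V] {ρ : Realization cs k V}

/-- Here `b` is the polynomial that the right-hand piece leaves behind in the shared region. -/
theorem actOn_appendMap {f b : ρ.Poly} {v : List (Set B)} (y : ∀ J, ρ.BS J v) (I : Set B)
    (w : List (Set B))
    (h : ρ.actOn f (lastRegion I w) v (y (lastRegion I w)) = ρ.toInv (lastRegion I w) b)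
    (x : ρ.BS I w) : ρ.actOn f I (w ++ v) (appendMap y I w x) = ρ.actOn b I w x := by
  induction w generalizing I with
  | nil =>
    let a : ρ.inv I := x
    refine (congrArg (ρ.actOn f I v) (appendMap_nil y I a)).trans ?_
    exact (map_smul (ρ.actOn f I v) a (y I)).trans (congrArg (a * ·) h)
  | cons J w ih =>
    induction x using ρ.tens_induction with
    | h0 => exact (congrArg _ (map_zero _)).trans ((map_zero _).trans (map_zero _).symm)
    | h1 a m =>
      refine (congrArg (ρ.actOn f I (J :: (w ++ v))) (appendMap_cons y I J w a m)).trans ?_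
      rw [actOn_cons, actOn_cons, ih J h]
    | h2 s t hs ht =>
      refine (congrArg _ (map_add _ s t)).trans ((map_add _ _ _).trans
        ((congrArg₂ (· + ·) hs ht).trans (map_add _ s t).symm))

theorem actOn_leftMap (f : ρ.Poly) {w : List (Set B)} (I : Set B) (z : List (Set B))
    (m : ρ.BS (lastRegion I z) w) : ρ.actOn f I (z ++ w) (leftMap I z m) =
      ρ.actOn (ρ.actOn f (lastRegion I z) w m : ρ.Poly) I z (ρ.oneTensor I z) := by
  induction z generalizing I with
  | nil =>
    rw [oneTensor_nil]
    refine Eq.trans ?_ (actOn_nil _ I 1).symm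
    rw [one_mul]
    exact (toInv_coe _).symm
  | cons J z ih =>
    rw [oneTensor_cons, actOn_cons, one_mul]
    refine (actOn_cons f I J (z ++ w) 1 (leftMap J z m)).trans ((one_mul _).trans ?_)
    exact congrArg (ρ.stepMap I J) (ih J m)

theorem actOn_append_oneTensor (f : ρ.Poly) (I : Set B) (z w : List (Set B)) :
    ρ.actOn f I (z ++ w) (ρ.oneTensor I (z ++ w)) =
      ρ.actOn (ρ.actOn f (lastRegion I z) w (ρ.oneTensor _ w) : ρ.Poly) I z
        (ρ.oneTensor I z) := by
  rw [← leftMap_oneTensor, actOn_leftMap]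

theorem actOn_nil_oneTensor (f : ρ.Poly) (I : Set B) :
    ρ.actOn f I [] (ρ.oneTensor I []) = ρ.toInv I f := by
  rw [oneTensor_nil]
  exact one_mul _

theorem actOn_cons_oneTensor (f : ρ.Poly) (I J : Set B) (w : List (Set B)) :
    ρ.actOn f I (J :: w) (ρ.oneTensor I (J :: w)) =
      ρ.stepMap I J (ρ.actOn f J w (ρ.oneTensor J w)) := by
  rw [oneTensor_cons, actOn_cons, one_mul]

theorem actOn_ascending {I : Set B} {w : List (Set B)} (hw : IsAscending I w) {b : ρ.Poly}
    (hb : b ∈ ρ.inv (lastRegion I w)) : (ρ.actOn b I w (ρ.oneTensor I w) : ρ.Poly) = b := by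
  induction w generalizing I with
  | nil =>
    rw [actOn_nil_oneTensor]
    exact coe_toInv hb
  | cons J w ih =>
    have hIJ : I ⊆ J := by
      obtain ⟨⟨s, -, rfl⟩, -⟩ := hw
      exact Set.subset_insert s I
    rw [actOn_cons_oneTensor, stepMap_of_subset hIJ]
    exact ih hw.2 hb

theorem IsAdmissible.actOn_descending (hρ : ρ.IsAdmissible) {I : Set B} {w : List (Set B)}
    (hI : Finitary cs I) (hw : IsDescending I w) (g : ρ.Poly) :
    (ρ.actOn (ρ.demazureSet (lastRegion I w) g) I w (ρ.oneTensor I w) : ρ.Poly) =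
      ρ.demazureSet I g := by
  induction w generalizing I with
  | nil =>
    rw [actOn_nil_oneTensor]
    exact coe_toInv (hρ.demazureSet_mem_inv hI g)
  | cons J w ih =>
    obtain ⟨⟨s, hs, rfl⟩, hw⟩ := hw
    rw [actOn_cons_oneTensor, stepMap_of_not_subset (not_insert_subset hs)]
    exact hρ.trace_demazureSet (Set.subset_insert s J) hI
      (ih (hI.mono (Set.subset_insert s J)) hw)

/-- Feeding in `∂_J g` instead of a bare invariant makes the induction uniform. An ascending step is
an inclusion and leaves the product `w_I · (w_I⁻¹ w_K) ⋯` unchanged. A descending step applies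
`∂_{w_I w_K⁻¹}`, and the operators compose because lengths add. -/
theorem IsAdmissible.actOn_reduced (hρ : ρ.IsAdmissible) {I : Set B} {w : List (Set B)}
    (hw : IsExpr cs I w) (hl : LengthsAdd cs I w) (g : ρ.Poly) :
    (ρ.actOn (ρ.demazureSet (lastRegion I w) g) I w (ρ.oneTensor I w) : ρ.Poly) =
      ρ.demazureElt (longest cs I * tailElt cs I w) g := by
  induction w generalizing I with
  | nil =>
    rw [actOn_nil_oneTensor, show tailElt cs I [] = 1 from rfl, mul_one]
    exact coe_toInv (hρ.demazureSet_mem_inv hw g)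
  | cons J w ih =>
    obtain ⟨hI, hs, hw⟩ := hw
    rw [actOn_cons_oneTensor]
    rcases hs with ⟨s, -, rfl⟩ | ⟨s, hs, rfl⟩
    · rw [longest_mul_tailElt_up (Set.subset_insert s I),
        stepMap_of_subset (Set.subset_insert s I)]
      exact ih hw (hl.up (Set.subset_insert s I) hw.finitary)
    · have h := hl.down (Set.subset_insert s J) (not_insert_subset hs) hI
      rw [longest_mul_tailElt_down (not_insert_subset hs),
        stepMap_of_not_subset (not_insert_subset hs), hρ.trace_eq (Set.subset_insert s J) hI,
        hρ.demazureElt_mul h.2]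
      exact congrArg _ (ih hw h.1)

/-- Along ascending steps each ring contains the next one, so all factors can be moved to the far
left; their product is the action on `1`. -/
theorem eq_smul_oneTensor {I : Set B} {w : List (Set B)} (hw : IsAscending I w)
    (t : ρ.BS I w) : t = ρ.actOn 1 I w t • ρ.oneTensor I w := by
  induction w generalizing I with
  | nil =>
    rw [oneTensor_nil]
    refine Eq.symm ((congrArg (· * (1 : ρ.inv I)) (actOn_nil 1 I t)).trans ?_)
    rw [toInv_one, mul_one]
    exact mul_one _
  | cons J w ih =>
    have hIJ : I ⊆ J := by
      obtain ⟨⟨s, -, rfl⟩, -⟩ := hw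
      exact Set.subset_insert s I
    induction t using ρ.tens_induction with
    | h0 =>
      refine Eq.symm ((congrArg (· • ρ.oneTensor I (J :: w)) ?_).trans (zero_smul (ρ.inv I) _))
      exact map_zero (ρ.actOn 1 I (J :: w))
    | h1 a m =>
      rw [actOn_cons, oneTensor_cons, stepMap_of_subset hIJ]
      refine Eq.trans ?_ (ρ.smul_tm _ 1 _).symm
      rw [mul_one, ρ.tm_balanced a _ (ρ.actOn 1 J w m) rfl]
      exact congrArg (ρ.tm J a) (ih hw.2 m)
    | h2 s t hs ht =>
      refine (congrArg₂ (· + ·) hs ht).trans ((add_smul _ _ _).symm.trans ?_)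
      exact congrArg (· • ρ.oneTensor I (J :: w)) (map_add (ρ.actOn 1 I (J :: w)) s t).symm

/-- Expand the last factor in a basis of `R^C` over `R^L` and move the coefficients to the left.
They are the actions on the dual basis, so the tensor is determined by its action. -/
theorem IsAdmissible.eq_sum_actOn (hρ : ρ.IsAdmissible) {A C L : Set B} (hA : A ⊆ L)
    (hC : C ⊆ L) (hL : Finitary cs L) (h : ¬ L ⊆ C) (t : ρ.BS A [L, C]) :
    t = (∑ i, ρ.tm L (ρ.actOn ((ρ.dualBases hC).2.2 i : ρ.Poly) A [L, C] t)
      (ρ.tm C 1 ((ρ.dualBases hC).2.1 i)) : ρ.Tens A L (ρ.Tens L C (ρ.inv C))) := by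
  induction t using tens_induction₂ with
  | h0 =>
    refine Eq.symm (Finset.sum_eq_zero fun i _ => ?_)
    refine (congrArg (fun a => ρ.tm L a _) (map_zero (ρ.actOn _ A [L, C]))).trans ?_
    refine (congrArg (fun a => ρ.tm L a _) (zero_mul (1 : ρ.inv A))).symm.trans ?_
    exact (ρ.smul_tm (0 : ρ.inv A) 1 (ρ.tm C 1 ((ρ.dualBases hC).2.1 i))).symm.trans
      (zero_smul _ _)
  | h1 a g e' =>
    let e : ρ.inv C := e'
    have e1 : ∀ i, ρ.tm L (ρ.actOn ((ρ.dualBases hC).2.2 i : ρ.Poly) A [L, C]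
        (ρ.tm L a (ρ.tm C g e' : ρ.Tens L C (ρ.BS C [])))) (ρ.tm C 1 ((ρ.dualBases hC).2.1 i)) =
        ρ.tm L a (ρ.tm C g (ρ.incl hC (ρ.trace C L (e * (ρ.dualBases hC).2.2 i)) *
          (ρ.dualBases hC).2.1 i)) := by
      intro i
      rw [actOn_cons_cons, stepMap_of_subset hA, stepMap_of_not_subset h,
        ρ.tm_balanced a _ (g * ρ.trace C L (ρ.actOn _ C [] e')) rfl, smul_tm, mul_one,
        ρ.tm_balanced g _ (ρ.incl hC (ρ.trace C L (ρ.actOn _ C [] e'))) rfl]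
      have e2 : ρ.actOn ((ρ.dualBases hC).2.2 i : ρ.Poly) C [] e' =
          e * (ρ.dualBases hC).2.2 i :=
        (actOn_nil _ C e).trans (congrArg (e * ·) (toInv_coe _))
      rw [e2]
      rfl
    refine Eq.trans ?_ (Finset.sum_congr rfl fun i _ => e1 i).symm
    rw [← tm_sum, ← tm_sum, hρ.sum_trace_mul hC hL]
    rfl
  | h2 s t hs ht =>
    refine (congrArg₂ (· + ·) hs ht).trans (Finset.sum_add_distrib.symm.trans ?_)
    refine Finset.sum_congr rfl fun i _ => ?_
    refine (ρ.add_tm _ _ _).symm.trans (congrArg (fun a => ρ.tm L a _) ?_)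
    exact (map_add (ρ.actOn _ A [L, C]) s t).symm

theorem IsAdmissible.eq_of_actOn_eq (hρ : ρ.IsAdmissible) {A C L : Set B} (hA : A ⊆ L)
    (hC : C ⊆ L) (hL : Finitary cs L) (h : ¬ L ⊆ C) {t t' : ρ.BS A [L, C]}
    (ht : ∀ f ∈ ρ.inv C, ρ.actOn f A [L, C] t = ρ.actOn f A [L, C] t') : t = t' := by
  rw [hρ.eq_sum_actOn hA hC hL h t, hρ.eq_sum_actOn hA hC hL h t']
  exact Finset.sum_congr rfl fun i _ =>
    congrArg (fun a => ρ.tm L a _) (ht _ ((ρ.dualBases hC).2.2 i).2)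

end Realization

end SingularSoergel

namespace SingularSoergel

/-! ### Rex moves and single step light leaves -/

section Cores

variable {B W : Type*} [Group W] {M : CoxeterMatrix B} {cs : CoxeterSystem M W}

theorem leftRed_subset (I J : Set B) (p : Set W) : leftRed cs I J p ⊆ I := fun _ h => h.1

theorem rightRed_subset (I J : Set B) (p : Set W) : rightRed cs I J p ⊆ J := fun _ h => h.1

theorem length_minElt_mul_longest {I J : Set B} {m : Set W} (hm : ∃ x, m = coset cs I J x)
    (hJ : Finitary cs J) :
    cs.length (minElt cs m * longest cs (rightRed cs I J m)) =
      cs.length (minElt cs m) + cs.length (longest cs (rightRed cs I J m)) :=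
  (rightMin_minElt hm).length_mul (longest_mem_of_subset (rightRed_subset I J m) hJ)

theorem leftMax_minElt_mul_longest {I J : Set B} {m : Set W} (hm : ∃ x, m = coset cs I J x)
    (hJ : Finitary cs J) :
    LeftMax cs (leftRed cs I J m) (minElt cs m * longest cs (rightRed cs I J m)) := by
  intro i ⟨hi, j, hj, e⟩
  have hj' : j ∈ rightRed cs I J m := ⟨hj, i, hi, by rw [e]; group⟩
  have e1 : cs.simple i * (minElt cs m * longest cs (rightRed cs I J m)) =
      minElt cs m * (cs.simple j * longest cs (rightRed cs I J m)) := by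
    rw [e]; group
  have hr := rightMin_minElt hm
  have hJ' := hJ.mono (rightRed_subset (cs := cs) I J m)
  rw [e1, length_minElt_mul_longest hm hJ, hr.length_mul
    (mul_mem (simple_mem_parabolic cs hj) (longest_mem_of_subset (rightRed_subset I J m) hJ)),
    ← leftMax_longest hJ' j hj']
  rfl

/-- The minimal element `x` conjugates the right redundancy into the left one, so `x w_R`, with `R`
the right redundancy, is maximal on both sides in the core coset. So is the product of a reduced
expression, and the maximal element is unique. -/
theorem longest_mul_tailElt_of_core {I J : Set B} {m : Set W} (hm : ∃ x, m = coset cs I J x)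
    (hI : Finitary cs I) (hJ : Finitary cs J) {K : List (Set B)}
    (hK : IsReducedExpr cs (leftRed cs I J m) K (rightRed cs I J m)
      (coset cs (leftRed cs I J m) (rightRed cs I J m) (minElt cs m))) :
    longest cs (leftRed cs I J m) * tailElt cs (leftRed cs I J m) K =
      minElt cs m * longest cs (rightRed cs I J m) := by
  obtain ⟨hK, hlast, hp, hl⟩ := hK
  have hl' : LengthsAdd cs (leftRed cs I J m) K := hl
  have hI' := hI.mono (leftRed_subset (cs := cs) I J m)
  have hJ' := hJ.mono (rightRed_subset (cs := cs) I J m)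
  refine eq_of_leftMax_of_rightMax hI' (J := rightRed cs I J m) ⟨_, rfl⟩
    (hp.symm.subset (self_mem_coset _))
    (mem_coset.2 ⟨1, one_mem _, _, longest_mem hJ', by rw [one_mul]⟩)
    (hl'.leftMax hI') ?_ (leftMax_minElt_mul_longest hm hJ)
    ((rightMax_longest hJ').mul (length_minElt_mul_longest hm hJ))
  have := hl'.rightMax hK
  rwa [hlast] at this

end Cores

namespace Realization

universe uB uW uk uV

variable {B : Type uB} {W : Type uW} [Group W] {M : CoxeterMatrix B} {cs : CoxeterSystem M W}
  {k : Type uk} {V : Type uV} [Field k] [AddCommGroup V] [Module k V] {ρ : Realization cs k V}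

theorem eval_comp {I : Set B} {w w' w'' : List (Set B)} (D : Diag ρ I w w')
    (D' : Diag ρ I w' w'') (x : ρ.BS I w) : (D.comp D').eval x = D'.eval (D.eval x) := rfl

/-! ### Rex moves -/

/-- On the short side tensors are determined by their action. There `1^⊗` takes `∂_{L∖u_d} g` to
`∂_L g` by a trace; on the long side the product of the reduced expression is the maximal element of
its coset, which is `w_L`, so the result is again `∂_L g`. -/
theorem IsAdmissible.eval_switchback (hρ : ρ.IsAdmissible) {L : Set B} {u : ℕ → B} {d : ℕ}
    (h : IsRotationSequence cs L u d)
    {D : Diag ρ (L \ {u 0}) (switchbackTail L u d) [L, L \ {u d}]} (hD : D.IsSinister) :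
    D.eval (ρ.oneTensor _ _) = ρ.oneTensor _ _ := by
  have hA : L \ {u 0} ⊆ L := Set.sdiff_subset
  have hC : L \ {u d} ⊆ L := Set.sdiff_subset
  have hLA : ¬ L ⊆ L \ {u 0} := fun h' => (h' (h.mem 0 (Nat.zero_le d))).2 rfl
  have hLC : ¬ L ⊆ L \ {u d} := fun h' => (h' (h.mem d le_rfl)).2 rfl
  refine hρ.eq_of_actOn_eq hA hC h.finitary hLC fun f hf => Subtype.ext ?_
  obtain ⟨hw, hlast, hp, hl⟩ := h.reduced
  have hl' : LengthsAdd cs (L \ {u 0}) (switchbackTail L u d) := hl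
  have hfA := h.finitary.mono hA
  obtain ⟨g, rfl⟩ := hρ.exists_demazureSet_eq (h.finitary.mono hC) hf
  have e : longest cs (L \ {u 0}) * tailElt cs (L \ {u 0}) (switchbackTail L u d) =
      longest cs L := by
    have hr := hl'.rightMax hw
    rw [hlast] at hr
    exact eq_of_leftMax_of_rightMax hfA (J := L \ {u d}) ⟨_, rfl⟩ (hp ▸ self_mem_coset _)
      (self_mem_coset _) (hl'.leftMax hfA) hr
      (fun i hi => leftMax_longest h.finitary i hi.1)
      (fun i hi => rightMax_longest h.finitary i hi.1)
  have e1 := hρ.actOn_reduced hw hl' g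
  rw [hlast, e] at e1
  rw [hρ.actOn_eval _ D hD, e1, actOn_cons_oneTensor, actOn_cons_oneTensor, actOn_nil_oneTensor,
    stepMap_of_subset hA, stepMap_of_not_subset hLC]
  exact (hρ.trace_demazureSet hC h.finitary (coe_toInv hf)).symm

theorem IsAdmissible.eval_rexMove (hρ : ρ.IsAdmissible) {I : Set B} {w w' : List (Set B)}
    {D : Diag ρ I w w'} (hD : ρ.IsRexMove D) :
    D.eval (ρ.oneTensor I w) = ρ.oneTensor I w' := by
  induction hD with
  | ofEq h => exact eval_ofEq_oneTensor h
  | comp _ _ ih ih' => exact (congrArg _ ih).trans ih'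
  | whisk I _ ih => exact eval_whisk_oneTensor I ih
  | upUp h w =>
    rw [oneTensor_cons, oneTensor_cons, oneTensor_cons, oneTensor_cons]
    refine (crossLeft_tm _ _ _ _ _).trans ?_
    rw [map_one, mul_one]
    rfl
  | downDown h w =>
    rw [oneTensor_cons, oneTensor_cons, oneTensor_cons, oneTensor_cons]
    refine (crossRight_tm _ _ _ _ _).trans ?_
    rw [map_one, one_smul]
    rfl
  | switchback h hD w => exact eval_right_oneTensor (hρ.eval_switchback h hD) w
  | switchbackDual h hD w => exact eval_right_oneTensor (eval_dual_oneTensor _ hD) w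

/-! ### Single step light leaves -/

theorem eval_cwCapEnd {K A K' : Set B} (h : IsEdge cs K A) (e : K' = K) :
    (Diag.cwCapEnd (ρ := ρ) h e).eval (ρ.oneTensor K' [A, K]) = ρ.oneTensor K' [] := by
  subst e
  rw [oneTensor_cons, oneTensor_cons]
  refine (capMul_tm h.sub 1 1 (ρ.oneTensor K' [])).trans ?_
  rw [map_one, one_smul, one_smul]

theorem eval_stepDown {I₀ J J' : Set B} (hJ : IsEdge cs J' J)
    {Z T Y X : List (Set B)} {E : Diag ρ (lastRegion I₀ Z) (T ++ Y ++ [J]) X}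
    (hE : E.IsSinister) (hlast : lastRegion (lastRegion I₀ Z) (T ++ Y) = J') (e₁ e₂ e₃) :
    ((Diag.ofEq e₁).comp (Diag.left I₀ Z ((E.dual.right [J']).comp ((Diag.ofEq e₂).comp
      ((Diag.left (lastRegion I₀ Z) (T ++ Y) (Diag.cwCapEnd hJ hlast)).comp
        (Diag.ofEq e₃)))))).eval (ρ.oneTensor I₀ ((Z ++ X) ++ [J'])) =
      ρ.oneTensor I₀ (Z ++ (T ++ Y)) := by
  refine (congrArg _ (eval_ofEq_oneTensor e₁)).trans (eval_left_oneTensor I₀ Z ?_)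
  rw [eval_comp, eval_comp, eval_comp, eval_right_oneTensor (eval_dual_oneTensor E hE) [J'],
    eval_ofEq_oneTensor e₂, eval_left_oneTensor _ (T ++ Y) (eval_cwCapEnd hJ hlast),
    eval_ofEq_oneTensor e₃]

theorem actOn_pureTensor_pair {J J' : Set B} (h : J ⊆ J') {g : ℕ → ρ.Poly} (hg : g 1 = 1) :
    ρ.actOn 1 J [J'] (ρ.pureTensor J [J'] g) = ρ.toInv J (g 0) := by
  refine (actOn_cons 1 J J' [] (ρ.toInv J (g 0)) (ρ.toInv J' (g 1))).trans ?_
  rw [hg, stepMap_of_subset h]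
  have : ρ.actOn 1 J' [] (ρ.toInv J' 1) = 1 := by
    refine (actOn_nil 1 J' (ρ.toInv J' 1)).trans ?_
    rw [toInv_one, mul_one]
  refine (congrArg (fun a => ρ.toInv J (g 0) * ρ.incl h a) this).trans ?_
  rw [map_one, mul_one]

/-- With `R` the right redundancy, write `b = ∂_R g`. The ascending tail only includes `b` into
`R^R`, and the core gives `∂_{x w_R} g = ∂_x b` for the minimal element `x`. -/
theorem IsAdmissible.actOn_core (hρ : ρ.IsAdmissible) {R J : Set B} {m : Set W}
    (hm : ∃ x, m = coset cs R J x) (hR : Finitary cs R) (hJ : Finitary cs J)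
    {K U : List (Set B)}
    (hK : IsReducedExpr cs (leftRed cs R J m) K (rightRed cs R J m)
      (coset cs (leftRed cs R J m) (rightRed cs R J m) (minElt cs m)))
    (hU : IsAscending (rightRed cs R J m) U) (hlast : lastRegion (rightRed cs R J m) U = J)
    {b : ρ.Poly} (hb : b ∈ ρ.inv J) :
    (ρ.actOn b (leftRed cs R J m) (K ++ U) (ρ.oneTensor _ _) : ρ.Poly) =
      ρ.demazureElt (minElt cs m) b := by
  have hl : LengthsAdd cs (leftRed cs R J m) K := hK.2.2.2
  have hr := rightRed_subset (cs := cs) R J m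
  obtain ⟨g, rfl⟩ := hρ.exists_demazureSet_eq (hJ.mono hr) (ρ.inv_anti hr hb)
  have e := hρ.actOn_reduced hK.1 hl g
  rw [longest_mul_tailElt_of_core hm hR hJ hK,
    hρ.demazureElt_mul (length_minElt_mul_longest hm hJ), hK.2.1] at e
  rw [actOn_append_oneTensor]
  have e' : (ρ.actOn (ρ.demazureSet (rightRed cs R J m) g) (lastRegion (leftRed cs R J m) K) U
      (ρ.oneTensor _ U) : ρ.Poly) = ρ.demazureSet (rightRed cs R J m) g := by
    apply actOn_ascending
    · rwa [hK.2.1]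
    · rwa [hK.2.1, hlast]
  rw [e', e]

/-- The target is ascending, so only the action on `1` of the source tensor is needed, and `E` does
not change it. From right to left, `g 0` becomes `∂_m(g 0)` along `Y`, is multiplied by the
sprinkle, and is traced up to `R^R` along `T`. -/
theorem IsAdmissible.eval_elementary (hρ : ρ.IsAdmissible) {R J J' : Set B} {m : Set W}
    (hJJ : J ⊆ J') (hm : ∃ x, m = coset cs R J x) (hR : Finitary cs R) (hJ : Finitary cs J)
    {T Y X : List (Set B)} (hc : IsCoreExpr cs R J m T Y) (hX : IsAscending R X)
    {E : Diag ρ R (T ++ Y ++ [J']) X} (hE : E.IsSinister) {g : ℕ → ρ.Poly}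
    (hg : g 0 ∈ ρ.inv J) (hg1 : g 1 = 1) (Q : ρ.Poly) (e) :
    ((Diag.left R T (Diag.poly (lastRegion R T) (ρ.demazureSet (leftRed cs R J m) Q)
      (Y ++ [J']))).comp ((Diag.ofEq e).comp E)).eval
        (leftMap R T (appendMap (fun K => ρ.pureTensor K [J'] g) (lastRegion R T) Y
          (ρ.oneTensor _ Y))) =
      ρ.toInv R (ρ.demazureSet R (Q * ρ.demazureElt (minElt cs m) (g 0))) • ρ.oneTensor R X := by
  obtain ⟨hT, hTl, K, U, rfl, hK, hU, hUl⟩ := hc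
  have hL := leftRed_subset (cs := cs) R J m
  have hfL := hR.mono hL
  set f := ρ.demazureSet (leftRed cs R J m) Q with hf
  set x : ρ.BS (lastRegion R T) ((K ++ U) ++ [J']) :=
    appendMap (fun K => ρ.pureTensor K [J'] g) (lastRegion R T) (K ++ U) (ρ.oneTensor _ _)
    with hx
  have hlast : lastRegion (lastRegion R T) (K ++ U) = J := by
    rw [hTl, lastRegion_append, hK.2.1, hUl]
  have ex : (ρ.actOn 1 (lastRegion R T) ((K ++ U) ++ [J']) x : ρ.Poly) =
      ρ.demazureElt (minElt cs m) (g 0) := by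
    rw [hx, actOn_appendMap (b := g 0)]
    · rw [hTl]
      exact hρ.actOn_core hm hR hJ hK hU hUl hg
    · rw [hlast]
      exact actOn_pureTensor_pair hJJ hg1
  refine (eq_smul_oneTensor hX _).trans (congrArg (· • ρ.oneTensor R X) (Subtype.ext ?_))
  rw [coe_toInv (hρ.demazureSet_mem_inv hR _)]
  have e1 : ρ.actOn 1 R X (((Diag.left R T (Diag.poly (lastRegion R T) f
      ((K ++ U) ++ [J']))).comp ((Diag.ofEq e).comp E)).eval (leftMap R T x)) =
      ρ.actOn 1 R (T ++ ((K ++ U) ++ [J'])) (leftMap R T (ρ.toInv (lastRegion R T) f • x)) := by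
    refine (hρ.actOn_eval 1 E hE _).trans ?_
    refine (hρ.actOn_eval 1 (Diag.ofEq (ρ := ρ) (I := R) e) trivial _).trans ?_
    exact congrArg _ (eval_left R T (Diag.poly (lastRegion R T) f ((K ++ U) ++ [J'])) x)
  have hfm : f ∈ ρ.inv (lastRegion R T) := hTl ▸ hρ.demazureSet_mem_inv hfL Q
  rw [e1, actOn_leftMap, map_smul, smul_eq_mul, MulMemClass.coe_mul, coe_toInv hfm, ex]
  have hxm : ρ.demazureElt (minElt cs m) (g 0) ∈ ρ.inv (leftRed cs R J m) := by
    rw [← ex, ← hTl]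
    exact SetLike.coe_mem _
  -- The factor `∂_m(g 0)` is invariant under the left redundancy and can be absorbed into the
  -- argument of its Demazure operator, after which the traces along `T` compose to `∂_R`.
  have e2 : f * ρ.demazureElt (minElt cs m) (g 0) =
      ρ.demazureSet (lastRegion R T) (Q * ρ.demazureElt (minElt cs m) (g 0)) := by
    rw [hTl, mul_comm Q, demazureSet, hρ.demazureElt_mul_of_mem_inv (longest_mem hfL) hxm,
      mul_comm, hf]
  rw [e2, hρ.actOn_descending hR hT]

theorem IsAdmissible.eval_stepUp (hρ : ρ.IsAdmissible) {I₀ J J' : Set B} {p q : Set W}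
    (hI : Finitary cs J') (hJ : IsEdge cs J J') {Z T Y X : List (Set B)}
    {E : Diag ρ (lastRegion I₀ Z) (T ++ Y ++ [J']) X}
    (h : ElementaryData ρ I₀ J J' p q Z T Y X E) {g : ℕ → ρ.Poly}
    (hg : g 0 ∈ ρ.inv J) (hg1 : g 1 = 1) (Q : ρ.Poly) {f : ρ.Poly}
    (hf : f = ρ.demazureSet (leftRed cs (rightRed cs I₀ J' q) J (grassmannian cs I₀ J J' p q)) Q)
    (e₁ e₂) :
    ((Diag.ofEq e₁).comp (Diag.left I₀ Z ((Diag.left (lastRegion I₀ Z) T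
      (Diag.poly (lastRegion (lastRegion I₀ Z) T) f (Y ++ [J']))).comp
        ((Diag.ofEq e₂).comp E)))).eval
      (appendMap (fun K => ρ.pureTensor K [J'] g) I₀ (Z ++ (T ++ Y)) (ρ.oneTensor _ _)) =
      leftMap I₀ Z (ρ.toInv (lastRegion I₀ Z) (ρ.demazureSet (rightRed cs I₀ J' q)
        (Q * ρ.demazureElt (minElt cs (grassmannian cs I₀ J J' p q)) (g 0))) •
          ρ.oneTensor (lastRegion I₀ Z) X) := by
  have hZ := h.z_reduced.2.1
  have hc := h.m_core
  have hX := h.n_ascending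
  have hm : ∃ x, grassmannian cs I₀ J J' p q = coset cs (rightRed cs I₀ J' q) J x := ⟨_, rfl⟩
  have hR : Finitary cs (rightRed cs I₀ J' q) := hI.mono (rightRed_subset I₀ J' q)
  -- The right redundancy of `q` equals the last region of `Z` only propositionally; the latter
  -- appears in the type of `E`.
  rw [← hZ] at hc hX hm hR hf ⊢
  subst hf
  have e3 : T ++ Y ++ [J'] = T ++ (Y ++ [J']) := List.append_assoc _ _ _
  refine (congrArg _ (?_ : _ = leftMap I₀ Z (leftMap (lastRegion I₀ Z) T
    (appendMap (fun K => ρ.pureTensor K [J'] g) (lastRegion (lastRegion I₀ Z) T) Y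
      (ρ.oneTensor _ Y))))).trans ?_
  · rw [← leftMap_oneTensor, ← leftMap_oneTensor]
    refine (appendMap_leftMap _ I₀ Z e3 e₁ _).trans (congrArg _ ?_)
    exact appendMap_leftMap _ (lastRegion I₀ Z) T rfl e3 _
  · refine (eval_left I₀ Z _ _).trans (congrArg (leftMap I₀ Z) ?_)
    exact hρ.eval_elementary hJ.sub hm hR (hI.mono hJ.sub) hc hX h.sinister hg hg1 Q e₂

end Realization

end SingularSoergel

/-! ### Grassmannian pairs and the order on sprinkled paths -/

namespace SingularSoergel

/-! ### Grassmannian pairs -/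

section Grassmannian

variable {B W : Type*} [Group W] {M : CoxeterMatrix B} {cs : CoxeterSystem M W}
  {I₀ J J' : Set B} {p q : Set W}

/-- The minimal element of `p` is a length-additive product of an element of `W_{I₀}`, the minimal
element of `q` and an element of `W_{J'}`; the first factor is trivial by left minimality. -/
theorem minElt_factor_of_subset (hp : ∃ x, p = coset cs I₀ J x) (hq : ∃ x, q = coset cs I₀ J' x)
    (hpq : p ⊆ q) : (minElt cs q)⁻¹ * minElt cs p ∈ parabolic cs J' := by
  have hne : p.Nonempty := by
    obtain ⟨x, rfl⟩ := hp
    exact ⟨x, self_mem_coset x⟩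
  obtain ⟨a, ha, b, hb, e, hl⟩ := exists_reduced_of_mem hq (hpq (minElt_mem (cs := cs) hne))
  have h1 := leftMin_minElt hp
  have h2 := cs.length_mul_le a (minElt cs q * b)
  have h3 := cs.length_mul_le (minElt cs q) b
  rw [e, mul_assoc] at h1 hl
  have ha1 := h1.eq_one_of_mul ha (by omega)
  rw [e, ha1, one_mul, inv_mul_cancel_left]
  exact hb

/-- Left multiplication by the minimal element of `q` adds a constant to lengths on `W_{J'}` and
turns `i` into an element of `I₀`, so minimality is inherited from `p`. -/
theorem leftMin_grassmannian (hp : ∃ x, p = coset cs I₀ J x) (hq : ∃ x, q = coset cs I₀ J' x)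
    (hpq : p ⊆ q) :
    LeftMin cs (rightRed cs I₀ J' q) ((minElt cs q)⁻¹ * minElt cs p) := by
  rintro i ⟨hi, a, ha, e⟩
  have hx := minElt_factor_of_subset hp hq hpq
  have h1 := leftMin_minElt hp a ha
  have h2 := (rightMin_minElt hq).length_mul (mul_mem (simple_mem_parabolic cs hi) hx)
  have h3 := (rightMin_minElt hq).length_mul hx
  rw [show minElt cs q * (cs.simple i * ((minElt cs q)⁻¹ * minElt cs p)) =
    cs.simple a * minElt cs p by rw [e]; group] at h2
  rw [mul_inv_cancel_left] at h3
  omega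

theorem rightMin_grassmannian (hp : ∃ x, p = coset cs I₀ J x)
    (hq : ∃ x, q = coset cs I₀ J' x) (hpq : p ⊆ q) (hJ : J ⊆ J') :
    RightMin cs J ((minElt cs q)⁻¹ * minElt cs p) := by
  intro j hj
  have hx := minElt_factor_of_subset hp hq hpq
  have h1 := rightMin_minElt hp j hj
  have h2 := (rightMin_minElt hq).length_mul (mul_mem hx (simple_mem_parabolic cs (hJ hj)))
  have h3 := (rightMin_minElt hq).length_mul hx
  rw [← mul_assoc, mul_inv_cancel_left] at h2
  rw [mul_inv_cancel_left] at h3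
  omega

theorem minElt_grassmannian (hp : ∃ x, p = coset cs I₀ J x) (hq : ∃ x, q = coset cs I₀ J' x)
    (hpq : p ⊆ q) (hJ : J ⊆ J') :
    minElt cs (Realization.grassmannian cs I₀ J J' p q) = (minElt cs q)⁻¹ * minElt cs p :=
  minElt_coset_of_min (leftMin_grassmannian hp hq hpq) (rightMin_grassmannian hp hq hpq hJ)

theorem leftRed_grassmannian_subset (hp : ∃ x, p = coset cs I₀ J x)
    (hq : ∃ x, q = coset cs I₀ J' x) (hpq : p ⊆ q) (hJ : J ⊆ J') :
    leftRed cs (rightRed cs I₀ J' q) J (Realization.grassmannian cs I₀ J J' p q) ⊆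
      {i | ∃ a ∈ leftRed cs I₀ J p,
        cs.simple i = (minElt cs q)⁻¹ * cs.simple a * minElt cs q} := by
  rintro i ⟨⟨-, a, ha, e⟩, j, hj, e'⟩
  rw [minElt_grassmannian hp hq hpq hJ] at e'
  refine ⟨a, ⟨ha, j, hj, ?_⟩, e⟩
  rw [show cs.simple a = minElt cs q * cs.simple i * (minElt cs q)⁻¹ by rw [e]; group, e']
  group

/-- Only the generated subgroups are compared, so injectivity of `i ↦ s_i` is not needed; `longest`,
and with it `∂_I`, depends on `W_I` alone. -/
theorem parabolic_leftRed_grassmannian (hp : ∃ x, p = coset cs I₀ J x)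
    (hq : ∃ x, q = coset cs I₀ J' x) (hpq : p ⊆ q) (hJ : J ⊆ J') :
    parabolic cs (leftRed cs (rightRed cs I₀ J' q) J (Realization.grassmannian cs I₀ J J' p q)) =
      parabolic cs {i | ∃ a ∈ leftRed cs I₀ J p,
        cs.simple i = (minElt cs q)⁻¹ * cs.simple a * minElt cs q} := by
  refine le_antisymm (parabolic_mono cs (leftRed_grassmannian_subset hp hq hpq hJ)) ?_
  refine (Subgroup.closure_le _).2 ?_
  rintro _ ⟨i, ⟨a, ⟨ha, j, hj, e⟩, e'⟩, rfl⟩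
  have hx := minElt_factor_of_subset hp hq hpq
  have e2 : cs.simple i = ((minElt cs q)⁻¹ * minElt cs p) * cs.simple j *
      ((minElt cs q)⁻¹ * minElt cs p)⁻¹ := by
    rw [e', e]; group
  obtain ⟨i', hi', e3⟩ := exists_simple_eq_of_mem_parabolic cs (I := J') (w := cs.simple i)
    (e2 ▸ mul_mem (mul_mem hx (simple_mem_parabolic cs (hJ hj))) (inv_mem hx))
    (cs.length_simple i)
  rw [e3]
  refine simple_mem_parabolic cs ⟨⟨hi', a, ha, e3 ▸ e'⟩, j, hj, ?_⟩
  rw [minElt_grassmannian hp hq hpq hJ, ← e3, e2]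

variable {y : W}

/-- This is `rightMin_mul` for `a = y⁻¹`: the left minimality demanded of a sprinkle is right
minimality of its inverse. -/
theorem rightMin_inv_mul (hp : ∃ x, p = coset cs I₀ J x) (hq : ∃ x, q = coset cs I₀ J' x)
    (hpq : p ⊆ q) (hJ : J ⊆ J') (hy : y ∈ parabolic cs (rightRed cs I₀ J' q))
    (hmin : ∀ v ∈ parabolic cs {i | ∃ a ∈ leftRed cs I₀ J p,
        cs.simple i = (minElt cs q)⁻¹ * cs.simple a * minElt cs q},
      cs.length y ≤ cs.length (v * y)) :
    RightMin cs J (y⁻¹ * ((minElt cs q)⁻¹ * minElt cs p)) := by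
  refine rightMin_mul (leftMin_grassmannian hp hq hpq) (rightMin_grassmannian hp hq hpq hJ)
    (inv_mem hy) fun i hi => ?_
  have hi' : i ∈ leftRed cs (rightRed cs I₀ J' q) J (Realization.grassmannian cs I₀ J J' p q) := by
    refine ⟨hi.1, ?_⟩
    rw [minElt_grassmannian hp hq hpq hJ]
    exact hi.2
  have h1 := hmin _ (simple_mem_parabolic cs (leftRed_grassmannian_subset hp hq hpq hJ hi'))
  have h2 : cs.length (y⁻¹ * cs.simple i) = cs.length (cs.simple i * y) := by
    rw [← cs.length_inv, mul_inv_rev, inv_inv, cs.inv_simple]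
  rw [h2, cs.length_inv]
  rcases cs.length_simple_mul y i with h3 | h3 <;> omega

theorem length_inv_mul_longest (hp : ∃ x, p = coset cs I₀ J x)
    (hq : ∃ x, q = coset cs I₀ J' x) (hpq : p ⊆ q) (hJ : J ⊆ J') (hJf : Finitary cs J')
    (hy : y ∈ parabolic cs (rightRed cs I₀ J' q))
    (hmin : ∀ v ∈ parabolic cs {i | ∃ a ∈ leftRed cs I₀ J p,
        cs.simple i = (minElt cs q)⁻¹ * cs.simple a * minElt cs q},
      cs.length y ≤ cs.length (v * y)) :
    cs.length (y⁻¹ * (((minElt cs q)⁻¹ * minElt cs p) * longest cs J)) =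
      cs.length y⁻¹ + cs.length (((minElt cs q)⁻¹ * minElt cs p) * longest cs J) := by
  have hw := longest_mem (hJf.mono hJ)
  rw [← mul_assoc, (rightMin_inv_mul hp hq hpq hJ hy hmin).length_mul hw,
    (leftMin_grassmannian hp hq hpq).length_mul (inv_mem hy),
    (rightMin_grassmannian hp hq hpq hJ).length_mul hw, add_assoc]

end Grassmannian

/-! ### Sprinkled paths and their dual sequences -/

namespace SprinkledPath

variable {B W : Type*} [Group W] {M : CoxeterMatrix B} {cs : CoxeterSystem M W} {d : ℕ}
  {I : Fin (d + 1) → Set B}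

theorem dualSeq_eq (T : SprinkledPath cs I) (j : Fin d) :
    T.dualSeq j = longest cs (I j.castSucc) *
      ((minElt cs (T.t j.succ))⁻¹ * minElt cs (T.t j.castSucc))⁻¹ * T.y j *
        longest cs (I j.succ) := by
  rw [dualSeq]
  group

theorem dualSeq_mem (T : SprinkledPath cs I) {j : Fin d} (hj : I j.castSucc ⊆ I j.succ)
    (hfin : Finitary cs (I j.succ)) : T.dualSeq j ∈ parabolic cs (I j.succ) := by
  rw [dualSeq_eq]
  exact mul_mem (mul_mem (mul_mem (longest_mem_of_subset hj hfin)
    (inv_mem (minElt_factor_of_subset (T.t_coset _) (T.t_coset _) (T.t_up j hj))))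
    (parabolic_mono cs (rightRed_subset _ _ _) (T.y_mem j hj))) (longest_mem hfin)

/-- With `x` the minimal element of the Grassmannian coset, the dual entry determines `x⁻¹ y`. As
`y` lies in the parabolic subgroup of the right redundancy, this fixes the double coset of `x`,
hence `x` by minimality, and then `y`. -/
theorem eq_of_dualSeq_eq_up {T U : SprinkledPath cs I} {j : Fin d}
    (hj : I j.castSucc ⊆ I j.succ) (h : T.dualSeq j = U.dualSeq j)
    (ht : T.t j.succ = U.t j.succ) : T.t j.castSucc = U.t j.castSucc ∧ T.y j = U.y j := by
  rw [dualSeq_eq, dualSeq_eq] at h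
  have hT := T.y_mem j hj
  have hU := U.y_mem j hj
  have hlT := leftMin_grassmannian (T.t_coset _) (T.t_coset _) (T.t_up j hj)
  have hlU := leftMin_grassmannian (U.t_coset _) (U.t_coset _) (U.t_up j hj)
  have hrT := rightMin_grassmannian (T.t_coset _) (T.t_coset _) (T.t_up j hj) hj
  have hrU := rightMin_grassmannian (U.t_coset _) (U.t_coset _) (U.t_up j hj) hj
  rw [ht] at h hT hlT hrT
  set x := (minElt cs (U.t j.succ))⁻¹ * minElt cs (T.t j.castSucc) with hx
  set x' := (minElt cs (U.t j.succ))⁻¹ * minElt cs (U.t j.castSucc) with hx'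
  have h1 : x⁻¹ * T.y j = x'⁻¹ * U.y j := by
    rw [mul_assoc (longest cs _) x⁻¹, mul_assoc (longest cs _) x'⁻¹] at h
    exact mul_left_cancel (mul_right_cancel h)
  have h2 : x = T.y j * (U.y j)⁻¹ * x' * 1 := by
    rw [mul_one, mul_assoc, ← inv_inv x', ← mul_inv_rev, ← h1]
    group
  have hxx : x = x' := by
    refine (minElt_coset_of_min hlT hrT).symm.trans (Eq.trans ?_ (minElt_coset_of_min hlU hrU))
    rw [coset_eq_of_mem (mem_coset.2 ⟨_, mul_mem hT (inv_mem hU), 1, one_mem _, h2⟩)]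
  have hm : minElt cs (T.t j.castSucc) = minElt cs (U.t j.castSucc) :=
    mul_left_cancel (hx.symm.trans (hxx.trans hx'))
  refine ⟨?_, ?_⟩
  · rw [coset_minElt (T.t_coset j.castSucc), coset_minElt (U.t_coset j.castSucc), hm]
  · rw [hxx] at h1
    exact mul_left_cancel h1

theorem eq_of_down {T U : SprinkledPath cs I} {j : Fin d}
    (hj : I j.succ ⊆ I j.castSucc) (ht : T.t j.succ = U.t j.succ) :
    T.t j.castSucc = U.t j.castSucc := by
  have key : ∀ T : SprinkledPath cs I,
      T.t j.castSucc = coset cs (I 0) (I j.castSucc) (minElt cs (T.t j.succ)) := by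
    intro T
    have hne : (T.t j.succ).Nonempty := by
      obtain ⟨x, hx⟩ := T.t_coset j.succ
      exact hx ▸ ⟨x, self_mem_coset x⟩
    have h1 := T.t_down j hj (minElt_mem (cs := cs) hne)
    obtain ⟨x, hx⟩ := T.t_coset j.castSucc
    rw [hx] at h1 ⊢
    exact (coset_eq_of_mem h1).symm
  rw [key T, key U, ht]

theorem subset_or_subset {I J : Set B} (h : SingleStep I J) : I ⊆ J ∨ J ⊆ I := by
  rcases h with ⟨s, -, rfl⟩ | ⟨s, -, rfl⟩
  · exact Or.inl (Set.subset_insert _ _)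
  · exact Or.inr (Set.subset_insert _ _)

theorem eq_of_dualSeq_eq (hstep : ∀ j : Fin d, SingleStep (I j.castSucc) (I j.succ))
    {T U : SprinkledPath cs I} (hterm : T.term = U.term)
    (h : ∀ j : Fin d, I j.castSucc ⊆ I j.succ → T.dualSeq j = U.dualSeq j) : T = U := by
  have ht : ∀ k, T.t k = U.t k := by
    intro k
    induction k using Fin.reverseInduction with
    | last => exact hterm
    | cast j ih =>
      by_cases hj : I j.castSucc ⊆ I j.succ
      · exact (eq_of_dualSeq_eq_up hj (h j hj) ih).1
      · exact eq_of_down ((subset_or_subset (hstep j)).resolve_left hj) ih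
  refine SprinkledPath.ext (funext ht) (funext fun j => ?_)
  by_cases hj : I j.castSucc ⊆ I j.succ
  · exact (eq_of_dualSeq_eq_up hj (h j hj) (ht j.succ)).2
  · rw [T.y_other j hj, U.y_other j hj]

theorem isStrictTotalOrder_prec {r : W → W → Prop} (hr : IsStrictTotalOrder W r)
    (hstep : ∀ j : Fin d, SingleStep (I j.castSucc) (I j.succ)) (p : Set W) :
    IsStrictTotalOrder {T : SprinkledPath cs I // T.term = p} (fun T U => T.1.Prec r U.1) where
  irrefl := fun T ⟨j, _, h, _⟩ => hr.irrefl _ h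
  trans := by
    rintro T U V ⟨i, hi, h1, h2⟩ ⟨j, hj, h3, h4⟩
    rcases lt_trichotomy i j with h | rfl | h
    · exact ⟨i, hi, h4 i h hi ▸ h1, fun l hl hl' => (h2 l hl hl').trans (h4 l (hl.trans h) hl')⟩
    · exact ⟨i, hi, hr.trans _ _ _ h1 h3, fun l hl hl' => (h2 l hl hl').trans (h4 l hl hl')⟩
    · exact ⟨j, hj, (h2 j h hj).symm ▸ h3,
        fun l hl hl' => (h2 l (hl.trans h) hl').trans (h4 l hl hl')⟩
  trichotomous := by
    intro T U hTU hUT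
    refine Subtype.ext (eq_of_dualSeq_eq hstep (T.2.trans U.2.symm) fun j => ?_)
    -- Incomparable paths have equal dual entries: a first discrepancy would make them comparable.
    induction j using WellFoundedLT.induction with
    | ind j ih =>
      intro hj
      refine hr.trichotomous _ _ (fun h => hTU ⟨j, hj, h, fun i hi hi' => ih i hi hi'⟩)
        fun h => hUT ⟨j, hj, h, fun i hi hi' => (ih i hi hi').symm⟩

theorem minElt_eq_one {p : Set W} (h : (1 : W) ∈ p) : minElt cs p = 1 := by
  have := length_minElt_le (cs := cs) h
  rwa [cs.length_one, Nat.le_zero, cs.length_eq_zero_iff] at this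

/-- The first element of the dual sequence does not depend on the path. -/
theorem dualSeq_zero (T : SprinkledPath cs I) {j : Fin d} (h0 : j.castSucc = 0)
    (hj : I j.castSucc ⊆ I j.succ) :
    T.dualSeq j = longest cs (I j.castSucc) * longest cs (I j.succ) := by
  have h1 : (1 : W) ∈ T.t j.castSucc := by
    rw [h0, T.t_zero]
    exact one_mem (parabolic cs (I 0))
  have e1 := minElt_eq_one (cs := cs) h1
  have e2 := minElt_eq_one (cs := cs) (T.t_up j hj h1)
  -- Both minimal elements are `1`, so `W_{𝓇}` is contained in `W_{𝓁}` and the minimal element of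
  -- `W_{𝓁} y` is the identity.
  have hy : T.y j = 1 := by
    have h2 := T.y_min j hj (T.y j)⁻¹ (inv_mem (parabolic_mono cs ?_ (T.y_mem j hj)))
    · rwa [inv_mul_cancel, cs.length_one, Nat.le_zero, cs.length_eq_zero_iff] at h2
    · rintro i ⟨-, a, ha, e⟩
      exact ⟨a, ⟨ha, a, h0 ▸ ha, by rw [e1]; group⟩, e⟩
  rw [dualSeq, e1, e2, hy]
  group

end SprinkledPath

end SingularSoergel

/-! ### Triangularity of light leaves against dual sprinkles -/

namespace SingularSoergel

theorem length_tailList {B : Type*} {d : ℕ} (I : Fin (d + 1) → Set B) (n : ℕ) (hn : n ≤ d) :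
    (tailList I n hn).length = n := by
  induction n with
  | zero => rfl
  | succ n ih => rw [tailList, List.length_append, ih]; rfl

namespace Realization

universe uB uW uk uV

variable {B : Type uB} {W : Type uW} [Group W] {M : CoxeterMatrix B} {cs : CoxeterSystem M W}
  {k : Type uk} {V : Type uV} [Field k] [AddCommGroup V] [Module k V] {ρ : Realization cs k V}
  {d : ℕ} {I : Fin (d + 1) → Set B}

/-! ### Evaluating light leaves on dual sprinkles -/

theorem dualSprinkle_of_not_subset (U : SprinkledPath cs I) (P : Fin d → ρ.Poly) {n : ℕ}
    (h : n < d) (hj : ¬ I (Fin.castSucc ⟨n, h⟩) ⊆ I (Fin.succ ⟨n, h⟩)) :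
    ρ.dualSprinkle U P n = 1 := by
  rw [dualSprinkle]
  split_ifs <;> rfl

/-- The general formula is also correct at index `0`, where the factor is `1` by definition: there
the dual entry is `w_{I₀} w_{I₁}`, so `∂_{I₀}` and `∂_{w_{I₀} w_{I₁}}` compose to `∂_{I₁}`, and
`∂_{I₁} P = 1`. -/
theorem IsAdmissible.dualSprinkle_of_subset (hρ : ρ.IsAdmissible) (U : SprinkledPath cs I)
    (P : Fin d → ρ.Poly) {n : ℕ} (h : n < d)
    (hj : I (Fin.castSucc ⟨n, h⟩) ⊆ I (Fin.succ ⟨n, h⟩))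
    (hfin : Finitary cs (I (Fin.succ ⟨n, h⟩)))
    (hP : ρ.demazureSet (I (Fin.succ ⟨n, h⟩)) (P ⟨n, h⟩) = 1) :
    ρ.dualSprinkle U P n = ρ.demazureSet (I (Fin.castSucc ⟨n, h⟩))
      (ρ.demazureElt (U.dualSeq ⟨n, h⟩) (P ⟨n, h⟩)) := by
  rcases Nat.eq_zero_or_pos n with rfl | h0
  · have hJ := hfin.mono hj
    have hl := (leftMax_longest hfin).length_eq (longest_mem_of_subset hj hfin)
    rw [longest_inv hJ] at hl
    have e : longest cs (I (Fin.castSucc ⟨0, h⟩)) *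
        (longest cs (I (Fin.castSucc ⟨0, h⟩)) * longest cs (I (Fin.succ ⟨0, h⟩))) =
          longest cs (I (Fin.succ ⟨0, h⟩)) := by
      rw [← mul_assoc, longest_mul_self hJ, one_mul]
    rw [U.dualSeq_zero rfl hj, demazureSet, ← hρ.demazureElt_mul (by rw [e, hl]), e, hP,
      dualSprinkle, dif_neg (fun h' => h'.1.false)]
  · rw [dualSprinkle, dif_pos ⟨h0, h⟩, if_pos hj]

theorem dualSprinkle_last (U : SprinkledPath cs I) (P : Fin d → ρ.Poly) :
    ρ.dualSprinkle U P d = 1 := by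
  rw [dualSprinkle, dif_neg fun h => h.2.false]

theorem IsAdmissible.eval_stepLeaf_up (hρ : ρ.IsAdmissible) {I₀ J J' : Set B} {p q : Set W}
    (hJ' : Finitary cs J') (hJ : J ⊆ J') {f : ρ.Poly} {X X' : List (Set B)}
    {S : Diag ρ I₀ (X ++ [J']) X'} (hS : ρ.IsStepLeaf I₀ J J' p q f X X' S) {g : ℕ → ρ.Poly}
    (hg : g 0 ∈ ρ.inv J) (hg1 : g 1 = 1) {Q : ρ.Poly}
    (hf : f = ρ.demazureSet (leftRed cs (rightRed cs I₀ J' q) J (grassmannian cs I₀ J J' p q)) Q) :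
    (ρ.demazureSet (rightRed cs I₀ J' q)
        (Q * ρ.demazureElt (minElt cs (grassmannian cs I₀ J J' p q)) (g 0)) = 1 →
      S.eval (appendMap (fun K => ρ.pureTensor K [J'] g) I₀ X (ρ.oneTensor _ _)) =
        ρ.oneTensor I₀ X') ∧
    (ρ.demazureSet (rightRed cs I₀ J' q)
        (Q * ρ.demazureElt (minElt cs (grassmannian cs I₀ J J' p q)) (g 0)) = 0 →
      S.eval (appendMap (fun K => ρ.pureTensor K [J'] g) I₀ X (ρ.oneTensor _ _)) = 0) := by
  cases hS with
  | @up hE Z T Y X E h =>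
    have e := hρ.eval_stepUp hJ' hE h hg hg1 Q hf (by simp only [List.append_assoc])
      (by simp only [List.append_assoc])
    refine ⟨fun h1 => e.trans ?_, fun h0 => e.trans ?_⟩
    · rw [h1, toInv_one, one_smul, leftMap_oneTensor]
    · rw [h0, toInv_of_mem (zero_mem _)]
      exact (congrArg (leftMap I₀ Z) (zero_smul _ _)).trans (map_zero _)
  | down hE h hlast => exact (not_subset_of_isEdge hE hJ).elim

theorem eval_stepLeaf_down {I₀ J J' : Set B} {p q : Set W} (hJ : ¬ J ⊆ J') {f : ρ.Poly}
    {X X' : List (Set B)} {S : Diag ρ I₀ (X ++ [J']) X'}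
    (hS : ρ.IsStepLeaf I₀ J J' p q f X X' S) :
    S.eval (ρ.oneTensor I₀ (X ++ [J'])) = ρ.oneTensor I₀ X' := by
  cases hS with
  | up hE h => exact (hJ hE.sub).elim
  | down hE h hlast => exact eval_stepDown hE h.sinister hlast _ _ _

open Classical in
/-- The polynomial that comes out of an ascending step. -/
theorem IsAdmissible.demazureSet_sprinkle (hρ : ρ.IsAdmissible) {r : W → W → Prop}
    (hr : IsStrictTotalOrder W r) (hlen : ∀ x y, cs.length x < cs.length y → r x y)
    (T U : SprinkledPath cs I) {j : Fin d} (hj : I j.castSucc ⊆ I j.succ)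
    (hfin : Finitary cs (I j.succ)) (hTU : T.dualSeq j = U.dualSeq j ∨ r (T.dualSeq j) (U.dualSeq j))
    {P P' : ρ.Poly} (hP : ρ.demazureSet (I j.succ) P = 1)
    (hP' : ρ.demazureSet (T.err j) P' = 1) :
    ρ.demazureSet (T.err j) (ρ.demazureElt (T.y j) P' *
      ρ.demazureElt ((minElt cs (T.t j.succ))⁻¹ * minElt cs (T.t j.castSucc))
        (ρ.demazureSet (I j.castSucc) (ρ.demazureElt (U.dualSeq j) P))) =
      if T.dualSeq j = U.dualSeq j then 1 else 0 := by
  set x := (minElt cs (T.t j.succ))⁻¹ * minElt cs (T.t j.castSucc) with hx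
  have hp := T.t_coset j.castSucc
  have hq := T.t_coset j.succ
  have hpq := T.t_up j hj
  have hJ := hfin.mono hj
  have hR : Finitary cs (T.err j) := hfin.mono (rightRed_subset _ _ _)
  have hy := T.y_mem j hj
  have hl1 := (rightMin_grassmannian hp hq hpq hj).length_mul (longest_mem hJ)
  have hl2 := length_inv_mul_longest hp hq hpq hj hfin hy (T.y_min j hj)
  have hTm := T.dualSeq_mem hj hfin
  have hUm := U.dualSeq_mem hj hfin
  -- This identity explains the shape of the dual sequence: the operator reaching `P'` is
  -- complementary to `y°` in `w_{I_{j+1}}`.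
  have e : (T.y j)⁻¹ * (x * longest cs (I j.castSucc)) =
      longest cs (I j.succ) * (T.dualSeq j)⁻¹ := by
    rw [T.dualSeq_eq]
    simp only [mul_inv_rev, longest_inv hJ, longest_inv hfin]
    rw [← mul_assoc (longest cs (I j.succ)), longest_mul_self hfin, one_mul, hx, inv_inv, inv_inv]
  rw [hρ.demazureSet_adjoint hR hy, demazureSet, ← hρ.demazureElt_mul hl1,
    ← hρ.demazureElt_mul hl2, e]
  -- The order refines length, so `◁` never lowers it; the pairing requires exactly this inequality.
  have hle : cs.length (T.dualSeq j) ≤ cs.length (U.dualSeq j) := by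
    rcases hTU with h | h
    · rw [h]
    · by_contra! h'
      exact hr.irrefl _ (hr.trans _ _ _ h (hlen _ _ h'))
  have hT1 := length_longest_eq hfin hTm
  have hU1 := length_longest_eq hfin hUm
  have key := hρ.demazureElt_pairing hfin hP
    (mul_mem (longest_mem hfin) (inv_mem hTm)) (mul_mem (longest_mem hfin) (inv_mem hUm))
    (by omega)
  rw [mul_inv_rev, inv_inv, inv_mul_cancel_right] at key
  rw [key]
  by_cases h : T.dualSeq j = U.dualSeq j
  · rw [if_pos (by rw [h]), if_pos h, mul_one]
    exact hP'
  · rw [if_neg fun h' => h (inv_injective (mul_left_cancel h')), if_neg h, mul_zero, map_zero]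

/-- Induction on `n` with `g` arbitrary, because the truncated tensor must end in `1`: the dual
sprinkle in the region `I_n` belongs to the next step. -/
theorem IsAdmissible.eval_lightLeaf (hρ : ρ.IsAdmissible) {r : W → W → Prop}
    (hr : IsStrictTotalOrder W r) (hlen : ∀ x y, cs.length x < cs.length y → r x y)
    (hfin : ∀ j, Finitary cs (I j)) {T : SprinkledPath cs I} (U : SprinkledPath cs I)
    {P : Fin d → ρ.Poly}
    (hP : ∀ j : Fin d, I j.castSucc ⊆ I j.succ → ρ.IsNormalized (I j.succ) (P j))
    {n : ℕ} {hn : n ≤ d} {X : List (Set B)} {D : Diag ρ (I 0) (tailList I n hn) X}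
    (hD : ρ.IsLightLeaf T n hn X D) {g : ℕ → ρ.Poly}
    (hg : ∀ i < n, g i = ρ.dualSprinkle U P i) (hgn : g n = 1) :
    ((∀ j : Fin d, j.1 < n → I j.castSucc ⊆ I j.succ → T.dualSeq j = U.dualSeq j) →
      D.eval (ρ.pureTensor (I 0) (tailList I n hn) g) = ρ.oneTensor (I 0) X) ∧
    (∀ j : Fin d, j.1 < n → I j.castSucc ⊆ I j.succ → r (T.dualSeq j) (U.dualSeq j) →
      (∀ i < j, I i.castSucc ⊆ I i.succ → T.dualSeq i = U.dualSeq i) →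
      D.eval (ρ.pureTensor (I 0) (tailList I n hn) g) = 0) := by
  induction hD generalizing g with
  | zero =>
    refine ⟨fun _ => ?_, fun j hj => absurd hj (Nat.not_lt_zero _)⟩
    exact congrArg (ρ.toInv (I 0)) hgn
  | @succ n hn X₁ X₂ X₃ D rex S f hD hrex hf hS ih =>
    set g' : ℕ → ρ.Poly := fun i => if i < n then g i else 1 with hg'
    have hg1 : ∀ i < n, g' i = g i := fun i hi => if_pos hi
    have hg2 : g' n = 1 := if_neg (lt_irrefl n)
    have hlenT := length_tailList I n (Nat.le_of_succ_le hn)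
    set y : ∀ K, ρ.BS K [I (Fin.succ ⟨n, hn⟩)] := fun K =>
      ρ.pureTensor K [I (Fin.succ ⟨n, hn⟩)] fun i => g (i + n) with hy
    have e1 : ρ.pureTensor (I 0) (tailList I (n + 1) hn) g =
        appendMap y (I 0) (tailList I n (Nat.le_of_succ_le hn))
          (ρ.pureTensor (I 0) (tailList I n (Nat.le_of_succ_le hn)) g') := by
      have := pureTensor_append [I (Fin.succ ⟨n, hn⟩)] (I 0)
        (tailList I n (Nat.le_of_succ_le hn)) g g' (by rwa [hlenT]) (by rwa [hlenT])
      rw [hlenT] at this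
      exact this
    have e2 : ((D.right [I (Fin.succ ⟨n, hn⟩)]).comp
        ((rex.right [I (Fin.succ ⟨n, hn⟩)]).comp S)).eval
          (ρ.pureTensor (I 0) (tailList I (n + 1) hn) g) =
        S.eval (appendMap y (I 0) X₂ (rex.eval (D.eval
          (ρ.pureTensor (I 0) (tailList I n (Nat.le_of_succ_le hn)) g')))) := by
      rw [e1]
      refine (congrArg (fun t => S.eval ((rex.right [I (Fin.succ ⟨n, hn⟩)]).eval t))
        (eval_right y D _)).trans (congrArg S.eval (eval_right y rex _))
    obtain ⟨ih1, ih2⟩ := ih (g := g')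
      (fun i hi => (hg1 i hi).trans (hg i (hi.trans n.lt_succ_self))) hg2
    have hy0 : g n = ρ.dualSprinkle U P n := hg n n.lt_succ_self
    have e3 : (∀ j : Fin d, j.1 < n → I j.castSucc ⊆ I j.succ → T.dualSeq j = U.dualSeq j) →
        ((D.right [I (Fin.succ ⟨n, hn⟩)]).comp
        ((rex.right [I (Fin.succ ⟨n, hn⟩)]).comp S)).eval
          (ρ.pureTensor (I 0) (tailList I (n + 1) hn) g) =
        S.eval (appendMap y (I 0) X₂ (ρ.oneTensor (I 0) X₂)) := fun h => by
      rw [e2, ih1 h, hρ.eval_rexMove hrex]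
    -- A value `0` reached earlier persists, since all later maps are additive.
    have e4 : ∀ j : Fin d, j.1 < n → I j.castSucc ⊆ I j.succ →
        r (T.dualSeq j) (U.dualSeq j) →
        (∀ i < j, I i.castSucc ⊆ I i.succ → T.dualSeq i = U.dualSeq i) →
        ((D.right [I (Fin.succ ⟨n, hn⟩)]).comp
        ((rex.right [I (Fin.succ ⟨n, hn⟩)]).comp S)).eval
          (ρ.pureTensor (I 0) (tailList I (n + 1) hn) g) = 0 := fun j hlt hja hjr hji => by
      rw [e2, ih2 j hlt hja hjr hji, map_zero, map_zero, map_zero]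
    by_cases hj : I (Fin.castSucc ⟨n, hn⟩) ⊆ I (Fin.succ ⟨n, hn⟩)
    · obtain ⟨-, P', hP', hf⟩ | ⟨hf, -⟩ := hf
      swap
      · exact absurd hj hf
      have hPn := (hP ⟨n, hn⟩ hj).2
      have eg : g n = _ :=
        hy0.trans (hρ.dualSprinkle_of_subset U P hn hj (hfin _) hPn)
      have hpar := parabolic_leftRed_grassmannian (T.t_coset (Fin.castSucc ⟨n, hn⟩))
        (T.t_coset (Fin.succ ⟨n, hn⟩)) (T.t_up ⟨n, hn⟩ hj) hj
      have hm := minElt_grassmannian (T.t_coset (Fin.castSucc ⟨n, hn⟩))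
        (T.t_coset (Fin.succ ⟨n, hn⟩)) (T.t_up ⟨n, hn⟩ hj) hj
      -- The sprinkle is formed with `𝓁_j`, the elementary light leaf with the left redundancy of
      -- `m`; both generate the same parabolic subgroup.
      rw [show ρ.demazureSet (T.ell ⟨n, hn⟩) = _ from (demazureSet_congr hpar).symm] at hf
      have hS' := hρ.eval_stepLeaf_up (hfin _) hj hS (g := fun i => g (i + n))
        (by
          rw [zero_add, eg]
          exact hρ.demazureSet_mem_inv (hfin _) _)
        (by
          rw [add_comm, hgn]) hf
      have hval := hρ.demazureSet_sprinkle hr hlen T U hj (hfin _) (P' := P') (hP := hPn)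
        (hP' := hP'.2)
      simp only [zero_add, eg, hm] at hS'
      refine ⟨fun h => ?_, fun j hjn hja hjr hji => ?_⟩
      · have h' := h ⟨n, hn⟩ n.lt_succ_self hj
        exact (e3 fun j hj => h j (hj.trans n.lt_succ_self)).trans <| hS'.1 ((hval (Or.inl h')).trans (if_pos h'))
      · rcases Nat.lt_succ_iff_lt_or_eq.1 hjn with hlt | heq
        · exact e4 j hlt hja hjr hji
        · obtain rfl : j = ⟨n, hn⟩ := Fin.ext heq
          exact (e3 fun i hi => hji i hi).trans <| hS'.2 ((hval (Or.inr hjr)).trans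
            (if_neg fun h => hr.irrefl _ (h ▸ hjr : r (U.dualSeq _) (U.dualSeq _))))
    -- At a descending index both factors of the appended pair are `1`.
    · have hy1 : y = fun K => ρ.oneTensor K [I (Fin.succ ⟨n, hn⟩)] := by
        funext K
        refine congrArg₂ (fun a b => (ρ.tm _ (ρ.toInv K a) (ρ.toInv _ b) :
          ρ.Tens K (I (Fin.succ ⟨n, hn⟩)) (ρ.inv _))) ?_ ?_
        · change g (0 + n) = 1
          rw [zero_add, hy0, dualSprinkle_of_not_subset U P hn hj]
        · change g (1 + n) = 1
          rw [add_comm, hgn]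
      refine ⟨fun h => ?_, fun j hjn hja hjr hji => ?_⟩
      · refine (e3 fun j hj => h j (hj.trans n.lt_succ_self)).trans ?_
        rw [hy1, appendMap_oneTensor]
        exact eval_stepLeaf_down hj hS
      · rcases Nat.lt_succ_iff_lt_or_eq.1 hjn with hlt | heq
        · exact e4 j hlt hja hjr hji
        · obtain rfl : j = ⟨n, hn⟩ := Fin.ext heq
          exact absurd hja hj

end Realization

end SingularSoergel

theorem mainTheorem7 {B W k V : Type*} [Group W] [Field k] [AddCommGroup V] [Module k V]
    {M : CoxeterMatrix B} (cs : CoxeterSystem M W)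
    (ρ : SingularSoergel.Realization cs k V) (hρ : ρ.IsAdmissible)
    (r : W → W → Prop) (hr : IsStrictTotalOrder W r)
    (hlen : ∀ x y, cs.length x < cs.length y → r x y)
    {d : ℕ} (I : Fin (d + 1) → Set B)
    (hfin : ∀ j, SingularSoergel.Finitary cs (I j))
    (hstep : ∀ j : Fin d, SingularSoergel.SingleStep (I j.castSucc) (I j.succ)) :
    (∀ p : Set W, IsStrictTotalOrder {T : SingularSoergel.SprinkledPath cs I // T.term = p}
      (fun T U => T.1.Prec r U.1)) ∧
    ∀ T U : SingularSoergel.SprinkledPath cs I, T.term = U.term →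
      ∀ (X : List (Set B))
        (LL : SingularSoergel.Realization.Diag ρ (I 0)
          (SingularSoergel.tailList I d le_rfl) X),
      ρ.IsLightLeaf T d le_rfl X LL →
      ∀ P : Fin d → ρ.Poly,
        (∀ j : Fin d, I j.castSucc ⊆ I j.succ → ρ.IsNormalized (I j.succ) (P j)) →
        (T = U → LL.eval (ρ.dualElement U P) = ρ.oneTensor (I 0) X) ∧
        (T.Prec r U → LL.eval (ρ.dualElement U P) = 0) := by
  refine ⟨SingularSoergel.SprinkledPath.isStrictTotalOrder_prec hr hstep,
    fun T U _ X LL hLL P hP => ?_⟩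
  obtain ⟨h1, h2⟩ := hρ.eval_lightLeaf hr hlen hfin U hP hLL (g := ρ.dualSprinkle U P)
    (fun _ _ => rfl) (SingularSoergel.Realization.dualSprinkle_last U P)
  exact ⟨fun h => h1 fun j _ _ => h ▸ rfl,
    fun ⟨j, hj, hjr, hji⟩ => h2 j j.2 hj hjr hji⟩
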